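/- Let $\mathbb K$ be a field of characteristic $0$ and let $\mathfrak g$ be a finite-dimensional Lie algebra over $\mathbb K$. Its derivation tower is $\mathfrak g_0=\mathfrak g$, $\mathfrak g_{n+1}=\mathrm{Der}\,\mathfrak g_n$. A Lie algebra is complete if its center $Z$ is $0$ and all its derivations are inner, and perfect if it equals its derived ideal. The tower terminates at $\widehat{\mathfrak g}$ if $\mathfrak g_n\cong\widehat{\mathfrak g}$ as Lie algebras for all sufficiently large $n$, where $\widehat{\mathfrak g}$ is a term of the tower. A $\Gamma$-triple of a Lie algebra $\mathfrak h$ with radical $\mathfrak r$ is a triple $(\mathfrak s,\mathfrak k,\mathfrak m)$ where $\mathfrak s$ is a Levi subalgebra of $\mathfrak h$, $\mathfrak k$ is a nilpotent subalgebra with $[\mathfrak s,\mathfrak k]=0$, and $\mathfrak m\subset\mathfrak r$ is a subspace with $\mathfrak r=\mathfrak m\oplus\mathfrak k$ and $[\mathfrak s\oplus\mathfrak k,\mathfrak m]=\mathfrak m$ (linear span of brackets); thus $\mathfrak h=\mathfrak s\oplus\mathfrak k\oplus\mathfrak m$. Put $\Gamma=\mathrm{ad}\,\mathfrak s+(\mathrm{ad}\,\mathfrak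 k)|_S$, where $(\mathrm{ad}\,\mathfrak k)|_S$ is spanned by the semisimple components (Jordan decomposition) of the $\mathrm{ad}\,x$, $x\in\mathfrak k$. Let $\mu:\mathfrak k\to\mathfrak{gl}(\mathfrak m)$, $\mu(x)=\mathrm{ad}\,x|_{\mathfrak m}$; let $\hat{\mathfrak n}$ be the subalgebra generated by $\mathfrak m$; let $\mathfrak B=(\mathrm{Der}\,\hat{\mathfrak n})^\Gamma|_{\mathfrak m}\subset\mathfrak{gl}(\mathfrak m)$ be the algebra of restrictions to $\mathfrak m$ of the derivations of $\hat{\mathfrak n}$ commuting with $\Gamma|_{\hat{\mathfrak n}}$. Let $N^0=\mu(\mathfrak k)$ and let $N^{n+1}$ be the normalizer of $N^n$ in $\mathfrak B$. On $\mathfrak s\oplus\mathfrak{gl}(\mathfrak m)\oplus\mathfrak m$ consider the bracket given by the brackets of $\mathfrak s$ and $\mathfrak{gl}(\mathfrak m)$, $[\mathfrak s,\mathfrak{gl}(\mathfrak m)]=0$, the bracket of $\mathfrak h$ on $\mathfrak s\times\mathfrak m$, $[y,z]=y(z)$ for $y\in\mathfrak{gl}(\mathfrak m)$, $z\in\mathfrak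 m$, and $[z_1,z_2]=\mu(k)+m$ for $z_1,z_2\in\mathfrak m$, where $k,m$ are the components in $\mathfrak k,\mathfrak m$ of the bracket of $z_1,z_2$ in $\mathfrak h$. **Theorem.** Exactly one of the following holds. 1. $Z(\mathfrak g_n)=0$ for all sufficiently large $n$, and the tower terminates at a complete Lie algebra, all $\mathfrak g_n$ being complete for large $n$. Moreover, whenever $Z(\mathfrak g_p)=0$, the algebra $\mathfrak g_p$ has a $\Gamma$-triple, and for every $\Gamma$-triple $(\mathfrak s,\mathfrak k,\mathfrak m)$ of $\mathfrak g_p$: there are linear bijections $\varphi_n:\mathfrak g_{p+n}\to\mathfrak s\oplus N^n\oplus\mathfrak m$ $(n\ge0)$ carrying the bracket of $\mathfrak g_{p+n}$ to the one above, with $\varphi_0(x+y+z)=(x,\mu(y),z)$ for $x\in\mathfrak s$, $y\in\mathfrak k$, $z\in\mathfrak m$, and $\varphi_{n+1}(\mathrm{ad}\,a)=\varphi_n(a)$ for $a\in\mathfrak g_{p+n}$; and there is $q$ with $N^n=N^q$ for all $n\ge q$, such that $\mathfrak g_{p+n}\cong\mathfrak s\oplus N^q\oplus\mathfrak m$ is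 complete for all $n\ge q$. 2. $Z(\mathfrak g_n)\ne0$ for all $n$, and the tower terminates at a Lie algebra $\widehat{\mathfrak g}\cong\mathbb K\times[\widehat{\mathfrak g},\widehat{\mathfrak g}]$ with $[\widehat{\mathfrak g},\widehat{\mathfrak g}]$ perfect and complete. 3. The sequence $(\dim\mathfrak g_n)_n$ is non-decreasing and tends to infinity. -/

import Mathlib

universe u v

-- The commutator bracket on associative algebras, used for `End V` and for the abelian
-- one-dimensional Lie algebra `K`.
attribute [local instance 100] LieRing.ofAssociativeRing

namespace DerTower

section Basic

variable (K : Type u) [Field K] (L : Type v) [LieRing L] [LieAlgebra K L]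

/-- A Lie algebra is complete if its center is trivial and all its derivations are inner. -/
def IsComplete : Prop :=
  LieAlgebra.center K L = ⊥ ∧ ∀ D : LieDerivation K L L, ∃ x : L, D = LieDerivation.ad K L x

/-- The derived ideal `[L, L]`. -/
abbrev derivedIdeal : LieIdeal K L := ⁅(⊤ : LieIdeal K L), (⊤ : LieIdeal K L)⁆

/-- A Lie algebra is perfect if it is equal to its derived ideal. -/
def IsPerfect : Prop := derivedIdeal K L = ⊤

end Basic

section Tower

/-- A Lie algebra together with its underlying type. -/
structure BundledLieAlgebra (K : Type u) [Field K] where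
  carrier : Type v
  [lieRing : LieRing carrier]
  [lieAlgebra : LieAlgebra K carrier]

attribute [instance] BundledLieAlgebra.lieRing BundledLieAlgebra.lieAlgebra

/-- The sequence `g₀ = g`, `gₙ₊₁ = Der gₙ`. -/
def bundledTower (K : Type u) [Field K] (g : Type v) [LieRing g] [LieAlgebra K g] :
    ℕ → BundledLieAlgebra.{u, v} K
  | 0 => ⟨g⟩
  | n + 1 => ⟨LieDerivation K (bundledTower K g n).carrier (bundledTower K g n).carrier⟩

variable (K : Type u) [Field K] (g : Type v) [LieRing g] [LieAlgebra K g]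

/-- The `n`-th term `gₙ` of the derivation tower of `g`. -/
abbrev tower (n : ℕ) : Type v := (bundledTower K g n).carrier

/-- The adjoint map `gₙ → gₙ₊₁ = Der gₙ`. -/
def towerAd (n : ℕ) : tower K g n →ₗ⁅K⁆ tower K g (n + 1) :=
  LieDerivation.ad K (tower K g n)

end Tower

section Gamma

/-- A `Γ`-triple `(s, k, m)` of `L`: `s` is a Levi subalgebra, `k` is a nilpotent subalgebra
commuting with `s`, and `m` is a subspace of the radical `r` with `r = m ⊕ k` and
`[s ⊕ k, m] = m`. Since `L = s ⊕ r`, one gets `L = s ⊕ k ⊕ m`. -/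
structure GammaTriple (K : Type u) [Field K] (L : Type v) [LieRing L] [LieAlgebra K L] where
  s : LieSubalgebra K L
  k : LieSubalgebra K L
  m : Submodule K L
  semisimple_s : LieAlgebra.HasTrivialRadical K s
  isCompl_s : IsCompl s.toSubmodule (LieAlgebra.radical K L).toSubmodule
  nilpotent_k : LieRing.IsNilpotent k
  lie_s_k : ∀ x ∈ s, ∀ y ∈ k, ⁅x, y⁆ = 0
  disjoint_m_k : Disjoint m k.toSubmodule
  sup_m_k : m ⊔ k.toSubmodule = (LieAlgebra.radical K L).toSubmodule
  span_lie : Submodule.span K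
    {w : L | ∃ x ∈ s.toSubmodule ⊔ k.toSubmodule, ∃ z ∈ m, ⁅x, z⁆ = w} = m

namespace GammaTriple

variable {K : Type u} [Field K] {L : Type v} [LieRing L] [LieAlgebra K L] (T : GammaTriple K L)

theorem lie_mem_of_mem_sup {x z : L} (hx : x ∈ T.s.toSubmodule ⊔ T.k.toSubmodule)
    (hz : z ∈ T.m) : ⁅x, z⁆ ∈ T.m := by
  have h : ⁅x, z⁆ ∈ Submodule.span K
      {w : L | ∃ x ∈ T.s.toSubmodule ⊔ T.k.toSubmodule, ∃ z ∈ T.m, ⁅x, z⁆ = w} :=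
    Submodule.subset_span ⟨x, hx, z, hz, rfl⟩
  rwa [T.span_lie] at h

theorem lie_s_mem {x z : L} (hx : x ∈ T.s) (hz : z ∈ T.m) : ⁅x, z⁆ ∈ T.m :=
  T.lie_mem_of_mem_sup (Submodule.mem_sup_left hx) hz

theorem lie_k_mem {x z : L} (hx : x ∈ T.k) (hz : z ∈ T.m) : ⁅x, z⁆ ∈ T.m :=
  T.lie_mem_of_mem_sup (Submodule.mem_sup_right hx) hz

theorem isCompl_k : IsCompl T.k.toSubmodule (T.m ⊔ T.s.toSubmodule) := by
  constructor
  · refine (T.disjoint_m_k.symm).disjoint_sup_right_of_disjoint_sup_left ?_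
    rw [sup_comm, T.sup_m_k]
    exact T.isCompl_s.disjoint.symm
  · rw [codisjoint_iff, ← sup_assoc, sup_comm T.k.toSubmodule, T.sup_m_k, sup_comm]
    exact T.isCompl_s.sup_eq_top

theorem isCompl_m : IsCompl T.m (T.k.toSubmodule ⊔ T.s.toSubmodule) := by
  constructor
  · refine (T.disjoint_m_k).disjoint_sup_right_of_disjoint_sup_left ?_
    rw [T.sup_m_k]
    exact T.isCompl_s.disjoint.symm
  · rw [codisjoint_iff, ← sup_assoc, T.sup_m_k, sup_comm]
    exact T.isCompl_s.sup_eq_top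

/-- The projection of `L = s ⊕ k ⊕ m` onto `k`. -/
noncomputable def projK : L →ₗ[K] T.k.toSubmodule :=
  T.k.toSubmodule.projectionOnto _ T.isCompl_k

/-- The projection of `L = s ⊕ k ⊕ m` onto `m`. -/
noncomputable def projM : L →ₗ[K] T.m :=
  T.m.projectionOnto _ T.isCompl_m

/-- The representation `μ : k → gl(m)`, `x ↦ ad x |ₘ`. -/
def mu : T.k →ₗ⁅K⁆ Module.End K T.m where
  toFun x :=
    { toFun := fun z => ⟨⁅(x : L), (z : L)⁆, T.lie_k_mem x.2 z.2⟩
      map_add' := fun a b => Subtype.ext (by simp)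
      map_smul' := fun c a => Subtype.ext (by simp) }
  map_add' x y := by ext z; simp
  map_smul' c x := by ext z; simp
  map_lie' {x y} := by ext z; simp [LieRing.of_associative_ring_bracket]

/-- `Γ = ad s + (ad k)|_S`, where `(ad k)|_S` consists of the semisimple components, in the
Jordan decomposition, of the endomorphisms `ad x` with `x ∈ k`. -/
def Gamma : Submodule K (Module.End K L) :=
  T.s.toSubmodule.map (LieAlgebra.ad K L : L →ₗ[K] Module.End K L) ⊔
    Submodule.span K {S | ∃ x ∈ T.k, ∃ N : Module.End K L,
      S.IsSemisimple ∧ IsNilpotent N ∧ Commute S N ∧ LieAlgebra.ad K L x = S + N}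

/-- The Lie subalgebra `n̂` of `L` generated by `m`. -/
def nHat : LieSubalgebra K L := LieSubalgebra.lieSpan K L (T.m : Set L)

theorem mem_nHat {z : L} (hz : z ∈ T.m) : z ∈ T.nHat :=
  LieSubalgebra.subset_lieSpan hz

/-- The derivation `D` of `n̂` commutes with the restrictions to `n̂` of the elements of `Γ`:
`D (γ x) = γ (D x)` for `γ ∈ Γ` and `x ∈ n̂`; here `y` stands for `γ x`, seen in `n̂`. -/
def CommutesWithGamma (D : LieDerivation K T.nHat T.nHat) : Prop :=
  ∀ γ ∈ T.Gamma, ∀ x y : T.nHat, (y : L) = γ (x : L) → ((D y : T.nHat) : L) = γ (D x : T.nHat)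

/-- `B = (Der n̂)^Γ |ₘ`: the endomorphisms of `m` which are restrictions of derivations of `n̂`
commuting with `Γ`. -/
def B : LieSubalgebra K (Module.End K T.m) where
  carrier := {f | ∃ D : LieDerivation K T.nHat T.nHat, T.CommutesWithGamma D ∧
    ∀ z : T.m, ((f z : T.m) : L) = (D ⟨z, T.mem_nHat z.2⟩ : T.nHat)}
  zero_mem' := ⟨0, fun γ _ x y _ => by simp, fun z => by simp⟩
  add_mem' := by
    rintro f f' ⟨D, hD, h⟩ ⟨D', hD', h'⟩
    refine ⟨D + D', fun γ hγ x y hxy => ?_, fun z => ?_⟩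
    · simp [hD γ hγ x y hxy, hD' γ hγ x y hxy]
    · simp [h, h']
  smul_mem' := by
    rintro c f ⟨D, hD, h⟩
    refine ⟨c • D, fun γ hγ x y hxy => ?_, fun z => ?_⟩
    · simp [hD γ hγ x y hxy]
    · simp [h]
  lie_mem' := by
    rintro f f' ⟨D, hD, h⟩ ⟨D', hD', h'⟩
    refine ⟨⁅D, D'⁆, fun γ hγ x y hxy => ?_, fun z => ?_⟩
    · have h1 := hD γ hγ _ _ (hD' γ hγ x y hxy)
      have h2 := hD' γ hγ _ _ (hD γ hγ x y hxy)
      simp [h1, h2]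
    · have e1 : D' ⟨z, T.mem_nHat z.2⟩ = ⟨f' z, T.mem_nHat (f' z).2⟩ := Subtype.ext (h' z).symm
      have e2 : D ⟨z, T.mem_nHat z.2⟩ = ⟨f z, T.mem_nHat (f z).2⟩ := Subtype.ext (h z).symm
      rw [LieDerivation.commutator_apply, e1, e2, AddSubgroupClass.coe_sub, ← h, ← h']
      rfl

/-- The sequence of normalizers in `B`: `N⁰ = μ(k)` and `Nⁿ⁺¹ = N_B(Nⁿ)`. -/
def normalizerSeq : ℕ → LieSubalgebra K (Module.End K T.m)
  | 0 => T.mu.range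
  | n + 1 => (normalizerSeq n).normalizer ⊓ T.B

/-- The bracket on `s ⊕ gl(m) ⊕ m`:
* on `s` it is the bracket of `L`, on `gl(m)` the commutator, and `[s, gl(m)] = 0`;
* `s` acts on `m` by the bracket of `L`, and `gl(m)` acts on `m` by evaluation;
* `[z₁, z₂] = μ(k) + m` for `z₁, z₂ ∈ m`, where `k` and `m` are the components in `k` and `m` of
  the bracket `[z₁, z₂]` of `L`. -/
noncomputable def Phi (a b : T.s × Module.End K T.m × T.m) : T.s × Module.End K T.m × T.m :=
  (⁅a.1, b.1⁆,
   ⁅a.2.1, b.2.1⁆ + T.mu (T.projK ⁅(a.2.2 : L), (b.2.2 : L)⁆),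
   (⟨⁅(a.1 : L), (b.2.2 : L)⁆, T.lie_s_mem a.1.2 b.2.2.2⟩ : T.m)
     - (⟨⁅(b.1 : L), (a.2.2 : L)⁆, T.lie_s_mem b.1.2 a.2.2.2⟩ : T.m)
     + a.2.1 b.2.2 - b.2.1 a.2.2 + T.projM ⁅(a.2.2 : L), (b.2.2 : L)⁆)

end GammaTriple

end Gamma

section Cases

variable (K : Type u) [Field K] (g : Type v) [LieRing g] [LieAlgebra K g]

/-- The part of the tower of `g` above `gₚ` is given by the `Γ`-triple `(s, k, m)` of `gₚ`:
* there are compatible isomorphisms `φₙ` of `gₚ₊ₙ` onto the subspace `s ⊕ Nⁿ ⊕ m` of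
  `s ⊕ gl(m) ⊕ m` with the bracket `Phi`, such that `φ₀` is `x + y + z ↦ (x, μ(y), z)` and `ad`
  becomes the inclusion of `s ⊕ Nⁿ ⊕ m` in `s ⊕ Nⁿ⁺¹ ⊕ m`;
* the sequence of normalizers terminates at some `N^q`, and the algebras `gₚ₊ₙ`, which are
  `s ⊕ N^q ⊕ m` for `n ≥ q`, are complete from there on. -/
def GivenByNormalizers (p : ℕ) (T : GammaTriple K (tower K g p)) : Prop :=
  (∃ φ : ∀ n : ℕ, tower K g (p + n) →ₗ[K] T.s × Module.End K T.m × T.m,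
    (∀ n, Function.Injective (φ n) ∧
      Set.range (φ n) = {t | t.2.1 ∈ T.normalizerSeq n} ∧
      ∀ a b, φ n ⁅a, b⁆ = T.Phi (φ n a) (φ n b)) ∧
    (∀ (x : T.s) (y : T.k) (z : T.m),
      φ 0 ((x : tower K g p) + (y : tower K g p) + (z : tower K g p)) = (x, T.mu y, z)) ∧
    (∀ (n : ℕ) (a : tower K g (p + n)), φ (n + 1) (towerAd K g (p + n) a) = φ n a)) ∧
  ∃ q : ℕ, T.normalizerSeq (q + 1) = T.normalizerSeq q ∧
    ∀ n, q ≤ n → T.normalizerSeq n = T.normalizerSeq q ∧ IsComplete K (tower K g (p + n))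

/-- The tower terminates at `g_q`: up to isomorphism it is constant from `g_q` on. -/
def TerminatesAt (q : ℕ) : Prop :=
  ∀ n, q ≤ n → Nonempty (tower K g n ≃ₗ⁅K⁆ tower K g q)

/-- First case: the centers are eventually trivial, and the tower terminates at a complete Lie
algebra, which is the one obtained from any `Γ`-triple of any term with trivial center. -/
def CaseOne : Prop :=
  (∃ N : ℕ, ∀ n, N ≤ n → LieAlgebra.center K (tower K g n) = ⊥) ∧
  (∃ q : ℕ, TerminatesAt K g q ∧ ∀ n, q ≤ n → IsComplete K (tower K g n)) ∧
  ∀ p : ℕ, LieAlgebra.center K (tower K g p) = ⊥ →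
    Nonempty (GammaTriple K (tower K g p)) ∧
    ∀ T : GammaTriple K (tower K g p), GivenByNormalizers K g p T

/-- Second case: no center is trivial, and the tower terminates at a Lie algebra `ĝ` which is
`K × [ĝ, ĝ]`, with `[ĝ, ĝ]` perfect and complete. -/
def CaseTwo : Prop :=
  (∀ n, LieAlgebra.center K (tower K g n) ≠ ⊥) ∧
  ∃ q : ℕ, TerminatesAt K g q ∧
    Nonempty (tower K g q ≃ₗ⁅K⁆ K × derivedIdeal K (tower K g q)) ∧
    IsPerfect K (derivedIdeal K (tower K g q)) ∧
    IsComplete K (derivedIdeal K (tower K g q))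

/-- Third case: the sequence of dimensions is increasing (in the large sense) and diverges. -/
def CaseThree : Prop :=
  Monotone (fun n => Module.finrank K (tower K g n)) ∧
  Filter.Tendsto (fun n => Module.finrank K (tower K g n)) Filter.atTop Filter.atTop

end Cases

end DerTower

-- The proof splits on whether some term of the tower has trivial center.
--
-- Suppose `Z(g_p) = 0`. A Γ-triple exists by Levi's theorem: `k` is a Cartan subalgebra of the
-- centralizer of `s` in the radical `r`, and `m` is `[s, r]` plus a positive Fitting component.
-- Trivial center makes `μ` injective, so `g_p` is `s ⊕ μ(k) ⊕ m`. The Γ-invariants of `r` are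
-- exactly `k`; hence a derivation of `n̂` commuting with `Γ` preserves `n̂ ∩ k`, elements of `B`
-- are compatible with both components of the bracket `m × m → k ⊕ m`, and `s ⊕ B ⊕ m` is a Lie
-- algebra (`Ambient`). Let `μ(k) ≤ N ≤ B`. Subtracting an inner derivation, one may assume that a
-- derivation of `s ⊕ N ⊕ m` vanishes on `s` (Whitehead) and has generalized weight zero for `k`
-- (Fitting). It then preserves `N` and `m`; its restriction `f` to `m` lies in `B`, it acts on `N`
-- as `ad f`, and so `f` normalizes `N`. Thus `Der (s ⊕ N ⊕ m)` is `s ⊕ N' ⊕ m` with `N'` the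
-- normalizer of `N` in `B` (`exists_eq_lie_of_sub`, `termAct_bijective`). The tower becomes an
-- ascending chain in a finite-dimensional space, and a repetition in the chain means completeness.
--
-- Suppose instead that all centers are nonzero. No term `L` is perfect, because derivations of a
-- perfect algebra form an algebra with trivial center; so `L` carries a nonzero functional `l` that
-- kills brackets. Counting the derivations `v ↦ l(v) c`, with `c` centralizing `ker l`, against the
-- inner ones gives `dim L ≤ dim Der L`. If the dimensions do not diverge they become constant. A
-- similar count with two functionals (`finrank_lt_finrank_derivation`) then forces `[L, L] = ker
-- l`, and comparison with the next term (`exists_mem_center_apply_eq_one`) yields a central `z`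
-- with `l(z) = 1`. So `L = Kz ⊕ [L, L]`; as `Der L` has nonzero center, `Z(L) = Kz`, whence `[L,
-- L]` is complete and `Der L ≅ L`.
--
-- The cases exclude each other: centers separate the first two, and termination bounds the
-- dimensions.

universe w

namespace DerTower

/-! ### Semisimple Lie algebras: Cartan's criterion, Whitehead's first lemma, Weyl's theorem. -/

section Semisimple

open LieAlgebra LieModule Module

variable {K : Type u} [Field K] [CharZero K] {q : Type v} [LieRing q] [LieAlgebra K q]
  [FiniteDimensional K q]

/-- The Killing complement of the derived ideal is abelian, since its bracket with itself lies both
in it and in the derived ideal; a semisimple algebra has no nonzero abelian ideal. -/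
theorem lie_top_eq_top [HasTrivialRadical K q] : ⁅(⊤ : LieIdeal K q), (⊤ : LieIdeal K q)⁆ = ⊤ := by
  set I : LieIdeal K q := ⁅(⊤ : LieIdeal K q), (⊤ : LieIdeal K q)⁆
  have hc := LieIdeal.isCompl_killingCompl (K := K) I
  have hab : IsLieAbelian (I.killingCompl K q) := by
    rw [LieSubmodule.lie_abelian_iff_lie_self_eq_bot, eq_bot_iff, ← hc.inf_eq_bot]
    exact le_inf (LieSubmodule.mono_lie le_top le_top) (LieSubmodule.lie_le_right _ _)
  have hb : I.killingCompl K q = ⊥ := IsKilling.ideal_eq_bot_of_isLieAbelian _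
  have := hc.sup_eq_top
  rwa [hb, sup_bot_eq] at this

variable {M : Type w} [AddCommGroup M] [Module K M] [LieRingModule q M] [LieModule K q M]
  [FiniteDimensional K M]

/-- Cartan's criterion for an ideal acting faithfully. A vanishing trace form makes `[R, R]` act
nilpotently on `M`; faithfulness transfers nilpotency from `ad` on `End M` to `ad` on `[R, R]`,
which is nilpotent by Engel. -/
theorem isSolvable_of_traceForm_eq_zero (R : LieIdeal K q)
    (hf : ∀ x ∈ R, toEnd K q M x = 0 → x = 0)
    (h : ∀ x ∈ R, ∀ y ∈ R, traceForm K q M x y = 0) : IsSolvable R := by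
  set D : LieIdeal K q := ⁅R, R⁆
  have hDR : D ≤ R := LieSubmodule.lie_le_left R R
  have tf : traceForm K R M = 0 := by
    ext ⟨x, hx⟩ ⟨y, hy⟩
    exact h x hx y hy
  have hn : LieModule.IsNilpotent (derivedSeries K R 1) M :=
    LieModule.isNilpotent_derivedSeries_of_traceForm_eq_zero tf
  have hD : LieRing.IsNilpotent D := by
    rw [LieAlgebra.isNilpotent_iff_forall (R := K)]
    rintro ⟨x, hx⟩
    have hx1 : IsNilpotent (toEnd K q M x) :=
      (LieModule.isNilpotent_iff_forall' (R := K)).mp hn ⟨⟨x, hDR hx⟩, by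
        rwa [LieIdeal.derivedSeries_eq_derivedSeriesOfIdeal_comap, LieIdeal.mem_comap]⟩
    obtain ⟨n, hn⟩ := LieAlgebra.ad_nilpotent_of_nilpotent (R := K) hx1
    refine ⟨n, ?_⟩
    let f : D →ₗ[K] Module.End K M := (toEnd K q M : q →ₗ[K] _) ∘ₗ D.toSubmodule.subtype
    have hcomm : (ad K (Module.End K M) (toEnd K q M x)) ∘ₗ f = f ∘ₗ (ad K D ⟨x, hx⟩) := by
      ext y : 1
      exact (LieHom.map_lie _ _ _).symm
    have := Module.End.commute_pow_left_of_commute hcomm n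
    rw [hn, LinearMap.zero_comp] at this
    ext y
    have h2 := LinearMap.congr_fun this y
    have := hf _ (hDR ((ad K D ⟨x, hx⟩ ^ n) y).2) h2.symm
    simpa using this
  obtain ⟨k, hk⟩ := IsSolvable.solvable K D
  rw [LieIdeal.derivedSeries_eq_bot_iff] at hk
  exact IsSolvable.mk (k := k + 1) ((LieIdeal.derivedSeries_eq_bot_iff R (k + 1)).mpr (by
    rwa [derivedSeriesOfIdeal_add, derivedSeriesOfIdeal_succ, derivedSeriesOfIdeal_zero]))

/-- The radical of the trace form on `J` is an ideal, solvable by Cartan's criterion, hence zero. -/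
theorem eq_zero_of_traceForm_eq_zero [HasTrivialRadical K q] (J : LieIdeal K q)
    (hf : ∀ x ∈ J, toEnd K q M x = 0 → x = 0) {x : q} (hx : x ∈ J)
    (h : ∀ y ∈ J, traceForm K q M y x = 0) : x = 0 := by
  let R : LieIdeal K q := J ⊓ InvariantForm.orthogonal (traceForm K q M)
    (traceForm_lieInvariant K q M) J
  have hR : IsSolvable R := isSolvable_of_traceForm_eq_zero (M := M) R (fun y hy => hf y hy.1)
    fun y hy z hz => (InvariantForm.mem_orthogonal _ _ _ _).1 hz.2 y hy.1
  have := HasTrivialRadical.eq_bot_of_isSolvable (R := K) R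
  have hxR : x ∈ R := ⟨hx, (InvariantForm.mem_orthogonal _ _ _ _).2 h⟩
  rwa [this, LieSubmodule.mem_bot] at hxR

omit [CharZero K] [FiniteDimensional K M] in
/-- Dual bases of an ideal with respect to a nondegenerate trace form give an invariant tensor. -/
theorem exists_casimir (J : LieIdeal K q)
    (hJ : ∀ x ∈ J, (∀ y ∈ J, traceForm K q M y x = 0) → x = 0) :
    ∃ (b d : Fin (finrank K J) → J),
      (∀ i, traceForm K q M (d i) (b i) = 1) ∧
      ∀ (W : Type w) [AddCommGroup W] [Module K W] (β : J →ₗ[K] J →ₗ[K] W) (x : q),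
        ∑ i, (β ⁅x, b i⁆ (d i) + β (b i) ⁅x, d i⁆) = 0 := by
  classical
  let B : LinearMap.BilinForm K J := (traceForm K q M).restrict J.toSubmodule
  have hBs : B.IsSymm := ⟨fun x y => traceForm_comm K q M x y⟩
  have hB : B.Nondegenerate := by
    refine (LinearMap.BilinForm.IsSymm.isRefl hBs).nondegenerate_iff_separatingRight.2 ?_
    intro x hx
    exact Subtype.ext (hJ x x.2 fun y hy => hx ⟨y, hy⟩)
  let b := Module.finBasis K J
  let d := B.dualBasis hB b
  have hdb : ∀ i j, B (d i) (b j) = if j = i then 1 else 0 :=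
    LinearMap.BilinForm.apply_dualBasis_left hB b
  have hb : ∀ z : J, ∑ j, B (d j) z • b j = z := by
    intro z
    conv_rhs => rw [← b.sum_repr z]
    refine Finset.sum_congr rfl fun j _ => ?_
    congr 1
    have := congrArg (B (d j)) (b.sum_repr z)
    simpa only [map_sum, map_smul, hdb, smul_eq_mul, mul_ite, mul_one, mul_zero, Finset.sum_ite_eq',
      Finset.sum_ite_eq, Finset.mem_univ, if_true] using this.symm
  have hd : ∀ z : J, ∑ j, B z (b j) • d j = z := by
    intro z
    conv_rhs => rw [← d.sum_repr z]
    refine Finset.sum_congr rfl fun j _ => ?_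
    rw [LinearMap.BilinForm.dualBasis_repr_apply]
  have hinv : ∀ (x : q) (y z : J), B y ⁅x, z⁆ = - B ⁅x, y⁆ z := by
    intro x y z
    have := traceForm_lieInvariant K q M x (y : q) (z : q)
    change traceForm K q M (y : q) ⁅x, (z : q)⁆ = - traceForm K q M ⁅x, (y : q)⁆ (z : q)
    rw [this, neg_neg]
  refine ⟨b, d, fun i => (hdb i i).trans (if_pos rfl), ?_⟩
  -- Quantifying over all bilinear `β` states the invariance of `∑ bᵢ ⊗ dᵢ` without tensor products.
  -- Invariance of the form makes the matrix of `x` on `d` minus the transpose of its matrix on `b`,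
  -- so the sums cancel.
  intro W _ _ β x
  have h1 : ∀ i, β ⁅x, b i⁆ (d i) = ∑ j, B (d j) ⁅x, b i⁆ • β (b j) (d i) := by
    intro i
    conv_lhs => rw [← hb ⁅x, b i⁆]
    simp
  have h2 : ∀ j, β (b j) ⁅x, d j⁆ = ∑ i, B ⁅x, d j⁆ (b i) • β (b j) (d i) := by
    intro i
    conv_lhs => rw [← hd ⁅x, d i⁆]
    simp
  rw [Finset.sum_add_distrib, Finset.sum_congr rfl fun i _ => h1 i,
    Finset.sum_congr rfl fun i _ => h2 i, Finset.sum_comm, ← Finset.sum_add_distrib]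
  refine Finset.sum_eq_zero fun i _ => ?_
  rw [← Finset.sum_add_distrib]
  refine Finset.sum_eq_zero fun j _ => ?_
  rw [hinv, neg_smul, neg_add_cancel]

omit [FiniteDimensional K M] in
-- On a trivial module a derivation kills brackets, and these span a semisimple algebra.
theorem exists_eq_lie_of_trivial [HasTrivialRadical K q] (hM : ∀ x : q, toEnd K q M x = 0)
    (δ : LieDerivation K q M) (x : q) : δ x = 0 := by
  have hM' : ∀ (x : q) (m : M), ⁅x, m⁆ = 0 := fun x m => LinearMap.congr_fun (hM x) m
  have hx : x ∈ (⊤ : LieIdeal K q) := trivial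
  rw [← lie_top_eq_top, ← LieSubmodule.mem_toSubmodule, LieSubmodule.lieIdeal_oper_eq_linear_span']
    at hx
  induction hx using Submodule.span_induction with
  | mem x h => obtain ⟨a, -, b, -, rfl⟩ := h; simp [hM']
  | zero => simp
  | add x y _ _ hx hy => simp [hx, hy]
  | smul c x _ hx => simp [hx]

/-- Whitehead's first lemma. -/
theorem exists_eq_lie [HasTrivialRadical K q] (δ : LieDerivation K q M) :
    ∃ m : M, ∀ x, δ x = ⁅x, m⁆ := by
  induction hn : finrank K M using Nat.strong_induction_on generalizing M with
  | _ n ih =>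
  subst hn
  -- Given a proper nonzero submodule, the cocycle is made a coboundary in the quotient, and the
  -- defect is a cocycle with values in the submodule.
  by_cases hN : ∃ N : LieSubmodule K q M, N ≠ ⊥ ∧ N ≠ ⊤
  · obtain ⟨N, hN0, hN1⟩ := hN
    let δ' : LieDerivation K q (M ⧸ N) :=
      { toLinearMap := (LieSubmodule.Quotient.mk' N : M →ₗ[K] M ⧸ N) ∘ₗ δ.toLinearMap
        leibniz' := fun a b => by
          simp only [LinearMap.comp_apply, LieDerivation.coeFn_coe, LieDerivation.apply_lie_eq_sub]
          rfl }
    have hpos : 0 < finrank K N := by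
      have : Nontrivial N := (LieSubmodule.nontrivial_iff_ne_bot K q M).2 hN0
      exact Module.finrank_pos
    have hlt : finrank K N < finrank K M := Submodule.finrank_lt
      (fun h => hN1 ((LieSubmodule.toSubmodule_eq_top _).1 h))
    have hsum : finrank K (M ⧸ N) + finrank K N = finrank K M :=
      Submodule.finrank_quotient_add_finrank N.toSubmodule
    have : FiniteDimensional K (M ⧸ N) :=
      inferInstanceAs (FiniteDimensional K (M ⧸ N.toSubmodule))
    obtain ⟨m', hm'⟩ := ih (finrank K (M ⧸ N)) (by omega) δ' rfl
    obtain ⟨m, rfl⟩ := LieSubmodule.Quotient.surjective_mk' N m'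
    have hmem : ∀ x, δ x - ⁅x, m⁆ ∈ N := by
      intro x
      have h1 : LieSubmodule.Quotient.mk' N (δ x) = ⁅x, LieSubmodule.Quotient.mk' N m⁆ := hm' x
      rw [← LieSubmodule.Quotient.mk_eq_zero, map_sub, h1, LieModuleHom.map_lie, sub_self]
    let δ₀ : LieDerivation K q N :=
      { toFun := fun x => ⟨δ x - ⁅x, m⁆, hmem x⟩
        map_add' := fun x y => Subtype.ext (by simp; abel)
        map_smul' := fun c x => Subtype.ext (by simp [smul_sub])
        leibniz' := fun a b => Subtype.ext (by simp; abel) }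
    obtain ⟨m₀, hm₀⟩ := ih (finrank K N) hlt δ₀ rfl
    refine ⟨m + m₀, fun x => ?_⟩
    have : δ x - ⁅x, m⁆ = ⁅x, (m₀ : M)⁆ := congrArg Subtype.val (hm₀ x)
    rw [lie_add, ← this]
    abel
  · push Not at hN
    -- No proper nonzero submodule remains. `J` is the part of `q` acting faithfully; it carries a
    -- Casimir operator unless the action is trivial.
    let I : LieIdeal K q := (toEnd K q M).ker
    let J : LieIdeal K q := I.killingCompl K q
    have hIJ : IsCompl I J := LieIdeal.isCompl_killingCompl I
    by_cases hJ0 : J = ⊥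
    · have hI : I = ⊤ := by simpa [hJ0] using hIJ.sup_eq_top
      refine ⟨0, fun x => ?_⟩
      rw [lie_zero]
      refine exists_eq_lie_of_trivial (fun y => ?_) δ x
      have : y ∈ I := hI ▸ LieSubmodule.mem_top y
      exact this
    · have hfaith : ∀ x ∈ J, toEnd K q M x = 0 → x = 0 := by
        intro x hx h
        have : x ∈ I ⊓ J := ⟨h, hx⟩
        rwa [hIJ.inf_eq_bot, LieSubmodule.mem_bot] at this
      obtain ⟨b, d, htr, hinv⟩ := exists_casimir (M := M) J
        fun x hx h => eq_zero_of_traceForm_eq_zero J hfaith hx h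
      let c : Module.End K M := ∑ i, toEnd K q M (d i) * toEnd K q M (b i)
      -- The Casimir operator has trace `dim J`, which is nonzero in characteristic zero.
      have htrc : LinearMap.trace K M c = finrank K J := by
        simp only [c, map_sum]
        rw [Finset.sum_congr rfl fun i _ => (by
          have := htr i
          rwa [traceForm_apply_apply] at this :
            LinearMap.trace K M (toEnd K q M (d i) * toEnd K q M (b i)) = 1)]
        simp
      have hc0 : c ≠ 0 := by
        intro h
        rw [h, map_zero] at htrc
        have : Nontrivial J := (LieSubmodule.nontrivial_iff_ne_bot K q q).2 hJ0
        have h2 : 0 < finrank K J := Module.finrank_pos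
        have h3 : (finrank K J : K) = 0 := htrc.symm
        rw [Nat.cast_eq_zero] at h3
        omega
      have hcapp : ∀ m, c m = ∑ i, ⁅(d i : q), ⁅(b i : q), m⁆⁆ := by
        intro m; simp [c]
      have hceq : ∀ (x : q) (m : M), c ⁅x, m⁆ = ⁅x, c m⁆ := by
        intro x m
        let β : J →ₗ[K] J →ₗ[K] M := LinearMap.mk₂ K (fun y z => ⁅(z : q), ⁅(y : q), m⁆⁆)
          (by intros; simp) (by intros; simp) (by intros; simp) (by intros; simp)
        have h := hinv M β x
        simp only [β, LinearMap.mk₂_apply, LieSubmodule.coe_bracket] at h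
        rw [hcapp, hcapp, lie_sum, eq_comm, ← sub_eq_zero, ← Finset.sum_sub_distrib, ← h]
        refine Finset.sum_congr rfl fun i _ => ?_
        simp only [lie_lie, lie_sub]
        abel
      -- The Casimir operator turns `δ` into the coboundary of `m₁`. It commutes with `q` and its
      -- kernel is a submodule, so it is invertible and the required vector is `c⁻¹ m₁`.
      let m₁ : M := ∑ i, ⁅(d i : q), δ (b i)⁆
      have hm₁ : ∀ x, c (δ x) = ⁅x, m₁⁆ := by
        intro x
        let β : J →ₗ[K] J →ₗ[K] M := LinearMap.mk₂ K (fun y z => ⁅(z : q), δ (y : q)⁆)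
          (by intros; simp) (by intros; simp) (by intros; simp) (by intros; simp)
        have h := hinv M β x
        simp only [β, LinearMap.mk₂_apply, LieSubmodule.coe_bracket] at h
        rw [hcapp, lie_sum, eq_comm, ← sub_eq_zero, ← Finset.sum_sub_distrib, ← h]
        refine Finset.sum_congr rfl fun i _ => ?_
        simp only [lie_lie, LieDerivation.apply_lie_eq_sub, lie_sub]
        abel
      let N : LieSubmodule K q M :=
        { LinearMap.ker c with
          lie_mem := fun {x m} hm => by
            change c ⁅x, m⁆ = 0
            have : c m = 0 := hm
            rw [hceq, this, lie_zero] }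
      have hker : LinearMap.ker c = ⊥ := by
        by_contra hne
        have h1 : N ≠ ⊥ := fun h => hne ((LieSubmodule.toSubmodule_eq_bot _).2 h)
        have h2 : LinearMap.ker c = ⊤ := (LieSubmodule.toSubmodule_eq_top _).2 (hN N h1)
        exact hc0 (LinearMap.ker_eq_top.1 h2)
      have hinj : Function.Injective c := LinearMap.ker_eq_bot.1 hker
      obtain ⟨m, hm⟩ := (LinearMap.injective_iff_surjective.1 hinj) m₁
      exact ⟨m, fun x => hinj (by rw [hm₁, hceq, hm])⟩

/-- Weyl's theorem: every submodule has a complement. -/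
theorem exists_equivariant_projection [HasTrivialRadical K q] (N : LieSubmodule K q M) :
    ∃ p : M →ₗ⁅K, q⁆ M, (∀ x, p x ∈ N) ∧ ∀ x ∈ N, p x = x := by
  obtain ⟨p₀, hp₀⟩ := LinearMap.exists_leftInverse_of_injective N.toSubmodule.subtype
    N.toSubmodule.ker_subtype
  let p : M →ₗ[K] M := N.toSubmodule.subtype ∘ₗ p₀
  have hpN : ∀ x, p x ∈ N := fun x => (p₀ x).2
  have hp1 : ∀ x ∈ N, p x = x := fun x hx =>
    congrArg Subtype.val (LinearMap.congr_fun hp₀ ⟨x, hx⟩)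
  -- For a linear projection `p` onto `N`, the maps `x · p` take values in `N` and kill `N`. So `x ↦
  -- x · p` is a cocycle in `W`; if it is the coboundary of `f ∈ W`, then `p - f` is an equivariant
  -- projection.
  let W : LieSubmodule K q (M →ₗ[K] M) :=
    { carrier := {f | (∀ x, f x ∈ N) ∧ ∀ x ∈ N, f x = 0}
      zero_mem' := by simp
      add_mem' := fun {f g} hf hg => ⟨fun x => add_mem (hf.1 x) (hg.1 x),
        fun x hx => by simp [hf.2 x hx, hg.2 x hx]⟩
      smul_mem' := fun c f hf => ⟨fun x => N.smul_mem c (hf.1 x), fun x hx => by simp [hf.2 x hx]⟩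
      lie_mem := fun {x f} hf => ⟨fun y => by
          rw [LieHom.lie_apply]
          exact sub_mem (N.lie_mem (hf.1 y)) (hf.1 _), fun y hy => by
          rw [LieHom.lie_apply, hf.2 y hy, hf.2 _ (N.lie_mem hy), lie_zero, sub_zero]⟩ }
  have hW : ∀ x : q, ⁅x, p⁆ ∈ W := fun x => ⟨fun y => by
      rw [LieHom.lie_apply]
      exact sub_mem (N.lie_mem (hpN y)) (hpN _), fun y hy => by
      rw [LieHom.lie_apply, hp1 y hy, hp1 _ (N.lie_mem hy), sub_self]⟩
  let δ : LieDerivation K q W :=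
    { toFun := fun x => ⟨⁅x, p⁆, hW x⟩
      map_add' := fun x y => Subtype.ext (by simp)
      map_smul' := fun c x => Subtype.ext (by simp)
      leibniz' := fun a b => Subtype.ext (by simp) }
  obtain ⟨⟨f, hf⟩, hδ⟩ := exists_eq_lie δ
  have hpf : ∀ x : q, ⁅x, p⁆ = ⁅x, f⁆ := fun x => congrArg Subtype.val (hδ x)
  refine ⟨{ toLinearMap := p - f, map_lie' := fun {x m} => ?_ }, fun x => ?_, fun x hx => ?_⟩
  · have := LinearMap.congr_fun (hpf x) m
    rw [LieHom.lie_apply, LieHom.lie_apply] at this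
    change p ⁅x, m⁆ - f ⁅x, m⁆ = ⁅x, p m - f m⁆
    rw [lie_sub, sub_eq_sub_iff_sub_eq_sub, ← neg_inj, neg_sub, neg_sub, this]
  · exact sub_mem (hpN x) (hf.1 x)
  · change p x - f x = x
    rw [hp1 x hx, hf.2 x hx, sub_zero]

/-- An equivariant projection onto the invariants kills `[q, M]`, which gives disjointness. If `p`
projects equivariantly onto `[q, M]`, then every `m - p m` is invariant, which gives the sum. -/
theorem isCompl_maxTriv_lie_top [HasTrivialRadical K q] :
    IsCompl (maxTrivSubmodule K q M) ⁅(⊤ : LieIdeal K q), (⊤ : LieSubmodule K q M)⁆ := by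
  constructor
  · obtain ⟨p, hp, hp1⟩ := exists_equivariant_projection (maxTrivSubmodule K q M)
    have hker : ⁅(⊤ : LieIdeal K q), (⊤ : LieSubmodule K q M)⁆ ≤ p.ker := by
      rw [LieSubmodule.lie_le_iff]
      intro x _ m _
      rw [LieModuleHom.mem_ker, LieModuleHom.map_lie]
      exact (mem_maxTrivSubmodule K q M _).1 (hp m) x
    rw [disjoint_iff, LieSubmodule.eq_bot_iff]
    rintro x ⟨hx1, hx2⟩
    rw [← hp1 x hx1]
    exact hker hx2
  · obtain ⟨p, hp, hp1⟩ := exists_equivariant_projection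
      ⁅(⊤ : LieIdeal K q), (⊤ : LieSubmodule K q M)⁆
    rw [codisjoint_iff, eq_top_iff]
    intro m _
    have : m = (m - p m) + p m := by abel
    rw [this]
    refine add_mem (LieSubmodule.mem_sup_left ?_) (LieSubmodule.mem_sup_right (hp m))
    rw [mem_maxTrivSubmodule]
    intro x
    rw [lie_sub, ← LieModuleHom.map_lie, hp1 _ (LieSubmodule.lie_mem_lie trivial trivial), sub_self]

end Semisimple

end DerTower

namespace DerTower

/-! ### Fitting decomposition for nilpotent Lie algebras. -/

section Fitting

open LieAlgebra LieModule Module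

variable {K : Type u} [Field K] {k : Type v} [LieRing k] [LieAlgebra K k] [LieRing.IsNilpotent k]
  {M : Type w} [AddCommGroup M] [Module K M] [FiniteDimensional K M]

/-- The Fitting decomposition of a representation of a nilpotent Lie algebra. -/
theorem exists_fitting (ρ : k →ₗ⁅K⁆ Module.End K M) :
    ∃ P : Submodule K M,
      (∀ v, ∃ v₀, (∀ y, ∃ n : ℕ, (ρ y ^ n) v₀ = 0) ∧ v - v₀ ∈ P) ∧
      (∀ v ∈ P, (∀ y, ∃ n : ℕ, (ρ y ^ n) v = 0) → v = 0) ∧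
      P = Submodule.span K {w | ∃ y, ∃ u ∈ P, ρ y u = w} ∧
      ∀ U : Submodule K M, U ≤ Submodule.span K {w | ∃ y, ∃ u ∈ U, ρ y u = w} → U ≤ P := by
  let _ : LieRingModule k M := LieRingModule.compLieHom M ρ
  have _ : LieModule K k M := LieModule.compLieHom M ρ
  have hc := isCompl_genWeightSpace_zero_posFittingComp K k M
  have hmem : ∀ v : M, v ∈ genWeightSpace M (0 : k → K) ↔ ∀ y, ∃ n : ℕ, (ρ y ^ n) v = 0 := by
    intro v
    rw [mem_genWeightSpace]
    simp only [Pi.zero_apply, zero_smul, sub_zero]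
    rfl
  refine ⟨(posFittingComp K k M).toSubmodule, fun v => ?_, fun v hv h => ?_, ?_, fun U hU => ?_⟩
  · have hv : v ∈ genWeightSpace M (0 : k → K) ⊔ posFittingComp K k M := by
      rw [hc.sup_eq_top]; trivial
    obtain ⟨a, ha, b, hb, rfl⟩ := (LieSubmodule.mem_sup _ _ _).1 hv
    exact ⟨a, (hmem a).1 ha, by simpa using hb⟩
  · have : v ∈ genWeightSpace M (0 : k → K) ⊓ posFittingComp K k M := ⟨(hmem v).2 h, hv⟩
    rwa [hc.inf_eq_bot, LieSubmodule.mem_bot] at this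
  -- The positive Fitting component is the stable term of the lower central series, so `k` maps it
  -- onto itself.
  · rw [← iInf_lowerCentralSeries_eq_posFittingComp]
    obtain ⟨n, hn⟩ := Filter.eventually_atTop.1 (eventually_iInf_lowerCentralSeries_eq K k M)
    have h : (⨅ i, lowerCentralSeries K k M i) =
        ⁅(⊤ : LieIdeal K k), ⨅ i, lowerCentralSeries K k M i⁆ := by
      conv_lhs => rw [hn (n + 1) (by omega), lowerCentralSeries_succ, ← hn n le_rfl]
    conv_lhs => rw [h, LieSubmodule.lieIdeal_oper_eq_linear_span']
    congr 1
    ext w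
    constructor
    · rintro ⟨y, -, u, hu, rfl⟩
      exact ⟨y, u, hu, rfl⟩
    · rintro ⟨y, u, hu, rfl⟩
      exact ⟨y, trivial, u, hu, rfl⟩
  · rw [← iInf_lowerCentralSeries_eq_posFittingComp]
    have h : ∀ n, U ≤ (lowerCentralSeries K k M n).toSubmodule := by
      intro n
      induction n with
      | zero => simp
      | succ n ih =>
        refine hU.trans (Submodule.span_le.2 ?_)
        rintro _ ⟨y, u, hu, rfl⟩
        rw [lowerCentralSeries_succ]
        exact LieSubmodule.lie_mem_lie (LieSubmodule.mem_top y) (ih hu)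
    intro x hx
    simp only [LieSubmodule.mem_toSubmodule, LieSubmodule.mem_iInf]
    exact fun n => h n hx

/-- A nilpotent representation with no coinvariants vanishes. -/
theorem eq_bot_of_le_span_of_nilpotent (ρ : k →ₗ⁅K⁆ Module.End K M) (U : Submodule K M)
    (hU : U ≤ Submodule.span K {w | ∃ y, ∃ u ∈ U, ρ y u = w})
    (h : ∀ v ∈ U, ∀ y, ∃ n : ℕ, (ρ y ^ n) v = 0) : U = ⊥ := by
  obtain ⟨P, -, h2, -, h4⟩ := exists_fitting ρ
  rw [eq_bot_iff]
  exact fun v hv => h2 v (h4 U hU hv) (h v hv)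

end Fitting

/-! ### Jordan decomposition and generalized null vectors. -/

section Jordan

open Module

variable {K : Type u} [Field K] [CharZero K]
  {M : Type w} [AddCommGroup M] [Module K M] [FiniteDimensional K M] {S N : Module.End K M}

omit [CharZero K] [FiniteDimensional K M] in
-- On `ker (S + N)ⁿ` the operator `S` is semisimple, and also nilpotent as a difference of the
-- commuting nilpotents `S + N` and `N`; so it vanishes there.
theorem semisimple_apply_eq_zero (hS : S.IsSemisimple) (hN : IsNilpotent N) (h : Commute S N)
    {n : ℕ} {v : M} (hv : ((S + N) ^ n) v = 0) : S v = 0 := by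
  let U : Submodule K M := LinearMap.ker ((S + N) ^ n)
  have hst : ∀ T : Module.End K M, Commute T (S + N) → ∀ x ∈ U, T x ∈ U := by
    intro T hT x hx
    have h1 := LinearMap.congr_fun (hT.pow_right n).eq x
    simp only [Module.End.mul_apply] at h1
    have hx' : ((S + N) ^ n) x = 0 := hx
    change ((S + N) ^ n) (T x) = 0
    rw [← h1, hx', map_zero]
  have hSU := hst S ((Commute.refl S).add_right h)
  have hNU := hst N (h.symm.add_right (Commute.refl N))
  have hS' : Module.End.IsSemisimple (S.restrict hSU) := hS.restrict hSU
  have hN' : IsNilpotent (N.restrict hNU) := by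
    obtain ⟨j, hj⟩ := hN
    refine ⟨j, ?_⟩
    rw [Module.End.pow_restrict]
    ext x
    simp [hj]
  have hX : IsNilpotent (S.restrict hSU + N.restrict hNU) := by
    refine ⟨n, ?_⟩
    have : S.restrict hSU + N.restrict hNU =
        (S + N).restrict (fun x hx => add_mem (hSU x hx) (hNU x hx)) := by ext; simp
    rw [this, Module.End.pow_restrict]
    ext x
    exact x.2
  have hcomm : Commute (S.restrict hSU) (N.restrict hNU) := by
    ext x
    exact LinearMap.congr_fun h.eq x
  have hnil : IsNilpotent (S.restrict hSU) := by
    have := Commute.isNilpotent_sub (x := S.restrict hSU + N.restrict hNU) (y := N.restrict hNU)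
      (hcomm.add_left (Commute.refl _)) hX hN'
    simpa using this
  have h0 := Module.End.eq_zero_of_isNilpotent_isSemisimple hnil hS'
  exact congrArg Subtype.val (LinearMap.congr_fun h0 ⟨v, hv⟩)

omit [CharZero K] [FiniteDimensional K M] in
theorem exists_pow_apply_eq_zero (hN : IsNilpotent N) (h : Commute S N) {v : M} (hv : S v = 0) :
    ∃ n : ℕ, ((S + N) ^ n) v = 0 := by
  obtain ⟨n, hn⟩ := hN
  refine ⟨n, ?_⟩
  have : ∀ j : ℕ, ((S + N) ^ j) v = (N ^ j) v := by
    intro j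
    induction j with
    | zero => simp
    | succ j ih =>
      rw [pow_succ', pow_succ', Module.End.mul_apply, ih, LinearMap.add_apply, Module.End.mul_apply]
      have := LinearMap.congr_fun (h.pow_right j).eq v
      simp only [Module.End.mul_apply] at this
      rw [this, hv, map_zero, zero_add]
  rw [this, hn, LinearMap.zero_apply]

/-- `ad S + ad N` is again a sum of commuting semisimple and nilpotent operators, so
`semisimple_apply_eq_zero` applies to the vector `D`. -/
theorem commute_of_ad_pow_eq_zero (hS : S.IsSemisimple) (hN : IsNilpotent N) (h : Commute S N)
    {n : ℕ} {D : Module.End K M} (hD : (LieAlgebra.ad K (Module.End K M) (S + N) ^ n) D = 0) :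
    Commute S D := by
  rw [map_add] at hD
  have := semisimple_apply_eq_zero (LieAlgebra.ad_isSemisimple_of_isSemisimple hS)
    (LieAlgebra.ad_nilpotent_of_nilpotent (R := K) hN) (LieAlgebra.commute_ad_of_commute h) hD
  rw [LieAlgebra.ad_apply, Ring.lie_def, sub_eq_zero] at this
  exact this

/-- Uniqueness of the Jordan decomposition identifies `S` with the semisimple part that is a
polynomial in `S + N`. Hence `S` preserves every subspace stable under `S + N`. -/
theorem semisimple_mem_adjoin (hS : S.IsSemisimple) (hN : IsNilpotent N) (h : Commute S N) :
    S ∈ Algebra.adjoin K {S + N} := by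
  obtain ⟨n, hn, s, hs, hnn, hss, he⟩ := (S + N).exists_isNilpotent_isSemisimple
  have hc : Commute n s := Algebra.commute_of_mem_adjoin_singleton_of_commute hs
    (Algebra.commute_of_mem_adjoin_self hn).symm
  obtain ⟨-, h2⟩ := Module.End.isNilpotent_isSemisimple_unique hN hS hnn hss h.symm hc
    ((add_comm N S).trans he)
  exact h2 ▸ hs

omit [CharZero K] [FiniteDimensional K M] in
theorem apply_mem_of_mem_adjoin {X T : Module.End K M} (hT : T ∈ Algebra.adjoin K {X})
    (U : Submodule K M) (hU : ∀ x ∈ U, X x ∈ U) : ∀ x ∈ U, T x ∈ U := by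
  induction hT using Algebra.adjoin_induction with
  | mem a ha => rw [Set.mem_singleton_iff.1 ha]; exact hU
  | algebraMap r => intro x hx; simpa using U.smul_mem r hx
  | add a b _ _ ha hb => exact fun x hx => add_mem (ha x hx) (hb x hx)
  | mul a b _ _ ha hb => exact fun x hx => ha _ (hb x hx)

theorem exists_jordan (X : Module.End K M) :
    ∃ S N : Module.End K M, S.IsSemisimple ∧ IsNilpotent N ∧ Commute S N ∧ X = S + N := by
  obtain ⟨n, hn, s, hs, hnn, hss, he⟩ := X.exists_isNilpotent_isSemisimple
  exact ⟨s, n, hss, hnn, (Algebra.commute_of_mem_adjoin_singleton_of_commute hs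
    (Algebra.commute_of_mem_adjoin_self hn).symm).symm, he.trans (add_comm _ _)⟩

end Jordan

/-! ### Invariance of the radical under derivations. -/

section Radical

open LieAlgebra Module

variable {K : Type u} [Field K] [CharZero K] {L : Type v} [LieRing L] [LieAlgebra K L]
  [FiniteDimensional K L]

omit [CharZero K] [FiniteDimensional K L] in
-- When `D^j` with `j < 2 ^ (n + 1)` is expanded on a bracket, each term has some exponent below `2
-- ^ n`.
theorem iterate_mem_of_lt_two_pow (D : LieDerivation K L L) (R : LieIdeal K L) (n : ℕ) :
    ∀ u ∈ derivedSeriesOfIdeal K L n R, ∀ j < 2 ^ n, (D^[j]) u ∈ R := by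
  induction n with
  | zero =>
    intro u hu j hj
    obtain rfl : j = 0 := by simpa using hj
    exact hu
  | succ n ih =>
    intro u hu j hj
    rw [derivedSeriesOfIdeal_succ, ← LieSubmodule.mem_toSubmodule,
      LieSubmodule.lieIdeal_oper_eq_linear_span'] at hu
    induction hu using Submodule.span_induction with
    | mem u h =>
      obtain ⟨a, ha, b, hb, rfl⟩ := h
      rw [LieDerivation.iterate_apply_lie]
      refine sum_mem fun ij hij => nsmul_mem ?_ _
      rw [Finset.HasAntidiagonal.mem_antidiagonal] at hij
      by_cases h1 : ij.1 < 2 ^ n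
      · exact lie_mem_left K L R _ _ (ih a ha _ h1)
      · exact lie_mem_right K L R _ _ (ih b hb _ (by rw [pow_succ] at hj; omega))
    | zero => rw [iterate_map_zero]; exact zero_mem _
    | add x y _ _ hx hy => rw [iterate_map_add]; exact add_mem hx hy
    | smul c x _ hx =>
      have : (D^[j]) (c • x) = c • (D^[j]) x :=
        (Function.Commute.iterate_left (f := D) (g := (c • ·)) (fun y => map_smul D c y) j) x
      rw [this]; exact R.smul_mem c hx

/-- In characteristic zero, the radical is stable under derivations. -/
theorem derivation_apply_mem_radical (D : LieDerivation K L L) {x : L}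
    (hx : x ∈ radical K L) : D x ∈ radical K L := by
  set R := radical K L with hR
  let I : LieIdeal K L :=
    { R.toSubmodule ⊔ R.toSubmodule.map (D : L →ₗ[K] L) with
      lie_mem := fun {y m} hm => by
        obtain ⟨a, ha, _, ⟨b, hb, rfl⟩, rfl⟩ := Submodule.mem_sup.1 hm
        rw [lie_add]
        refine add_mem (Submodule.mem_sup_left (R.lie_mem ha)) ?_
        have : ⁅y, D b⁆ = - ⁅D y, b⁆ + D ⁅y, b⁆ := by
          rw [LieDerivation.apply_lie_eq_add]; abel
        change ⁅y, D b⁆ ∈ _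
        rw [this]
        exact add_mem (Submodule.mem_sup_left (neg_mem (R.lie_mem hb)))
          (Submodule.mem_sup_right ⟨_, R.lie_mem hb, rfl⟩) }
  -- The aim is solvability of the ideal `I = R + D R`. Modulo `R`, its `n`-th derived ideal
  -- consists of values of `D ^ (2 ^ n)` on the `n`-th derived ideal of `R`, so it falls into `R`
  -- once the latter vanishes.
  have key : ∀ n, ∀ z ∈ derivedSeriesOfIdeal K L n I, ∃ a ∈ R,
      ∃ b ∈ derivedSeriesOfIdeal K L n R, z = a + ((D : L →ₗ[K] L) ^ (2 ^ n)) b := by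
    intro n
    induction n with
    | zero =>
      intro z hz
      obtain ⟨a, ha, _, ⟨b, hb, rfl⟩, rfl⟩ := Submodule.mem_sup.1 hz
      exact ⟨a, ha, b, hb, by simp⟩
    | succ n ih =>
      intro z hz
      rw [derivedSeriesOfIdeal_succ, ← LieSubmodule.mem_toSubmodule,
        LieSubmodule.lieIdeal_oper_eq_linear_span'] at hz
      induction hz using Submodule.span_induction with
      | mem z h =>
        obtain ⟨p, hp, p', hp', rfl⟩ := h
        obtain ⟨a, ha, b, hb, rfl⟩ := ih p hp
        obtain ⟨a', ha', b', hb', rfl⟩ := ih p' hp'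
        set N := 2 ^ n with hN
        set E := (D : L →ₗ[K] L) with hE
        have hpow : ∀ (j : ℕ) (y : L), (E ^ j) y = (D^[j]) y := fun j y => by
          rw [Module.End.pow_apply]; rfl
        -- Modulo `R` only the middle Leibniz term survives, every other term having an exponent
        -- below `N`. Its binomial coefficient is invertible in characteristic zero.
        have h1 : (E ^ (2 * N)) ⁅b, b'⁆ - ((2 * N).choose N) • ⁅(E ^ N) b, (E ^ N) b'⁆ ∈ R := by
          rw [hpow, LieDerivation.iterate_apply_lie, hpow, hpow,
            ← Finset.add_sum_erase _ _ (show (N, N) ∈ Finset.HasAntidiagonal.antidiagonal (2 * N) by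
              rw [Finset.HasAntidiagonal.mem_antidiagonal]; omega), add_sub_cancel_left]
          refine sum_mem fun ij hij => nsmul_mem ?_ _
          rw [Finset.mem_erase, Finset.HasAntidiagonal.mem_antidiagonal] at hij
          by_cases h1 : ij.1 < N
          · exact lie_mem_left K L R _ _ (iterate_mem_of_lt_two_pow D R n b hb _ h1)
          · refine lie_mem_right K L R _ _ (iterate_mem_of_lt_two_pow D R n b' hb' _ ?_)
            have : ij.1 ≠ N := fun h => hij.1 (Prod.ext h (by omega))
            omega
        have hc : (((2 * N).choose N : ℕ) : K) ≠ 0 :=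
          Nat.cast_ne_zero.2 (Nat.choose_pos (by omega)).ne'
        set c : K := (((2 * N).choose N : ℕ) : K) with hcdef
        rw [← Nat.cast_smul_eq_nsmul K, ← hcdef] at h1
        refine ⟨⁅a, a'⁆ + ⁅a, (E ^ N) b'⁆ + ⁅(E ^ N) b, a'⁆ -
          c⁻¹ • ((E ^ (2 * N)) ⁅b, b'⁆ - c • ⁅(E ^ N) b, (E ^ N) b'⁆), ?_, c⁻¹ • ⁅b, b'⁆, ?_, ?_⟩
        · exact sub_mem (add_mem (add_mem (R.lie_mem ha') (lie_mem_left K L R _ _ ha))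
            (R.lie_mem ha')) (R.smul_mem _ h1)
        · rw [derivedSeriesOfIdeal_succ]
          exact SMulMemClass.smul_mem _ (LieSubmodule.lie_mem_lie hb hb')
        · rw [pow_succ, mul_comm (2 ^ n) 2, ← hN, map_smul, smul_sub, smul_smul,
            inv_mul_cancel₀ hc, one_smul]
          simp only [lie_add, add_lie]
          abel
      | zero => exact ⟨0, zero_mem _, 0, zero_mem _, by simp⟩
      | add y z _ _ hy hz =>
        obtain ⟨a, ha, b, hb, rfl⟩ := hy
        obtain ⟨a', ha', b', hb', rfl⟩ := hz
        exact ⟨a + a', add_mem ha ha', b + b', add_mem hb hb', by rw [map_add]; abel⟩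
      | smul t z _ hz =>
        obtain ⟨a, ha, b, hb, rfl⟩ := hz
        exact ⟨t • a, R.smul_mem t ha, t • b, SMulMemClass.smul_mem t hb, by
          rw [map_smul, smul_add]⟩
  obtain ⟨n, hn⟩ := IsSolvable.solvable K R
  rw [LieIdeal.derivedSeries_eq_bot_iff] at hn
  have hIR : derivedSeriesOfIdeal K L n I ≤ R := by
    intro z hz
    obtain ⟨a, ha, b, hb, rfl⟩ := key n z hz
    rw [hn, LieSubmodule.mem_bot] at hb
    rw [hb, map_zero, add_zero]
    exact ha
  have hI : IsSolvable I := by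
    refine IsSolvable.mk (R := K) (k := n + n) ((LieIdeal.derivedSeries_eq_bot_iff I _).mpr ?_)
    rw [derivedSeriesOfIdeal_add, eq_bot_iff, ← hn]
    exact derivedSeriesOfIdeal_mono hIR n
  have := (LieIdeal.solvable_iff_le_radical K L I).1 hI
  exact this (Submodule.mem_sup_right ⟨x, hx, rfl⟩)

end Radical

end DerTower

namespace DerTower

/-! ### Levi's theorem. -/

section Levi

open LieAlgebra LieModule Module

variable {K : Type u} [Field K] {L : Type v} [LieRing L] [LieAlgebra K L]

/-- The quotient map by an ideal, as a morphism of Lie algebras. -/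
def quotientHom (I : LieIdeal K L) : L →ₗ⁅K⁆ L ⧸ I :=
  { (LieSubmodule.Quotient.mk' I : L →ₗ[K] L ⧸ I) with
    map_lie' := fun {x y} => LieSubmodule.Quotient.mk_bracket _ x y }

theorem quotientHom_surjective (I : LieIdeal K L) : Function.Surjective (quotientHom I) :=
  LieSubmodule.Quotient.surjective_mk' I

theorem quotientHom_eq_zero {I : LieIdeal K L} {x : L} : quotientHom I x = 0 ↔ x ∈ I :=
  LieSubmodule.Quotient.mk_eq_zero I

theorem derivedSeriesOfIdeal_comap_le {L' : Type w} [LieRing L'] [LieAlgebra K L']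
    (f : L →ₗ⁅K⁆ L') (I : LieIdeal K L') (n : ℕ) :
    derivedSeriesOfIdeal K L n (I.comap f) ≤ (derivedSeriesOfIdeal K L' n I).comap f := by
  induction n with
  | zero => exact le_rfl
  | succ n ih =>
    rw [derivedSeriesOfIdeal_succ, derivedSeriesOfIdeal_succ, LieSubmodule.lie_le_iff]
    intro x hx y hy
    rw [LieIdeal.mem_comap, LieHom.map_lie]
    exact LieSubmodule.lie_mem_lie (LieIdeal.mem_comap.1 (ih hx)) (LieIdeal.mem_comap.1 (ih hy))

variable [FiniteDimensional K L]

omit [FiniteDimensional K L] in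
theorem isSolvable_of_derivedSeriesOfIdeal_le {I J : LieIdeal K L} [hJ : IsSolvable J] (n : ℕ)
    (h : derivedSeriesOfIdeal K L n I ≤ J) : IsSolvable I := by
  obtain ⟨j, hj⟩ := IsSolvable.solvable K J
  rw [LieIdeal.derivedSeries_eq_bot_iff] at hj
  refine IsSolvable.mk (R := K) (k := j + n) ((LieIdeal.derivedSeries_eq_bot_iff I _).mpr ?_)
  rw [derivedSeriesOfIdeal_add, eq_bot_iff, ← hj]
  exact derivedSeriesOfIdeal_mono h j

instance hasTrivialRadical_quotient : HasTrivialRadical K (L ⧸ radical K L) := by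
  refine hasTrivialRadical_of_no_solvable_ideals fun I hI => ?_
  obtain ⟨n, hn⟩ := IsSolvable.solvable K I
  rw [LieIdeal.derivedSeries_eq_bot_iff] at hn
  have hsol : IsSolvable (I.comap (quotientHom (radical K L))) := by
    refine isSolvable_of_derivedSeriesOfIdeal_le (J := radical K L) n ?_
    refine (derivedSeriesOfIdeal_comap_le _ _ _).trans fun x hx => ?_
    rw [hn, LieIdeal.mem_comap, LieSubmodule.mem_bot] at hx
    exact quotientHom_eq_zero.1 hx
  have hle := (LieIdeal.solvable_iff_le_radical K L _).1 hsol
  rw [LieSubmodule.eq_bot_iff]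
  intro x hx
  obtain ⟨y, rfl⟩ := quotientHom_surjective _ x
  exact quotientHom_eq_zero.2 (hle (LieIdeal.mem_comap.2 hx))

variable [CharZero K]

/-- Whitehead's first lemma for a module on which the radical acts trivially. -/
theorem exists_eq_lie_of_radical {M : Type w} [AddCommGroup M] [Module K M] [LieRingModule L M]
    [LieModule K L M] [FiniteDimensional K M] (δ : LieDerivation K L M)
    (hM : ∀ x ∈ radical K L, ∀ m : M, ⁅x, m⁆ = 0) (hδ : ∀ x ∈ radical K L, δ x = 0) :
    ∃ m : M, ∀ x, δ x = ⁅x, m⁆ := by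
  let r := radical K L
  let ρ₀ : (L ⧸ r) →ₗ[K] Module.End K M :=
    r.toSubmodule.liftQ (toEnd K L M : L →ₗ[K] _) fun x hx => LinearMap.ext (hM x hx)
  have hρ₀ : ∀ x, ρ₀ (quotientHom r x) = toEnd K L M x := fun x => rfl
  let ρ : (L ⧸ r) →ₗ⁅K⁆ Module.End K M :=
    { ρ₀ with
      map_lie' := fun {x y} => by
        obtain ⟨x, rfl⟩ := quotientHom_surjective r x
        obtain ⟨y, rfl⟩ := quotientHom_surjective r y
        change ρ₀ _ = ⁅ρ₀ _, ρ₀ _⁆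
        rw [← LieHom.map_lie, hρ₀, hρ₀, hρ₀, LieHom.map_lie] }
  let _ : LieRingModule (L ⧸ r) M := LieRingModule.compLieHom M ρ
  have _ : LieModule K (L ⧸ r) M := LieModule.compLieHom M ρ
  have hact : ∀ (x : L) (m : M), ⁅quotientHom r x, m⁆ = ⁅x, m⁆ := fun x m => rfl
  let δ₀ : (L ⧸ r) →ₗ[K] M := r.toSubmodule.liftQ δ.toLinearMap hδ
  have hδ₀ : ∀ x, δ₀ (quotientHom r x) = δ x := fun x => rfl
  let δ' : LieDerivation K (L ⧸ r) M :=
    { toLinearMap := δ₀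
      leibniz' := fun x y => by
        obtain ⟨x, rfl⟩ := quotientHom_surjective r x
        obtain ⟨y, rfl⟩ := quotientHom_surjective r y
        change δ₀ _ = ⁅_, δ₀ _⁆ - ⁅_, δ₀ _⁆
        rw [← LieHom.map_lie, hδ₀, hδ₀, hδ₀, hact, hact, LieDerivation.apply_lie_eq_sub] }
  have _ : FiniteDimensional K (L ⧸ r) :=
    inferInstanceAs (FiniteDimensional K (L ⧸ r.toSubmodule))
  obtain ⟨m, hm⟩ := exists_eq_lie δ'
  exact ⟨m, fun x => hm (quotientHom r x)⟩

omit [FiniteDimensional K L] [CharZero K] in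
theorem eq_bot_of_le_lie_self (r : LieIdeal K L) [IsSolvable r] (h : r ≤ ⁅r, r⁆) : r = ⊥ := by
  obtain ⟨j, hj⟩ := IsSolvable.solvable K r
  rw [LieIdeal.derivedSeries_eq_bot_iff] at hj
  have : ∀ n, derivedSeriesOfIdeal K L n r = r := by
    intro n
    induction n with
    | zero => rfl
    | succ n ih =>
      rw [derivedSeriesOfIdeal_succ, ih]
      exact le_antisymm (LieSubmodule.lie_le_left r r) h
  rw [← this j, hj]

/-- Put `A = r / [r, r]`. The goal is an `L`-equivariant `φ : L → A` extending the quotient map on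
`r`: its kernel is a subalgebra supplementing `r`, hence all of `L`, so `r ≤ [r, r]` and `r = 0` by
solvability. A linear extension `p` has `x · p` in the space `W` of maps into `A` killing `r`.
Modulo the subspace `P` of maps `y ↦ [a, y]` with `a ∈ r`, this cocycle kills `r`, and Whitehead's
lemma gives a correction `f`. -/
theorem radical_eq_bot_of_forall_sup_eq_top
    (h : ∀ U : LieSubalgebra K L, U.toSubmodule ⊔ (radical K L).toSubmodule = ⊤ → U = ⊤) :
    radical K L = ⊥ := by
  set r := radical K L with hr
  refine eq_bot_of_le_lie_self r ?_
  let mk : L →ₗ⁅K, L⁆ (L ⧸ ⁅r, r⁆) := LieSubmodule.Quotient.mk' ⁅r, r⁆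
  have hmk0 : ∀ x, mk x = 0 ↔ x ∈ ⁅r, r⁆ := fun x => LieSubmodule.Quotient.mk_eq_zero _
  let A : LieSubmodule K L (L ⧸ ⁅r, r⁆) := LieSubmodule.map mk r
  have hA : ∀ a ∈ r, ∀ y ∈ A, ⁅a, y⁆ = 0 := by
    rintro a ha y hy
    obtain ⟨b, hb, rfl⟩ := (LieSubmodule.mem_map _).1 hy
    rw [← LieModuleHom.map_lie, hmk0]
    exact LieSubmodule.lie_mem_lie ha hb
  have hmkA : ∀ a ∈ r, mk a ∈ A := fun a ha => (LieSubmodule.mem_map _).2 ⟨a, ha, rfl⟩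
  have _ : FiniteDimensional K (L ⧸ ⁅r, r⁆) :=
    inferInstanceAs (FiniteDimensional K (L ⧸ (⁅r, r⁆ : LieIdeal K L).toSubmodule))
  let W : LieSubmodule K L (L →ₗ[K] (L ⧸ ⁅r, r⁆)) :=
    { carrier := {f | (∀ x, f x ∈ A) ∧ ∀ x ∈ r, f x = 0}
      zero_mem' := by simp
      add_mem' := fun {f g} hf hg => ⟨fun x => add_mem (hf.1 x) (hg.1 x),
        fun x hx => by simp [hf.2 x hx, hg.2 x hx]⟩
      smul_mem' := fun c f hf => ⟨fun x => A.smul_mem c (hf.1 x), fun x hx => by simp [hf.2 x hx]⟩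
      lie_mem := fun {x f} hf => ⟨fun y => by
          rw [LieHom.lie_apply]
          exact sub_mem (A.lie_mem (hf.1 y)) (hf.1 _), fun y hy => by
          rw [LieHom.lie_apply, hf.2 y hy, hf.2 _ (r.lie_mem hy), lie_zero, sub_zero]⟩ }
  let P₀ : L →ₗ[K] (L →ₗ[K] (L ⧸ ⁅r, r⁆)) :=
    LinearMap.mk₂ K (fun a y => mk ⁅a, y⁆) (by intros; simp) (by intros; simp) (by intros; simp)
      (by intros; simp)
  have hP₀ : ∀ x a : L, ⁅x, P₀ a⁆ = P₀ ⁅x, a⁆ := by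
    intro x a
    ext y
    rw [LieHom.lie_apply]
    change ⁅x, mk ⁅a, y⁆⁆ - mk ⁅a, ⁅x, y⁆⁆ = mk ⁅⁅x, a⁆, y⁆
    rw [← LieModuleHom.map_lie, lie_lie, map_sub]
  have hP₀W : ∀ a ∈ r, P₀ a ∈ W := fun a ha =>
    ⟨fun y => hmkA _ (lie_mem_left K L r _ _ ha), fun y hy =>
      (hmk0 _).2 (LieSubmodule.lie_mem_lie ha hy)⟩
  let P : LieSubmodule K L W :=
    { (r.toSubmodule.map P₀).comap W.toSubmodule.subtype with
      lie_mem := fun {x f} hf => by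
        obtain ⟨a, ha, hf⟩ := hf
        exact ⟨⁅x, a⁆, r.lie_mem ha, by
          rw [← hP₀, hf]
          rfl⟩ }
  have hPmem : ∀ f : W, f ∈ P ↔ ∃ a ∈ r, P₀ a = f := fun f => Iff.rfl
  have hWtriv : ∀ a ∈ r, ∀ f : W, ⁅a, f⁆ = 0 := by
    intro a ha f
    refine Subtype.ext (LinearMap.ext fun y => ?_)
    change ⁅a, (f : L →ₗ[K] (L ⧸ ⁅r, r⁆))⁆ y = 0
    rw [LieHom.lie_apply, hA a ha _ (f.2.1 y), f.2.2 _ (lie_mem_left K L r _ _ ha), sub_zero]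
  obtain ⟨π₀, hπ₀⟩ := LinearMap.exists_leftInverse_of_injective r.toSubmodule.subtype
    r.toSubmodule.ker_subtype
  let p : L →ₗ[K] (L ⧸ ⁅r, r⁆) := (mk : L →ₗ[K] _) ∘ₗ r.toSubmodule.subtype ∘ₗ π₀
  have hpA : ∀ x, p x ∈ A := fun x => hmkA _ (π₀ x).2
  have hpr : ∀ x ∈ r, p x = mk x := fun x hx =>
    congrArg (fun z : r => mk (z : L)) (LinearMap.congr_fun hπ₀ ⟨x, hx⟩)
  have hδW : ∀ x : L, ⁅x, p⁆ ∈ W := fun x => ⟨fun y => by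
      rw [LieHom.lie_apply]
      exact sub_mem (A.lie_mem (hpA y)) (hpA _), fun y hy => by
      rw [LieHom.lie_apply, hpr y hy, hpr _ (r.lie_mem hy), LieModuleHom.map_lie, sub_self]⟩
  let δ₀ : LieDerivation K L W :=
    { toFun := fun x => ⟨⁅x, p⁆, hδW x⟩
      map_add' := fun x y => Subtype.ext (by simp)
      map_smul' := fun c x => Subtype.ext (by simp)
      leibniz' := fun a b => Subtype.ext (by simp) }
  let δ : LieDerivation K L (W ⧸ P) :=
    { toLinearMap := (LieSubmodule.Quotient.mk' P : W →ₗ[K] W ⧸ P) ∘ₗ δ₀.toLinearMap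
      leibniz' := fun a b => by
        simp only [LinearMap.comp_apply, LieDerivation.coeFn_coe, LieDerivation.apply_lie_eq_sub]
        rfl }
  have _ : FiniteDimensional K (W ⧸ P) := inferInstanceAs (FiniteDimensional K (W ⧸ P.toSubmodule))
  -- Elements of `r` move such a `φ` exactly through `P`. So when all `x · φ` lie in `P`, each `x`
  -- can be corrected by an element of `r` to fix `φ`: the stabilizer of `φ` supplements `r` and is
  -- `L` by hypothesis.
  have hap : ∀ (φ : L →ₗ[K] (L ⧸ ⁅r, r⁆)), (∀ x, φ x ∈ A) → (∀ x ∈ r, φ x = mk x) → ∀ a ∈ r,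
      ⁅a, φ⁆ = - P₀ a := by
    intro φ hφA hφr a ha
    ext y
    rw [LieHom.lie_apply, hA a ha _ (hφA y), hφr _ (lie_mem_left K L r _ _ ha), zero_sub]
    rfl
  obtain ⟨m, hm⟩ := exists_eq_lie_of_radical δ (by
      intro x hx m
      obtain ⟨f, rfl⟩ := LieSubmodule.Quotient.surjective_mk' P m
      rw [← LieModuleHom.map_lie, hWtriv x hx, map_zero]) (by
      intro x hx
      change LieSubmodule.Quotient.mk' P (δ₀ x) = 0
      rw [LieSubmodule.Quotient.mk_eq_zero, hPmem]
      refine ⟨-x, neg_mem hx, ?_⟩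
      rw [map_neg]
      exact (hap p hpA hpr x hx).symm)
  obtain ⟨f, rfl⟩ := LieSubmodule.Quotient.surjective_mk' P m
  let φ : L →ₗ[K] (L ⧸ ⁅r, r⁆) := p - (f : L →ₗ[K] (L ⧸ ⁅r, r⁆))
  have hφA : ∀ x, φ x ∈ A := fun x => sub_mem (hpA x) (f.2.1 x)
  have hφr : ∀ x ∈ r, φ x = mk x := fun x hx => by
    change p x - (f : L →ₗ[K] (L ⧸ ⁅r, r⁆)) x = mk x
    rw [f.2.2 x hx, sub_zero, hpr x hx]
  have hφP : ∀ x : L, ∃ a ∈ r, P₀ a = ⁅x, φ⁆ := by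
    intro x
    have h1 : LieSubmodule.Quotient.mk' P (δ₀ x) = ⁅x, LieSubmodule.Quotient.mk' P f⁆ := hm x
    have h2 : δ₀ x - ⁅x, f⁆ ∈ P := by
      rw [← LieSubmodule.Quotient.mk_eq_zero, map_sub, h1, LieModuleHom.map_lie, sub_self]
    obtain ⟨a, ha, h3⟩ := (hPmem _).1 h2
    refine ⟨a, ha, h3.trans ?_⟩
    rw [lie_sub]
    rfl
  let S : LieSubalgebra K L :=
    { carrier := {x | ⁅x, φ⁆ = 0}
      zero_mem' := zero_lie φ
      add_mem' := fun {x y} hx hy => by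
        rw [Set.mem_ofPred_eq] at hx hy ⊢
        rw [add_lie, hx, hy, add_zero]
      smul_mem' := fun c x hx => by
        rw [Set.mem_ofPred_eq] at hx ⊢
        rw [smul_lie, hx, smul_zero]
      lie_mem' := fun {x y} hx hy => by
        change ⁅⁅x, y⁆, φ⁆ = 0
        have hx' : ⁅x, φ⁆ = 0 := hx
        have hy' : ⁅y, φ⁆ = 0 := hy
        rw [lie_lie, hx', hy', lie_zero, lie_zero, sub_zero] }
  have hS : S = ⊤ := by
    refine h S (eq_top_iff.2 fun x _ => ?_)
    obtain ⟨a, ha, hax⟩ := hφP x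
    refine Submodule.mem_sup.2 ⟨x + a, ?_, -a, neg_mem ha, by abel⟩
    change ⁅x + a, φ⁆ = 0
    rw [add_lie, hap φ hφA hφr a ha, ← hax, add_neg_cancel]
  have hφeq : ∀ x y : L, φ ⁅x, y⁆ = ⁅x, φ y⁆ := by
    intro x y
    have : x ∈ S := hS ▸ LieSubalgebra.mem_top x
    have h1 : ⁅x, φ⁆ = 0 := this
    have h2 := LinearMap.congr_fun h1 y
    rw [LieHom.lie_apply, LinearMap.zero_apply, sub_eq_zero] at h2
    exact h2.symm
  let T : LieSubalgebra K L :=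
    { LinearMap.ker φ with
      lie_mem' := fun {x y} _ hy => by
        change φ ⁅x, y⁆ = 0
        have hy' : φ y = 0 := hy
        rw [hφeq, hy', lie_zero] }
  have hT : T = ⊤ := by
    refine h T (eq_top_iff.2 fun x _ => ?_)
    obtain ⟨a, ha, hax⟩ := (LieSubmodule.mem_map _).1 (hφA x)
    refine Submodule.mem_sup.2 ⟨x - a, ?_, a, ha, by abel⟩
    change φ (x - a) = 0
    rw [map_sub, hφr a ha, hax, sub_self]
  intro x hx
  have : x ∈ T := hT ▸ LieSubalgebra.mem_top x
  have h1 : φ x = 0 := this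
  rw [hφr x hx] at h1
  exact (hmk0 x).1 h1

/-- Levi's theorem. -/
theorem exists_levi : ∃ s : LieSubalgebra K L, HasTrivialRadical K s ∧
    IsCompl s.toSubmodule (radical K L).toSubmodule := by
  set r := radical K L with hr
  -- A subalgebra `U` of least dimension with `U + r = L` is a Levi subalgebra. Its radical is `U ∩
  -- r`, because `U` maps onto the semisimple quotient `L / r`, and minimality passes to supplements
  -- of that radical in `U`.
  let P : ℕ → Prop := fun n => ∃ U : LieSubalgebra K L,
    U.toSubmodule ⊔ r.toSubmodule = ⊤ ∧ finrank K U = n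
  have hP : ∃ n, P n := ⟨_, ⊤, by simp, rfl⟩
  classical
  obtain ⟨U, hU, hUn⟩ := Nat.find_spec hP
  have hmin : ∀ V : LieSubalgebra K L, V.toSubmodule ⊔ r.toSubmodule = ⊤ →
      finrank K U ≤ finrank K V := fun V hV => hUn ▸ Nat.find_min' hP ⟨V, hV, rfl⟩
  have hrad1 : ∀ x : U, (x : L) ∈ r → x ∈ radical K U := by
    have hsol : IsSolvable (r.comap U.incl) := by
      obtain ⟨n, hn⟩ := IsSolvable.solvable K r
      rw [LieIdeal.derivedSeries_eq_bot_iff] at hn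
      refine IsSolvable.mk (R := K) (k := n) ((LieIdeal.derivedSeries_eq_bot_iff _ _).mpr ?_)
      rw [eq_bot_iff]
      intro x hx
      have := derivedSeriesOfIdeal_comap_le U.incl r n hx
      rw [hn, LieIdeal.mem_comap, LieSubmodule.mem_bot] at this
      exact (LieSubmodule.mem_bot x).2 (Subtype.ext this)
    intro x hx
    exact (LieIdeal.solvable_iff_le_radical K U _).1 hsol (LieIdeal.mem_comap.2 hx)
  have hrad2 : ∀ x ∈ radical K U, (x : L) ∈ r := by
    let f : U →ₗ⁅K⁆ L ⧸ r := (quotientHom r).comp U.incl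
    have hf : Function.Surjective f := by
      intro y
      obtain ⟨y, rfl⟩ := quotientHom_surjective r y
      have hy : y ∈ U.toSubmodule ⊔ r.toSubmodule := hU ▸ Submodule.mem_top
      obtain ⟨a, ha, b, hb, rfl⟩ := Submodule.mem_sup.1 hy
      refine ⟨⟨a, ha⟩, ?_⟩
      rw [map_add, quotientHom_eq_zero.2 hb, add_zero]
      rfl
    have hI : (radical K U).map f = ⊥ := by
      have hsol : IsSolvable ((radical K U).map f) := by
        obtain ⟨n, hn⟩ := IsSolvable.solvable K (radical K U)
        rw [LieIdeal.derivedSeries_eq_bot_iff] at hn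
        refine IsSolvable.mk (R := K) (k := n) ((LieIdeal.derivedSeries_eq_bot_iff _ _).mpr ?_)
        have : ∀ n, derivedSeriesOfIdeal K _ n ((radical K U).map f) ≤
            (derivedSeriesOfIdeal K U n (radical K U)).map f := by
          intro n
          induction n with
          | zero => exact le_rfl
          | succ n ih =>
            rw [derivedSeriesOfIdeal_succ, derivedSeriesOfIdeal_succ, LieSubmodule.lie_le_iff]
            intro x hx y hy
            obtain ⟨x, rfl⟩ := LieIdeal.mem_map_of_surjective hf (ih hx)
            obtain ⟨y, rfl⟩ := LieIdeal.mem_map_of_surjective hf (ih hy)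
            rw [← LieHom.map_lie]
            exact LieIdeal.mem_map (LieSubmodule.lie_mem_lie x.2 y.2)
        rw [eq_bot_iff]
        refine (this n).trans ?_
        rw [hn]
        exact LieIdeal.map_le_iff_le_comap.2 bot_le
      exact HasTrivialRadical.eq_bot_of_isSolvable (R := K) _
    intro x hx
    have h1 : f x ∈ (radical K U).map f := LieIdeal.mem_map hx
    rw [hI, LieSubmodule.mem_bot] at h1
    exact quotientHom_eq_zero.1 h1
  have hUrad : radical K U = ⊥ := by
    refine radical_eq_bot_of_forall_sup_eq_top fun V hV => ?_
    have h1 : (V.map U.incl).toSubmodule ⊔ r.toSubmodule = ⊤ := by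
      rw [eq_top_iff, ← hU]
      refine sup_le (fun x hx => ?_) le_sup_right
      have hx' : (⟨x, hx⟩ : U) ∈ V.toSubmodule ⊔ (radical K U).toSubmodule :=
        hV ▸ Submodule.mem_top
      obtain ⟨a, ha, b, hb, hab⟩ := Submodule.mem_sup.1 hx'
      refine Submodule.mem_sup.2 ⟨a, ⟨a, ha, rfl⟩, b, hrad2 b hb, ?_⟩
      exact congrArg Subtype.val hab
    have h2 := hmin _ h1
    have h3 : finrank K (V.map U.incl) = finrank K V :=
      (Submodule.equivMapOfInjective _ Subtype.val_injective _).finrank_eq.symm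
    rw [h3] at h2
    exact (LieSubalgebra.toSubmodule_eq_top _).1
      (Submodule.eq_top_of_finrank_eq (le_antisymm (Submodule.finrank_le _) h2))
  refine ⟨U, ⟨hUrad⟩, ?_, codisjoint_iff.2 hU⟩
  rw [Submodule.disjoint_def]
  intro x hxU hxr
  have := hrad1 ⟨x, hxU⟩ hxr
  rw [hUrad, LieSubmodule.mem_bot] at this
  exact congrArg Subtype.val this

end Levi

end DerTower

namespace DerTower

open LieAlgebra LieModule Module

variable {K : Type u} [Field K] [CharZero K] {L : Type v} [LieRing L] [LieAlgebra K L]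
  [FiniteDimensional K L]

/-! ### Invariants of a semisimple subalgebra and existence of Γ-triples. -/

section Levi

variable {s : LieSubalgebra K L} [HasTrivialRadical K s] {V : Submodule K L}

/-- For a semisimple subalgebra `s` and an `s`-stable subspace `V`, one has
`V = Vˢ ⊕ [s, V]`. -/
theorem exists_add_of_stable (hV : ∀ x ∈ s, ∀ z ∈ V, ⁅x, z⁆ ∈ V) :
    (∀ z ∈ V, ∃ c ∈ V, (∀ x ∈ s, ⁅x, c⁆ = 0) ∧
      z - c ∈ Submodule.span K {w : L | ∃ x ∈ s, ∃ z ∈ V, ⁅x, z⁆ = w}) ∧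
    ∀ z ∈ Submodule.span K {w : L | ∃ x ∈ s, ∃ z ∈ V, ⁅x, z⁆ = w},
      (∀ x ∈ s, ⁅x, z⁆ = 0) → z = 0 := by
  let M : LieSubmodule K s L :=
    { V with lie_mem := fun {x z} hz => hV x x.2 z hz }
  have hc := isCompl_maxTriv_lie_top (K := K) (q := s) (M := M)
  have hmax : ∀ z : M, z ∈ maxTrivSubmodule K s M ↔ ∀ x ∈ s, ⁅x, (z : L)⁆ = 0 := by
    intro z
    rw [mem_maxTrivSubmodule]
    exact ⟨fun h x hx => congrArg Subtype.val (h ⟨x, hx⟩), fun h x => Subtype.ext (h x x.2)⟩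
  have hspan : (⁅(⊤ : LieIdeal K s), (⊤ : LieSubmodule K s M)⁆.toSubmodule).map
      M.toSubmodule.subtype = Submodule.span K {w : L | ∃ x ∈ s, ∃ z ∈ V, ⁅x, z⁆ = w} := by
    rw [LieSubmodule.lieIdeal_oper_eq_linear_span', Submodule.map_span]
    congr 1
    ext w
    constructor
    · rintro ⟨_, ⟨x, -, z, -, rfl⟩, rfl⟩
      exact ⟨x, x.2, z, z.2, rfl⟩
    · rintro ⟨x, hx, z, hz, rfl⟩
      let x' : s := ⟨x, hx⟩
      let z' : M := ⟨z, hz⟩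
      exact ⟨(⁅x', z'⁆ : M), ⟨x', trivial, z', trivial, rfl⟩, rfl⟩
  rw [← hspan]
  constructor
  · intro z hz
    have h : (⟨z, hz⟩ : M) ∈ maxTrivSubmodule K s M ⊔
        ⁅(⊤ : LieIdeal K s), (⊤ : LieSubmodule K s M)⁆ := by
      rw [hc.sup_eq_top]
      exact LieSubmodule.mem_top _
    obtain ⟨a, ha, b, hb, hab⟩ := (LieSubmodule.mem_sup _ _ _).1 h
    refine ⟨a, a.2, (hmax a).1 ha, b, hb, ?_⟩
    have : (a : L) + b = z := congrArg Subtype.val hab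
    rw [← this]
    simp
  · rintro _ ⟨z, hz, rfl⟩ h
    let z' : M := z
    have : z' ∈ maxTrivSubmodule K s M ⊓ ⁅(⊤ : LieIdeal K s), (⊤ : LieSubmodule K s M)⁆ :=
      ⟨(hmax z').2 h, hz⟩
    rw [hc.inf_eq_bot, LieSubmodule.mem_bot] at this
    exact congrArg Subtype.val this

end Levi

variable (K L) in
/-- Every finite-dimensional Lie algebra in characteristic zero has a `Γ`-triple. -/
theorem nonempty_gammaTriple : Nonempty (GammaTriple K L) := by
  obtain ⟨s, hs, hcompl⟩ := exists_levi (K := K) (L := L)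
  set r := radical K L with hr
  have hrs : ∀ x ∈ s, ∀ z ∈ r.toSubmodule, ⁅x, z⁆ ∈ r.toSubmodule := fun x _ z hz => r.lie_mem hz
  obtain ⟨hY1, hY2⟩ := exists_add_of_stable hrs
  set Y := Submodule.span K {w : L | ∃ x ∈ s, ∃ z ∈ r.toSubmodule, ⁅x, z⁆ = w} with hY
  have hYr : Y ≤ r.toSubmodule := by
    rw [hY, Submodule.span_le]
    rintro _ ⟨x, hx, z, hz, rfl⟩
    exact hrs x hx z hz
  -- `C` is the centralizer of `s` in the radical, so `r = [s, r] ⊕ C`. A Cartan subalgebra `H` of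
  -- `C` is its own zero root space, and Fitting gives `C = H ⊕ P` with `[H, P] = P`; the triple is
  -- `k = H`, `m = [s, r] ⊕ P`.
  let C : LieSubalgebra K L :=
    { carrier := {z | z ∈ r ∧ ∀ x ∈ s, ⁅x, z⁆ = 0}
      zero_mem' := ⟨zero_mem _, fun x _ => lie_zero x⟩
      add_mem' := fun {a b} ha hb => ⟨add_mem ha.1 hb.1, fun x hx => by
        rw [lie_add, ha.2 x hx, hb.2 x hx, add_zero]⟩
      smul_mem' := fun c a ha => ⟨r.smul_mem c ha.1, fun x hx => by
        rw [lie_smul, ha.2 x hx, smul_zero]⟩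
      lie_mem' := fun {a b} ha hb => ⟨r.lie_mem hb.1, fun x hx => by
        rw [leibniz_lie, ha.2 x hx, hb.2 x hx, zero_lie, lie_zero, add_zero]⟩ }
  have _ : Infinite K := inferInstance
  obtain ⟨x₀, hcartan⟩ := exists_isCartanSubalgebra_engel K C
  set H : LieSubalgebra K C := LieSubalgebra.engel K x₀ with hH
  obtain ⟨P, hP1, hP2, hP3, -⟩ := exists_fitting (toEnd K H C)
  have hroot : ∀ v : C, v ∈ H ↔ ∀ y : H, ∃ n : ℕ, (toEnd K H C y ^ n) v = 0 := by
    intro v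
    rw [← LieSubalgebra.mem_toLieSubmodule, ← rootSpace_zero_eq K C H, mem_genWeightSpace]
    simp only [Pi.zero_apply, zero_smul, sub_zero]
  let k : LieSubalgebra K L := H.map C.incl
  have hkC : ∀ y ∈ k, ∃ h : C, h ∈ H ∧ (h : L) = y := fun y hy => hy
  have hks : ∀ x ∈ s, ∀ y ∈ k, ⁅x, y⁆ = 0 := by
    rintro x hx _ ⟨h, -, rfl⟩
    exact h.2.2 x hx
  let P' : Submodule K L := P.map C.toSubmodule.subtype
  have hPs : ∀ x ∈ s, ∀ p ∈ P', ⁅x, p⁆ = 0 := by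
    rintro x hx _ ⟨p, -, rfl⟩
    exact p.2.2 x hx
  have hPr : P' ≤ r.toSubmodule := by
    rintro _ ⟨p, -, rfl⟩
    exact p.2.1
  have hkr : k.toSubmodule ≤ r.toSubmodule := by
    rintro _ ⟨p, -, rfl⟩
    exact p.2.1
  have hYP : ∀ y ∈ Y, (∀ x ∈ s, ⁅x, y⁆ = 0) → y = 0 := hY2
  have hsY : ∀ x ∈ s, ∀ y ∈ r.toSubmodule, ⁅x, y⁆ ∈ Y := fun x hx y hy =>
    Submodule.subset_span ⟨x, hx, y, hy, rfl⟩
  have hkY : ∀ h ∈ k, ∀ y ∈ Y, ⁅h, y⁆ ∈ Y := by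
    intro h hh y hy
    induction hy using Submodule.span_induction with
    | mem y hy =>
      obtain ⟨x, hx, z, hz, rfl⟩ := hy
      have : ⁅h, x⁆ = 0 := by rw [← lie_skew, hks x hx h hh, neg_zero]
      rw [leibniz_lie, this, zero_lie, zero_add]
      exact hsY x hx _ (r.lie_mem hz)
    | zero => rw [lie_zero]; exact zero_mem _
    | add a b _ _ ha hb => rw [lie_add]; exact add_mem ha hb
    | smul c a _ ha => rw [lie_smul]; exact Y.smul_mem c ha
  have hkP : ∀ h ∈ k, ∀ p ∈ P', ⁅h, p⁆ ∈ P' := by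
    rintro _ ⟨h, hh, rfl⟩ _ ⟨p, hp, rfl⟩
    refine ⟨⁅h, p⁆, ?_, rfl⟩
    have hp' : p ∈ P := hp
    change ⁅h, p⁆ ∈ P
    rw [hP3]
    exact Submodule.subset_span ⟨⟨h, hh⟩, p, hp', rfl⟩
  have hnil : LieRing.IsNilpotent k := by
    let f : H →ₗ⁅K⁆ k :=
      { toFun := fun h => ⟨((h : C) : L), ⟨h, h.2, rfl⟩⟩
        map_add' := fun _ _ => rfl
        map_smul' := fun _ _ => rfl
        map_lie' := fun {_ _} => rfl }
    have hf : Function.Surjective f := by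
      rintro ⟨_, ⟨h, hh, rfl⟩⟩
      exact ⟨⟨h, hh⟩, rfl⟩
    exact hf.lieAlgebra_isNilpotent
  refine ⟨{ s := s, k := k, m := Y ⊔ P', semisimple_s := hs, isCompl_s := hcompl,
            nilpotent_k := hnil, lie_s_k := hks, disjoint_m_k := ?_, sup_m_k := ?_,
            span_lie := ?_ }⟩
  · rw [Submodule.disjoint_def]
    rintro _ hyp ⟨h, hh, rfl⟩
    obtain ⟨y, hy, _, ⟨p, hp, rfl⟩, hyp⟩ := Submodule.mem_sup.1 hyp
    have hy0 : y = 0 := by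
      have : y = ((h - p : C) : L) := eq_sub_of_add_eq hyp
      refine hYP y hy fun x hx => ?_
      rw [this]
      exact (h - p).2.2 x hx
    rw [hy0, zero_add] at hyp
    have hph : p = h := Subtype.ext hyp
    have hh' : h ∈ H := hh
    have : h = 0 := hP2 h (hph ▸ hp) ((hroot h).1 hh')
    rw [this, map_zero]
  · refine le_antisymm (sup_le (sup_le hYr hPr) hkr) fun z hz => ?_
    obtain ⟨c, hc, hcs, hzc⟩ := hY1 z hz
    obtain ⟨v₀, hv₀, hv₁⟩ := hP1 ⟨c, hc, hcs⟩
    have h1 : z = (z - c) + (c - (v₀ : L)) + v₀ := by abel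
    rw [h1]
    exact add_mem (Submodule.mem_sup_left (add_mem (Submodule.mem_sup_left hzc)
      (Submodule.mem_sup_right ⟨_, hv₁, rfl⟩)))
      (Submodule.mem_sup_right ⟨v₀, (hroot v₀).2 hv₀, rfl⟩)
  · apply le_antisymm
    · rw [Submodule.span_le]
      rintro _ ⟨x, hx, z, hz, rfl⟩
      obtain ⟨a, ha, h, hh, rfl⟩ := Submodule.mem_sup.1 hx
      obtain ⟨y, hy, p, hp, rfl⟩ := Submodule.mem_sup.1 hz
      rw [add_lie, lie_add, lie_add, hPs a ha p hp, add_zero]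
      exact add_mem (Submodule.mem_sup_left (hsY a ha y (hYr hy)))
        (add_mem (Submodule.mem_sup_left (hkY h hh y hy)) (Submodule.mem_sup_right (hkP h hh p hp)))
    · refine sup_le ?_ ?_
      · rw [hY, Submodule.span_le]
        rintro _ ⟨x, hx, z, hz, rfl⟩
        obtain ⟨c, hc, hcs, hzc⟩ := hY1 z hz
        have : ⁅x, z⁆ = ⁅x, z - c⁆ := by rw [lie_sub, hcs x hx, sub_zero]
        rw [this]
        exact Submodule.subset_span ⟨x, Submodule.mem_sup_left hx, _, Submodule.mem_sup_left hzc, rfl⟩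
      · change P.map C.toSubmodule.subtype ≤ _
        rw [hP3, Submodule.map_span, Submodule.span_le]
        rintro _ ⟨_, ⟨h, p, hp, rfl⟩, rfl⟩
        exact Submodule.subset_span ⟨h, Submodule.mem_sup_right ⟨h, h.2, rfl⟩, p,
          Submodule.mem_sup_right ⟨p, hp, rfl⟩, rfl⟩

/-! ### Projections of a Γ-triple, weight-zero vectors of `m`, injectivity of `μ`. -/

namespace GammaTriple

variable (T : GammaTriple K L)

omit [CharZero K] [FiniteDimensional K L] in
theorem m_le_radical : T.m ≤ (radical K L).toSubmodule := T.sup_m_k ▸ le_sup_left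

omit [CharZero K] [FiniteDimensional K L] in
theorem k_le_radical : T.k.toSubmodule ≤ (radical K L).toSubmodule := T.sup_m_k ▸ le_sup_right

omit [CharZero K] [FiniteDimensional K L] in
theorem lie_m_mem_radical {z : L} (hz : z ∈ T.m) (x : L) : ⁅x, z⁆ ∈ radical K L :=
  (radical K L).lie_mem (T.m_le_radical hz)

omit [CharZero K] [FiniteDimensional K L] in
theorem projK_of_mem_k {x : L} (hx : x ∈ T.k) : T.projK x = ⟨x, hx⟩ :=
  Submodule.projectionOnto_apply_of_mem_left _ hx

omit [CharZero K] [FiniteDimensional K L] in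
theorem projK_of_mem_m {x : L} (hx : x ∈ T.m) : T.projK x = 0 :=
  (Submodule.projectionOnto_apply_eq_zero_iff _).2 (Submodule.mem_sup_left hx)

omit [CharZero K] [FiniteDimensional K L] in
theorem projM_of_mem_m {x : L} (hx : x ∈ T.m) : T.projM x = ⟨x, hx⟩ :=
  Submodule.projectionOnto_apply_of_mem_left _ hx

omit [CharZero K] [FiniteDimensional K L] in
theorem projM_of_mem_k {x : L} (hx : x ∈ T.k) : T.projM x = 0 :=
  (Submodule.projectionOnto_apply_eq_zero_iff _).2 (Submodule.mem_sup_left hx)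

omit [CharZero K] [FiniteDimensional K L] in
theorem projK_add_projM {x : L} (hx : x ∈ radical K L) :
    (T.projK x : L) + (T.projM x : L) = x := by
  have h : x ∈ T.m ⊔ T.k.toSubmodule := by rw [T.sup_m_k]; exact hx
  obtain ⟨z, hz, y, hy, rfl⟩ := Submodule.mem_sup.1 h
  rw [map_add, map_add, T.projK_of_mem_m hz, T.projK_of_mem_k hy, T.projM_of_mem_m hz,
    T.projM_of_mem_k hy, zero_add, add_zero, add_comm]

omit [CharZero K] [FiniteDimensional K L] in
theorem projK_add {y z : L} (hy : y ∈ T.k) (hz : z ∈ T.m) : T.projK (y + z) = ⟨y, hy⟩ := by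
  rw [map_add, T.projK_of_mem_k hy, T.projK_of_mem_m hz, add_zero]

omit [CharZero K] [FiniteDimensional K L] in
theorem projM_add {y z : L} (hy : y ∈ T.k) (hz : z ∈ T.m) : T.projM (y + z) = ⟨z, hz⟩ := by
  rw [map_add, T.projM_of_mem_k hy, T.projM_of_mem_m hz, zero_add]

omit [CharZero K] [FiniteDimensional K L] in
theorem exists_decomposition (w : L) :
    ∃ x : T.s, ∃ y : T.k, ∃ z : T.m, w = (x : L) + (y : L) + (z : L) := by
  have h : w ∈ T.s.toSubmodule ⊔ (radical K L).toSubmodule :=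
    T.isCompl_s.sup_eq_top ▸ Submodule.mem_top
  rw [← T.sup_m_k] at h
  obtain ⟨x, hx, r, hr, rfl⟩ := Submodule.mem_sup.1 h
  obtain ⟨z, hz, y, hy, rfl⟩ := Submodule.mem_sup.1 hr
  exact ⟨⟨x, hx⟩, ⟨y, hy⟩, ⟨z, hz⟩, by simp only; abel⟩

omit [CharZero K] [FiniteDimensional K L] in
theorem lie_k_s {x y : L} (hx : x ∈ T.s) (hy : y ∈ T.k) : ⁅y, x⁆ = 0 := by
  rw [← lie_skew, T.lie_s_k x hx y hy, neg_zero]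

omit [CharZero K] [FiniteDimensional K L] in
/-- `s` and `k` commute, hence so do their actions. -/
theorem lie_k_lie_s {x y : L} (hx : x ∈ T.s) (hy : y ∈ T.k) (z : L) : ⁅y, ⁅x, z⁆⁆ = ⁅x, ⁅y, z⁆⁆ := by
  rw [leibniz_lie, T.lie_k_s hx hy, zero_lie, zero_add]

/-- `m` contains no nonzero `s`-invariant vector of generalized weight zero for `k`. -/
theorem eq_zero_of_lie_eq_zero_of_weight_zero (z : T.m) (hs : ∀ x ∈ T.s, ⁅x, (z : L)⁆ = 0)
    (hk : ∀ y, ∃ n : ℕ, (T.mu y ^ n) z = 0) : z = 0 := by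
  have _ := T.semisimple_s
  have _ := T.nilpotent_k
  obtain ⟨h1, h2⟩ := exists_add_of_stable (s := T.s) (V := T.m) fun x hx z hz => T.lie_s_mem hx hz
  set Y := Submodule.span K {w : L | ∃ x ∈ T.s, ∃ z ∈ T.m, ⁅x, z⁆ = w} with hY
  let U : Submodule K T.m :=
    { carrier := {z | ∀ x ∈ T.s, ⁅x, (z : L)⁆ = 0}
      zero_mem' := fun x _ => lie_zero x
      add_mem' := fun {a b} ha hb x hx => by
        rw [Submodule.coe_add, lie_add, ha x hx, hb x hx, add_zero]
      smul_mem' := fun c a ha x hx => by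
        rw [Submodule.coe_smul, lie_smul, ha x hx, smul_zero] }
  let kU := Submodule.span K {w | ∃ y, ∃ u ∈ U, T.mu y u = w}
  have hkU : kU ≤ U := by
    refine Submodule.span_le.2 ?_
    rintro _ ⟨y, u, hu, rfl⟩ x hx
    change ⁅x, ⁅(y : L), (u : L)⁆⁆ = 0
    rw [← T.lie_k_lie_s hx y.2, hu x hx, lie_zero]
  have hYk : ∀ y ∈ T.k, ∀ w ∈ Y, ⁅y, w⁆ ∈ Y := by
    intro y hy w hw
    induction hw using Submodule.span_induction with
    | mem w hw =>
      obtain ⟨x, hx, z, hz, rfl⟩ := hw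
      rw [T.lie_k_lie_s hx hy]
      exact Submodule.subset_span ⟨x, hx, _, T.lie_k_mem hy hz, rfl⟩
    | zero => rw [lie_zero]; exact zero_mem _
    | add a b _ _ ha hb => rw [lie_add]; exact add_mem ha hb
    | smul c a _ ha => rw [lie_smul]; exact Y.smul_mem c ha
  -- From `m = [s + k, m]` and `m = [s, m] ⊕ mˢ` one gets `m = [s, m] + [k, mˢ]`. Comparing
  -- invariants, `mˢ = [k, mˢ]`, so `mˢ` lies in the positive Fitting component.
  have hm : T.m ≤ Y ⊔ kU.map T.m.subtype := by
    conv_lhs => rw [← T.span_lie]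
    refine Submodule.span_le.2 ?_
    rintro _ ⟨x, hx, z, hz, rfl⟩
    obtain ⟨a, ha, y, hy, rfl⟩ := Submodule.mem_sup.1 hx
    obtain ⟨c, hc, hcs, hzc⟩ := h1 z hz
    have : ⁅a + y, z⁆ = (⁅a, z⁆ + ⁅y, z - c⁆) + ⁅y, c⁆ := by rw [add_lie, lie_sub]; abel
    rw [this]
    refine add_mem (Submodule.mem_sup_left (add_mem (Submodule.subset_span ⟨a, ha, z, hz, rfl⟩)
      (hYk y hy _ hzc))) (Submodule.mem_sup_right ?_)
    exact ⟨T.mu ⟨y, hy⟩ ⟨c, hc⟩,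
      Submodule.subset_span ⟨⟨y, hy⟩, (⟨c, hc⟩ : T.m), hcs, rfl⟩, rfl⟩
  have hU : U ≤ kU := by
    intro u hu
    obtain ⟨a, ha, _, ⟨b, hb, rfl⟩, hab⟩ := Submodule.mem_sup.1 (hm u.2)
    have ha' : a = ((u - b : T.m) : L) := eq_sub_of_add_eq hab
    have ha0 : a = 0 := h2 a ha fun x hx => by
      rw [ha']
      exact (sub_mem hu (hkU hb) : u - b ∈ U) x hx
    rw [ha0, zero_add] at hab
    have : b = u := Subtype.ext hab
    exact this ▸ hb
  obtain ⟨P, -, hP2, -, hP4⟩ := exists_fitting T.mu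
  exact hP2 z (hP4 U hU hs) hk

omit [CharZero K] [FiniteDimensional K L] in
-- A nonzero ideal `ker μ` of the nilpotent algebra `k` would contain a nonzero vector centralized
-- by `k`; being centralized by `s` and `m` as well, it would be central in `L`.
theorem mu_injective (hc : center K L = ⊥) : Function.Injective T.mu := by
  have _ := T.nilpotent_k
  rw [← LieHom.ker_eq_bot]
  by_contra hne
  have _ : Nontrivial T.mu.ker := (LieSubmodule.nontrivial_iff_ne_bot K T.k T.k).2 hne
  have _ : LieModule.IsNilpotent T.k T.mu.ker :=
    Function.Injective.lieModuleIsNilpotent (f := (LieHom.id : T.k →ₗ⁅K⁆ T.k))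
      (g := T.mu.ker.toSubmodule.subtype) (L := T.k) (M := T.mu.ker) (M₂ := T.k)
      (fun _ _ => rfl) Subtype.val_injective
  have := nontrivial_max_triv_of_isNilpotent K T.k T.mu.ker
  obtain ⟨⟨⟨y, hy⟩, hmax⟩, hy0⟩ := exists_ne (0 : maxTrivSubmodule K T.k T.mu.ker)
  have hyk : ∀ x ∈ T.k, ⁅x, (y : L)⁆ = 0 := fun x hx => by
    have := (mem_maxTrivSubmodule K T.k T.mu.ker _).1 hmax ⟨x, hx⟩
    exact congrArg (fun t : T.mu.ker => ((t : T.k) : L)) this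
  have hym : ∀ z ∈ T.m, ⁅z, (y : L)⁆ = 0 := fun z hz => by
    have h : T.mu y = 0 := hy
    have h' : ⁅(y : L), z⁆ = 0 := congrArg Subtype.val (LinearMap.congr_fun h ⟨z, hz⟩)
    rw [← lie_skew, h', neg_zero]
  have hyc : (y : L) ∈ center K L := by
    rw [LieModule.mem_maxTrivSubmodule]
    intro w
    obtain ⟨a, b, z, rfl⟩ := T.exists_decomposition w
    rw [add_lie, add_lie, T.lie_s_k a a.2 y y.2, hyk b b.2, hym z z.2, add_zero, add_zero]
  rw [hc, LieSubmodule.mem_bot] at hyc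
  exact hy0 (Subtype.ext (Subtype.ext (Subtype.ext hyc)))

end GammaTriple

end DerTower

namespace DerTower

open LieAlgebra LieModule Module

/-! ### The algebra `Γ`, its invariants, and the action of `B` on the bracket of `m`. -/

namespace GammaTriple

variable {K : Type u} [Field K] {L : Type v} [LieRing L] [LieAlgebra K L] (T : GammaTriple K L)

theorem nHat_le_radical {x : L} (hx : x ∈ T.nHat) : x ∈ radical K L := by
  have : T.nHat ≤ (radical K L).toLieSubalgebra :=
    LieSubalgebra.lieSpan_le.2 fun z hz => T.m_le_radical hz
  exact this hx

/-- Derivations of `L` mapping `m` to `n̂` preserve `n̂`. -/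
theorem derivation_apply_mem_nHat (D : LieDerivation K L L) (hD : ∀ z ∈ T.m, D z ∈ T.nHat) {x : L}
    (hx : x ∈ T.nHat) : D x ∈ T.nHat := by
  have hx' : x ∈ LieSubalgebra.lieSpan K L (T.m : Set L) := hx
  have h : x ∈ T.nHat ∧ D x ∈ T.nHat := by
    induction hx' using LieSubalgebra.lieSpan_induction with
    | mem z hz => exact ⟨T.mem_nHat hz, hD z hz⟩
    | zero => exact ⟨zero_mem _, by rw [map_zero]; exact zero_mem _⟩
    | add a b ha hb iha ihb =>
      have ha' := iha ha
      have hb' := ihb hb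
      exact ⟨add_mem ha'.1 hb'.1, by rw [map_add]; exact add_mem ha'.2 hb'.2⟩
    | smul c a ha iha =>
      have ha' := iha ha
      exact ⟨T.nHat.smul_mem c ha'.1, by rw [map_smul]; exact T.nHat.smul_mem c ha'.2⟩
    | lie a b ha hb iha ihb =>
      have ha' := iha ha
      have hb' := ihb hb
      refine ⟨T.nHat.lie_mem ha'.1 hb'.1, ?_⟩
      rw [LieDerivation.apply_lie_eq_add]
      exact add_mem (T.nHat.lie_mem ha'.1 hb'.2) (T.nHat.lie_mem ha'.2 hb'.1)
  exact h.2

theorem lie_mem_nHat {x : L} (hx : x ∈ T.s.toSubmodule ⊔ T.k.toSubmodule) {y : L}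
    (hy : y ∈ T.nHat) : ⁅x, y⁆ ∈ T.nHat := by
  have := T.derivation_apply_mem_nHat (LieDerivation.ad K L x)
    (fun z hz => by simpa using T.mem_nHat (T.lie_mem_of_mem_sup hx hz)) hy
  simpa using this

theorem ad_mem_Gamma {x : L} (hx : x ∈ T.s) : LieAlgebra.ad K L x ∈ T.Gamma :=
  Submodule.mem_sup_left ⟨x, hx, rfl⟩

theorem semisimple_mem_Gamma {y : L} (hy : y ∈ T.k) {S N : Module.End K L} (hS : S.IsSemisimple)
    (hN : IsNilpotent N) (h : Commute S N) (he : LieAlgebra.ad K L y = S + N) : S ∈ T.Gamma :=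
  Submodule.mem_sup_right (Submodule.subset_span ⟨y, hy, N, hS, hN, h, he⟩)

/-- An induction principle for `Γ`. -/
theorem Gamma_induction {p : Module.End K L → Prop} (hs : ∀ x ∈ T.s, p (LieAlgebra.ad K L x))
    (hk : ∀ y ∈ T.k, ∀ S N : Module.End K L, S.IsSemisimple → IsNilpotent N → Commute S N →
      LieAlgebra.ad K L y = S + N → p S)
    (h0 : p 0) (ha : ∀ γ γ', p γ → p γ' → p (γ + γ')) (hc : ∀ (c : K) γ, p γ → p (c • γ))
    {γ : Module.End K L} (hγ : γ ∈ T.Gamma) : p γ := by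
  obtain ⟨_, ⟨x, hx, rfl⟩, b, hb, rfl⟩ := Submodule.mem_sup.1 hγ
  refine ha _ _ (hs x hx) ?_
  clear hγ
  induction hb using Submodule.span_induction with
  | mem S h =>
    obtain ⟨y, hy, N, hS, hN, h, he⟩ := h
    exact hk y hy S N hS hN h he
  | zero => exact h0
  | add a b _ _ iha ihb => exact ha _ _ iha ihb
  | smul c a _ iha => exact hc _ _ iha

theorem coe_mu_pow (y : T.k) (z : T.m) (n : ℕ) :
    (((T.mu y ^ n) z : T.m) : L) = (LieAlgebra.ad K L (y : L) ^ n) (z : L) := by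
  induction n with
  | zero => rfl
  | succ n ih =>
    rw [pow_succ', pow_succ', Module.End.mul_apply, Module.End.mul_apply, ← ih]
    rfl

theorem exists_ad_pow_apply_eq_zero (y y' : T.k) :
    ∃ n : ℕ, (LieAlgebra.ad K L (y : L) ^ n) (y' : L) = 0 := by
  have _ := T.nilpotent_k
  obtain ⟨n, hn⟩ := LieModule.exists_forall_pow_toEnd_eq_zero K T.k T.k
  refine ⟨n, ?_⟩
  have h : ∀ j : ℕ, (LieAlgebra.ad K L (y : L) ^ j) (y' : L) = ((toEnd K T.k T.k y ^ j) y' : T.k) := by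
    intro j
    induction j with
    | zero => rfl
    | succ j ih =>
      rw [pow_succ', pow_succ', Module.End.mul_apply, Module.End.mul_apply, ih]
      rfl
  rw [h, hn y]
  rfl

/-- `s` commutes with `k`, and `ad y` is nilpotent on `k` for `y ∈ k`, so its semisimple part kills
`k`. -/
theorem Gamma_apply_k {γ : Module.End K L} (hγ : γ ∈ T.Gamma) {y : L} (hy : y ∈ T.k) : γ y = 0 := by
  refine T.Gamma_induction (p := fun γ => γ y = 0) (fun x hx => T.lie_s_k x hx y hy) ?_ rfl
    (fun γ γ' h h' => by rw [LinearMap.add_apply, h, h', add_zero])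
    (fun c γ h => by rw [LinearMap.smul_apply, h, smul_zero]) hγ
  intro y' hy' S N hS hN h he
  obtain ⟨n, hn⟩ := T.exists_ad_pow_apply_eq_zero ⟨y', hy'⟩ ⟨y, hy⟩
  rw [he] at hn
  exact semisimple_apply_eq_zero hS hN h hn

variable [FiniteDimensional K L] [CharZero K]

/-- The `m`-component of a Γ-invariant vector is `s`-invariant and of weight zero, hence zero. With
`Gamma_apply_k` this shows that `k` is the space of Γ-invariants of the radical, so derivations
commuting with `Γ` preserve `n̂ ∩ k`. -/
theorem mem_k_of_Gamma_apply_eq_zero {x : L} (hx : x ∈ radical K L)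
    (h : ∀ γ ∈ T.Gamma, γ x = 0) : x ∈ T.k := by
  have hz : ∀ γ ∈ T.Gamma, γ (T.projM x : L) = 0 := by
    intro γ hγ
    have h1 := h γ hγ
    rw [← T.projK_add_projM hx, map_add, T.Gamma_apply_k hγ (T.projK x).2, zero_add] at h1
    exact h1
  have h0 : T.projM x = 0 := by
    refine T.eq_zero_of_lie_eq_zero_of_weight_zero _ (fun x hx => hz _ (T.ad_mem_Gamma hx)) ?_
    intro y
    obtain ⟨S, N, hS, hN, hc, he⟩ := exists_jordan (LieAlgebra.ad K L (y : L))
    obtain ⟨n, hn⟩ := exists_pow_apply_eq_zero hN hc (hz S (T.semisimple_mem_Gamma y.2 hS hN hc he))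
    refine ⟨n, Subtype.ext ?_⟩
    rw [T.coe_mu_pow, he, hn]
    rfl
  have := T.projK_add_projM hx
  rw [h0, ZeroMemClass.coe_zero, add_zero] at this
  rw [← this]
  exact (T.projK x).2

variable {T} in
theorem CommutesWithGamma.apply_mem_k {D : LieDerivation K T.nHat T.nHat}
    (hD : T.CommutesWithGamma D) (x : T.nHat) (hx : (x : L) ∈ T.k) : ((D x : T.nHat) : L) ∈ T.k := by
  refine T.mem_k_of_Gamma_apply_eq_zero (T.nHat_le_radical (D x).2) fun γ hγ => ?_
  rw [← hD γ hγ x 0 (by rw [T.Gamma_apply_k hγ hx]; rfl), map_zero]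
  rfl

omit [FiniteDimensional K L] [CharZero K] in
theorem apply_lie_s_of_mem_B {f : Module.End K T.m} (hf : f ∈ T.B) (x : T.s) (z : T.m) :
    ((f ⟨⁅(x : L), (z : L)⁆, T.lie_s_mem x.2 z.2⟩ : T.m) : L) = ⁅(x : L), (f z : L)⁆ := by
  obtain ⟨D, hD, h⟩ := hf
  rw [h, h, hD _ (T.ad_mem_Gamma x.2) ⟨z, T.mem_nHat z.2⟩ _ rfl]
  rfl

/-- `f` commutes with the semisimple part of `μ(y)`, so only the nilpotent part contributes to
iterated brackets: `B` is of generalized weight zero for `k`. -/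
theorem exists_ad_mu_pow_eq_zero_of_mem_B {f : Module.End K T.m} (hf : f ∈ T.B) (y : T.k) :
    ∃ n : ℕ, (LieAlgebra.ad K (Module.End K T.m) (T.mu y) ^ n) f = 0 := by
  obtain ⟨D, hD, hDf⟩ := hf
  obtain ⟨S, N, hS, hN, hc, he⟩ := exists_jordan (LieAlgebra.ad K L (y : L))
  have hSm : ∀ z ∈ T.m, S z ∈ T.m := apply_mem_of_mem_adjoin
    (he ▸ semisimple_mem_adjoin hS hN hc) T.m fun z hz => T.lie_k_mem y.2 hz
  have hNm : ∀ z ∈ T.m, N z ∈ T.m := by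
    intro z hz
    have h1 : N z = ⁅(y : L), z⁆ - S z := by
      have := LinearMap.congr_fun he z
      rw [LieAlgebra.ad_apply, LinearMap.add_apply] at this
      rw [this]; abel
    rw [h1]
    exact sub_mem (T.lie_k_mem y.2 hz) (hSm z hz)
  have hmu : T.mu y = S.restrict hSm + N.restrict hNm := by
    ext z
    exact LinearMap.congr_fun he z
  have hN' : IsNilpotent (N.restrict hNm) := by
    obtain ⟨j, hj⟩ := hN
    refine ⟨j, ?_⟩
    rw [Module.End.pow_restrict]
    ext x
    simp [hj]
  have hSf : ⁅S.restrict hSm, f⁆ = 0 := by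
    ext z
    have h1 := hD S (T.semisimple_mem_Gamma y.2 hS hN hc he) ⟨z, T.mem_nHat z.2⟩
      ⟨S z, T.mem_nHat (hSm z z.2)⟩ rfl
    rw [← hDf] at h1
    have h2 := hDf ⟨S z, hSm z z.2⟩
    rw [← h2] at h1
    simp only [LieRing.of_associative_ring_bracket, LinearMap.sub_apply, Module.End.mul_apply,
      LinearMap.zero_apply, AddSubgroupClass.coe_sub, ZeroMemClass.coe_zero, sub_eq_zero]
    exact h1.symm
  have hcomm : Commute (S.restrict hSm) (N.restrict hNm) := by
    ext x
    exact LinearMap.congr_fun hc.eq x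
  have h := exists_pow_apply_eq_zero (S := LieAlgebra.ad K (Module.End K T.m) (S.restrict hSm))
    (LieAlgebra.ad_nilpotent_of_nilpotent (R := K) hN')
    (LieAlgebra.commute_ad_of_commute hcomm) hSf
  rwa [← map_add, ← hmu] at h

/-- Nilpotency of `k` gives `(ad y)ⁿ y' = 0`, hence a power of `ad (ad y)` kills `ad y'`. -/
theorem commute_semisimple_ad {y y' : T.k} {S N : Module.End K L} (hS : S.IsSemisimple)
    (hN : IsNilpotent N) (h : Commute S N) (he : LieAlgebra.ad K L (y : L) = S + N) :
    Commute S (LieAlgebra.ad K L (y' : L)) := by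
  obtain ⟨n, hn⟩ := T.exists_ad_pow_apply_eq_zero y y'
  refine commute_of_ad_pow_eq_zero hS hN h (n := n) ?_
  have : ∀ j : ℕ, (LieAlgebra.ad K (Module.End K L) (S + N) ^ j) (LieAlgebra.ad K L (y' : L)) =
      LieAlgebra.ad K L ((LieAlgebra.ad K L (y : L) ^ j) (y' : L)) := by
    intro j
    induction j with
    | zero => rfl
    | succ j ih =>
      rw [pow_succ', pow_succ', Module.End.mul_apply, Module.End.mul_apply, ih, ← he,
        LieAlgebra.ad_apply, LieAlgebra.ad_apply, LieHom.map_lie]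
  rw [this, hn, map_zero]

theorem commute_Gamma_ad_k {γ : Module.End K L} (hγ : γ ∈ T.Gamma) (y : T.k) :
    Commute γ (LieAlgebra.ad K L (y : L)) := by
  refine T.Gamma_induction (p := fun γ => Commute γ (LieAlgebra.ad K L (y : L))) ?_ ?_
    (Commute.zero_left _) (fun γ γ' h h' => h.add_left h') (fun c γ h => h.smul_left c) hγ
  · intro x hx
    refine LinearMap.ext fun z => ?_
    simp only [Module.End.mul_apply, LieAlgebra.ad_apply]
    exact (T.lie_k_lie_s hx y.2 z).symm
  · intro y' hy' S N hS hN h he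
    exact T.commute_semisimple_ad (y := ⟨y', hy'⟩) (y' := y) hS hN h he

theorem mu_mem_B (y : T.k) : T.mu y ∈ T.B := by
  have hy : (y : L) ∈ T.s.toSubmodule ⊔ T.k.toSubmodule := Submodule.mem_sup_right y.2
  let D : LieDerivation K T.nHat T.nHat :=
    { toFun := fun x => ⟨⁅(y : L), (x : L)⁆, T.lie_mem_nHat hy x.2⟩
      map_add' := fun a b => Subtype.ext (by simp)
      map_smul' := fun c a => Subtype.ext (by simp)
      leibniz' := fun a b => Subtype.ext (by
        change ⁅(y : L), ⁅(a : L), (b : L)⁆⁆ = ⁅(a : L), ⁅(y : L), (b : L)⁆⁆ -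
          ⁅(b : L), ⁅(y : L), (a : L)⁆⁆
        rw [leibniz_lie, ← lie_skew (b : L)]
        abel) }
  refine ⟨D, fun γ hγ a b hab => ?_, fun z => rfl⟩
  change ⁅(y : L), (b : L)⁆ = γ ⁅(y : L), (a : L)⁆
  rw [hab]
  exact (LinearMap.congr_fun (T.commute_Gamma_ad_k hγ y).eq (a : L)).symm

theorem range_mu_le_B : T.mu.range ≤ T.B := by
  rintro _ ⟨y, rfl⟩
  exact T.mu_mem_B y

/-- The representation of `s` on `m`. -/
def actS : T.s →ₗ⁅K⁆ Module.End K T.m where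
  toFun x :=
    { toFun := fun z => ⟨⁅(x : L), (z : L)⁆, T.lie_s_mem x.2 z.2⟩
      map_add' := fun a b => Subtype.ext (by simp)
      map_smul' := fun c a => Subtype.ext (by simp) }
  map_add' x y := by ext z; simp
  map_smul' c x := by ext z; simp
  map_lie' {x y} := by ext z; simp [LieRing.of_associative_ring_bracket]

/-- The `k`-component of the bracket of `m`, acting on `m`. -/
noncomputable def brK : T.m →ₗ[K] T.m →ₗ[K] Module.End K T.m :=
  LinearMap.mk₂ K (fun z w => T.mu (T.projK ⁅(z : L), (w : L)⁆))
    (fun a b c => by rw [Submodule.coe_add, add_lie, map_add]; exact map_add T.mu _ _)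
    (fun r a c => by rw [Submodule.coe_smul, smul_lie, map_smul]; exact map_smul T.mu _ _)
    (fun a b c => by rw [Submodule.coe_add, lie_add, map_add]; exact map_add T.mu _ _)
    (fun r a c => by rw [Submodule.coe_smul, lie_smul, map_smul]; exact map_smul T.mu _ _)

/-- The `m`-component of the bracket of `m`. -/
noncomputable def brM : T.m →ₗ[K] T.m →ₗ[K] T.m :=
  LinearMap.mk₂ K (fun z w => T.projM ⁅(z : L), (w : L)⁆)
    (fun a b c => by rw [Submodule.coe_add, add_lie, map_add])
    (fun r a c => by rw [Submodule.coe_smul, smul_lie, map_smul])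
    (fun a b c => by rw [Submodule.coe_add, lie_add, map_add])
    (fun r a c => by rw [Submodule.coe_smul, lie_smul, map_smul])

theorem brK_mem_B (z w : T.m) : T.brK z w ∈ T.B := T.mu_mem_B _

omit [FiniteDimensional K L] [CharZero K] in
theorem brK_apply (z w : T.m) : T.brK z w = T.mu (T.projK ⁅(z : L), (w : L)⁆) := rfl

omit [FiniteDimensional K L] [CharZero K] in
theorem brM_apply (z w : T.m) : T.brM z w = T.projM ⁅(z : L), (w : L)⁆ := rfl

omit [FiniteDimensional K L] [CharZero K] in
theorem brK_skew (z w : T.m) : T.brK z w = - T.brK w z := by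
  rw [brK_apply, brK_apply, ← lie_skew, map_neg]
  exact map_neg T.mu _

omit [FiniteDimensional K L] [CharZero K] in
theorem brM_skew (z w : T.m) : T.brM z w = - T.brM w z := by
  rw [brM_apply, brM_apply, ← lie_skew, map_neg]

/-- A derivation `D` inducing `f` preserves `n̂ ∩ k` and `m`, so applying it to `[z, w] = κ + e` can
be read off in each component. The `k`-part uses that `D κ` acts on `m` as `[f, μ(κ)]`. -/
theorem lie_brK_and_apply_brM_of_mem_B {f : Module.End K T.m} (hf : f ∈ T.B) (z w : T.m) :
    ⁅f, T.brK z w⁆ = T.brK (f z) w + T.brK z (f w) ∧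
      f (T.brM z w) = T.brM (f z) w + T.brM z (f w) := by
  obtain ⟨D, hD, hDf⟩ := hf
  have hzr : ⁅(z : L), (w : L)⁆ ∈ radical K L := T.lie_m_mem_radical w.2 _
  set κ := T.projK ⁅(z : L), (w : L)⁆ with hκ
  set e := T.projM ⁅(z : L), (w : L)⁆ with he
  have hsum : (κ : L) + (e : L) = ⁅(z : L), (w : L)⁆ := T.projK_add_projM hzr
  have hen : (e : L) ∈ T.nHat := T.mem_nHat e.2
  have hzwn : ⁅(z : L), (w : L)⁆ ∈ T.nHat := T.nHat.lie_mem (T.mem_nHat z.2) (T.mem_nHat w.2)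
  have hκn : (κ : L) ∈ T.nHat := by
    rw [eq_sub_of_add_eq hsum]
    exact sub_mem hzwn hen
  have hDκ := hD.apply_mem_k ⟨κ, hκn⟩ κ.2
  set δ := ((D ⟨κ, hκn⟩ : T.nHat) : L) with hδ
  have hfb : ∀ z w : T.m, ((D ⟨⁅(z : L), (w : L)⁆, T.nHat.lie_mem (T.mem_nHat z.2)
      (T.mem_nHat w.2)⟩ : T.nHat) : L) = ⁅(f z : L), (w : L)⁆ + ⁅(z : L), (f w : L)⁆ := by
    intro z w
    have := D.apply_lie_eq_add (⟨z, T.mem_nHat z.2⟩ : T.nHat) ⟨w, T.mem_nHat w.2⟩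
    have h2 := congrArg (Subtype.val : T.nHat → L) this
    refine h2.trans ?_
    rw [hDf z, hDf w, add_comm]
    rfl
  have hmain : δ + (f e : L) = ⁅(f z : L), (w : L)⁆ + ⁅(z : L), (f w : L)⁆ := by
    rw [← hfb, hDf e, hδ, ← AddMemClass.coe_add, ← map_add]
    congr 2
    exact Subtype.ext hsum
  have hmu : ⁅f, T.mu κ⁆ = T.mu ⟨δ, hDκ⟩ := by
    ext v
    have h1 := D.apply_lie_eq_add (⟨κ, hκn⟩ : T.nHat) ⟨v, T.mem_nHat v.2⟩
    have h2 := congrArg (Subtype.val : T.nHat → L) h1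
    have h3 := hDf (T.mu κ v)
    have h4 : ((D ⟨((T.mu κ v : T.m) : L), T.mem_nHat (T.mu κ v).2⟩ : T.nHat) : L) =
        ⁅(κ : L), (f v : L)⁆ + ⁅δ, (v : L)⁆ := by
      rw [hDf v]
      exact h2
    rw [h4] at h3
    change ((f (T.mu κ v) : T.m) : L) - ⁅(κ : L), (f v : L)⁆ = ⁅δ, (v : L)⁆
    rw [h3]
    abel
  constructor
  · rw [brK_apply, ← hκ, hmu, brK_apply, brK_apply]
    have : (⟨δ, hDκ⟩ : T.k) = T.projK (⁅(f z : L), (w : L)⁆ + ⁅(z : L), (f w : L)⁆) := by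
      rw [← hmain]
      exact (T.projK_add hDκ (f e).2).symm
    rw [this, map_add]
    exact map_add T.mu _ _
  · rw [brM_apply, brM_apply, brM_apply, ← he, ← map_add, ← hmain]
    exact (T.projM_add hDκ (f e).2).symm

omit [FiniteDimensional K L] [CharZero K] in
theorem brK_actS_and_actS_brM (x : T.s) (z w : T.m) :
    T.brK (T.actS x z) w + T.brK z (T.actS x w) = 0 ∧
      T.actS x (T.brM z w) = T.brM (T.actS x z) w + T.brM z (T.actS x w) := by
  have hzr : ⁅(z : L), (w : L)⁆ ∈ radical K L := T.lie_m_mem_radical w.2 _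
  have hsum := T.projK_add_projM hzr
  have h1 : ⁅⁅(x : L), (z : L)⁆, (w : L)⁆ + ⁅(z : L), ⁅(x : L), (w : L)⁆⁆ =
      ((T.actS x (T.projM ⁅(z : L), (w : L)⁆) : T.m) : L) := by
    rw [← leibniz_lie]
    change _ = ⁅(x : L), (T.projM ⁅(z : L), (w : L)⁆ : L)⁆
    conv_lhs => rw [← hsum]
    rw [lie_add, T.lie_s_k x x.2 _ (T.projK _).2, zero_add]
  constructor
  · have h2 : T.projK ⁅⁅(x : L), (z : L)⁆, (w : L)⁆ + T.projK ⁅(z : L), ⁅(x : L), (w : L)⁆⁆ = 0 := by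
      rw [← map_add, h1]
      exact T.projK_of_mem_m (T.actS x _).2
    have h3 := congrArg T.mu h2
    rw [show T.mu 0 = 0 from map_zero T.mu] at h3
    exact (map_add T.mu _ _).symm.trans h3
  · have h2 : T.projM ⁅⁅(x : L), (z : L)⁆, (w : L)⁆ + T.projM ⁅(z : L), ⁅(x : L), (w : L)⁆⁆ =
        T.actS x (T.projM ⁅(z : L), (w : L)⁆) := by
      rw [← map_add, h1]
      exact T.projM_of_mem_m (T.actS x _).2
    exact h2.symm

omit [FiniteDimensional K L] [CharZero K] in
-- The two components, in `k` and in `m`, of the Jacobi identity of `L` for three elements of `m`.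
theorem jacobi_m (z w v : T.m) :
    T.brK z (T.brM w v) + T.brK w (T.brM v z) + T.brK v (T.brM z w) = 0 ∧
    (T.brM z (T.brM w v) - T.brK w v z) + (T.brM w (T.brM v z) - T.brK v z w) +
      (T.brM v (T.brM z w) - T.brK z w v) = 0 := by
  have hdec : ∀ z w v : T.m, ⁅(z : L), ⁅(w : L), (v : L)⁆⁆ =
      - ((T.brK w v z : T.m) : L) + ⁅(z : L), (T.brM w v : L)⁆ := by
    intro z w v
    have hwr : ⁅(w : L), (v : L)⁆ ∈ radical K L := T.lie_m_mem_radical v.2 _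
    conv_lhs => rw [← T.projK_add_projM hwr]
    rw [lie_add, ← lie_skew]
    rfl
  have hj := lie_jacobi (z : L) (w : L) (v : L)
  rw [hdec, hdec, hdec] at hj
  have hmem : ∀ u : T.m, T.projK (u : L) = 0 := fun u => T.projK_of_mem_m u.2
  have hmemM : ∀ u : T.m, T.projM (u : L) = u := fun u => T.projM_of_mem_m u.2
  constructor
  · have h1 := congrArg T.projK hj
    simp only [map_add, map_neg, hmem, neg_zero, zero_add, map_zero] at h1
    have h2 := congrArg T.mu h1
    rw [show T.mu 0 = 0 from map_zero T.mu] at h2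
    rw [← h2]
    exact ((map_add T.mu _ _).trans (congrArg (· + _) (map_add T.mu _ _))).symm
  · have h1 := congrArg T.projM hj
    simp only [map_add, map_neg, hmemM, map_zero] at h1
    simp only [brM_apply] at h1 ⊢
    rw [← h1]
    abel

end GammaTriple

end DerTower

namespace DerTower

open LieAlgebra LieModule Module

/-! ### The Lie algebra `s ⊕ B ⊕ m`. -/

namespace GammaTriple

variable {K : Type u} [Field K] {L : Type v} [LieRing L] [LieAlgebra K L] (T : GammaTriple K L)

/-- The space `s ⊕ B ⊕ m`, which carries the bracket `Phi`. -/
def Ambient : Type v := T.s × T.B × T.m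

namespace Ambient

noncomputable instance : AddCommGroup T.Ambient := inferInstanceAs (AddCommGroup (T.s × T.B × T.m))

noncomputable instance : Module K T.Ambient := inferInstanceAs (Module K (T.s × T.B × T.m))

instance [FiniteDimensional K L] : FiniteDimensional K T.Ambient :=
  inferInstanceAs (FiniteDimensional K (T.s × T.B × T.m))

variable {T}

/-- The components of an element of `s ⊕ B ⊕ m`. -/
def toProd : T.Ambient →ₗ[K] T.s × Module.End K T.m × T.m :=
  LinearMap.prodMap LinearMap.id (LinearMap.prodMap T.B.toSubmodule.subtype LinearMap.id)

theorem toProd_injective : Function.Injective (toProd (T := T)) := by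
  intro a b h
  exact Prod.ext (congrArg (·.1) h)
    (Prod.ext (Subtype.ext (congrArg (·.2.1) h)) (congrArg (·.2.2) h))

theorem toProd_mem (t : T.Ambient) : (toProd t).2.1 ∈ T.B := t.2.1.2

@[ext] theorem ext {a b : T.Ambient} (h1 : (toProd a).1 = (toProd b).1)
    (h2 : (toProd a).2.1 = (toProd b).2.1) (h3 : (toProd a).2.2 = (toProd b).2.2) : a = b :=
  toProd_injective (Prod.ext h1 (Prod.ext h2 h3))

/-- The element with the given components. -/
def mk (x : T.s) (f : Module.End K T.m) (hf : f ∈ T.B) (z : T.m) : T.Ambient := (x, ⟨f, hf⟩, z)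

@[simp] theorem toProd_mk (x : T.s) (f : Module.End K T.m) (hf : f ∈ T.B) (z : T.m) :
    toProd (mk x f hf z) = (x, f, z) := rfl

variable [FiniteDimensional K L] [CharZero K]

noncomputable instance : Bracket T.Ambient T.Ambient where
  bracket a b := (⁅a.1, b.1⁆, ⟨⁅(a.2.1 : Module.End K T.m), (b.2.1 : Module.End K T.m)⁆ +
      T.brK a.2.2 b.2.2, add_mem (T.B.lie_mem a.2.1.2 b.2.1.2) (T.brK_mem_B _ _)⟩,
    T.actS a.1 b.2.2 - T.actS b.1 a.2.2 + (a.2.1 : Module.End K T.m) b.2.2 -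
      (b.2.1 : Module.End K T.m) a.2.2 + T.brM a.2.2 b.2.2)

theorem toProd_lie (a b : T.Ambient) : toProd ⁅a, b⁆ = T.Phi (toProd a) (toProd b) := rfl

theorem toProd_lie_fst (a b : T.Ambient) : (toProd ⁅a, b⁆).1 = ⁅(toProd a).1, (toProd b).1⁆ := rfl

theorem toProd_lie_snd_fst (a b : T.Ambient) : (toProd ⁅a, b⁆).2.1 =
    ⁅(toProd a).2.1, (toProd b).2.1⁆ + T.brK (toProd a).2.2 (toProd b).2.2 := rfl

theorem toProd_lie_snd_snd (a b : T.Ambient) : (toProd ⁅a, b⁆).2.2 =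
    T.actS (toProd a).1 (toProd b).2.2 - T.actS (toProd b).1 (toProd a).2.2 +
      (toProd a).2.1 (toProd b).2.2 - (toProd b).2.1 (toProd a).2.2 +
      T.brM (toProd a).2.2 (toProd b).2.2 := rfl

/-- The `B`-component of the Jacobi identity. It combines compatibility of `B` with `brK`, the
`s`-invariance of `brK`, and `jacobi_m`; this and the next identity are where membership in `B`
matters. -/
theorem leibniz_snd_fst (x₁ x₂ x₃ : T.s) {f₁ f₂ f₃ : Module.End K T.m} (h₁ : f₁ ∈ T.B)
    (h₂ : f₂ ∈ T.B) (h₃ : f₃ ∈ T.B) (z₁ z₂ z₃ : T.m) :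
    ⁅f₁, ⁅f₂, f₃⁆ + T.brK z₂ z₃⁆ +
      T.brK z₁ (T.actS x₂ z₃ - T.actS x₃ z₂ + f₂ z₃ - f₃ z₂ + T.brM z₂ z₃) =
    ⁅⁅f₁, f₂⁆ + T.brK z₁ z₂, f₃⁆ +
      T.brK (T.actS x₁ z₂ - T.actS x₂ z₁ + f₁ z₂ - f₂ z₁ + T.brM z₁ z₂) z₃ +
    (⁅f₂, ⁅f₁, f₃⁆ + T.brK z₁ z₃⁆ +
      T.brK z₂ (T.actS x₁ z₃ - T.actS x₃ z₁ + f₁ z₃ - f₃ z₁ + T.brM z₁ z₃)) := by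
  have e1 := (T.lie_brK_and_apply_brM_of_mem_B h₁ z₂ z₃).1
  have e2 := (T.lie_brK_and_apply_brM_of_mem_B h₂ z₁ z₃).1
  have e3 := (T.lie_brK_and_apply_brM_of_mem_B h₃ z₁ z₂).1
  have s1 := eq_neg_of_add_eq_zero_left (T.brK_actS_and_actS_brM x₁ z₂ z₃).1
  have s2 := eq_neg_of_add_eq_zero_right (T.brK_actS_and_actS_brM x₂ z₁ z₃).1
  have s3 := eq_neg_of_add_eq_zero_right (T.brK_actS_and_actS_brM x₃ z₁ z₂).1
  have j := (T.jacobi_m z₁ z₂ z₃).1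
  rw [T.brM_skew z₃ z₁, T.brK_skew z₃, map_neg] at j
  have j' := eq_neg_of_add_eq_zero_left j
  rw [lie_add, lie_add, add_lie, e1, e2, ← lie_skew (T.brK z₁ z₂), e3]
  simp only [map_add, map_sub, LinearMap.add_apply, LinearMap.sub_apply]
  rw [s1, s2, s3, leibniz_lie f₁ f₂ f₃, T.brK_skew (T.actS x₃ z₁) z₂, T.brK_skew (f₃ z₁) z₂]
  rw [add_assoc, ← sub_eq_zero] at j
  rw [← sub_eq_zero]
  rw [← j]
  abel

theorem leibniz_snd_snd (x₁ x₂ x₃ : T.s) {f₁ f₂ f₃ : Module.End K T.m} (h₁ : f₁ ∈ T.B)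
    (h₂ : f₂ ∈ T.B) (h₃ : f₃ ∈ T.B) (z₁ z₂ z₃ : T.m) :
    T.actS x₁ (T.actS x₂ z₃ - T.actS x₃ z₂ + f₂ z₃ - f₃ z₂ + T.brM z₂ z₃) -
      T.actS ⁅x₂, x₃⁆ z₁ +
      f₁ (T.actS x₂ z₃ - T.actS x₃ z₂ + f₂ z₃ - f₃ z₂ + T.brM z₂ z₃) -
      (⁅f₂, f₃⁆ + T.brK z₂ z₃) z₁ +
      T.brM z₁ (T.actS x₂ z₃ - T.actS x₃ z₂ + f₂ z₃ - f₃ z₂ + T.brM z₂ z₃) =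
    T.actS ⁅x₁, x₂⁆ z₃ - T.actS x₃ (T.actS x₁ z₂ - T.actS x₂ z₁ + f₁ z₂ - f₂ z₁ + T.brM z₁ z₂) +
      (⁅f₁, f₂⁆ + T.brK z₁ z₂) z₃ -
      f₃ (T.actS x₁ z₂ - T.actS x₂ z₁ + f₁ z₂ - f₂ z₁ + T.brM z₁ z₂) +
      T.brM (T.actS x₁ z₂ - T.actS x₂ z₁ + f₁ z₂ - f₂ z₁ + T.brM z₁ z₂) z₃ +
    (T.actS x₂ (T.actS x₁ z₃ - T.actS x₃ z₁ + f₁ z₃ - f₃ z₁ + T.brM z₁ z₃) -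
      T.actS ⁅x₁, x₃⁆ z₂ +
      f₂ (T.actS x₁ z₃ - T.actS x₃ z₁ + f₁ z₃ - f₃ z₁ + T.brM z₁ z₃) -
      (⁅f₁, f₃⁆ + T.brK z₁ z₃) z₂ +
      T.brM z₂ (T.actS x₁ z₃ - T.actS x₃ z₁ + f₁ z₃ - f₃ z₁ + T.brM z₁ z₃)) := by
  have e1 := (T.lie_brK_and_apply_brM_of_mem_B h₁ z₂ z₃).2
  have e2 := (T.lie_brK_and_apply_brM_of_mem_B h₂ z₁ z₃).2
  have e3 := (T.lie_brK_and_apply_brM_of_mem_B h₃ z₁ z₂).2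
  have s1 := (T.brK_actS_and_actS_brM x₁ z₂ z₃).2
  have s2 := (T.brK_actS_and_actS_brM x₂ z₁ z₃).2
  have s3 := (T.brK_actS_and_actS_brM x₃ z₁ z₂).2
  have c : ∀ {f : Module.End K T.m} (_ : f ∈ T.B) (x : T.s) (z : T.m),
      f (T.actS x z) = T.actS x (f z) := fun hf x z => Subtype.ext (T.apply_lie_s_of_mem_B hf x z)
  have j := (T.jacobi_m z₁ z₂ z₃).2
  rw [T.brM_skew z₃ z₁, T.brK_skew z₃, T.brM_skew z₃, map_neg] at j
  simp only [map_add, map_sub, LinearMap.add_apply, LinearMap.sub_apply, LieHom.map_lie,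
    LieRing.of_associative_ring_bracket, Module.End.mul_apply, LinearMap.neg_apply] at j ⊢
  rw [e1, e2, e3, s1, s2, s3]
  simp only [c h₁, c h₂, c h₃]
  rw [T.brM_skew (T.actS x₃ z₁) z₂, T.brM_skew (f₃ z₁) z₂]
  rw [← sub_eq_zero]
  rw [← j]
  abel

noncomputable instance : LieRing T.Ambient where
  add_lie a b c := by
    ext1 <;> simp only [toProd_lie_fst, toProd_lie_snd_fst, toProd_lie_snd_snd, map_add,
      Prod.fst_add, Prod.snd_add, add_lie, LinearMap.add_apply] <;> abel
  lie_add a b c := by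
    ext1 <;> simp only [toProd_lie_fst, toProd_lie_snd_fst, toProd_lie_snd_snd, map_add,
      Prod.fst_add, Prod.snd_add, lie_add, LinearMap.add_apply] <;> abel
  lie_self a := by
    have h1 : T.brK (toProd a).2.2 (toProd a).2.2 = 0 := by
      rw [T.brK_apply, lie_self, map_zero]; exact map_zero T.mu
    have h2 : T.brM (toProd a).2.2 (toProd a).2.2 = 0 := by
      rw [T.brM_apply, lie_self, map_zero]
    ext1
    · rw [toProd_lie_fst, lie_self, map_zero]; rfl
    · rw [toProd_lie_snd_fst, lie_self, h1, add_zero, map_zero]; rfl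
    · rw [toProd_lie_snd_snd, h2, map_zero, sub_self, zero_add, sub_self, zero_add]; rfl
  leibniz_lie a b c := by
    ext1
    · exact leibniz_lie (toProd a).1 (toProd b).1 (toProd c).1
    · exact leibniz_snd_fst _ _ _ (toProd_mem a) (toProd_mem b) (toProd_mem c) _ _ _
    · exact leibniz_snd_snd _ _ _ (toProd_mem a) (toProd_mem b) (toProd_mem c) _ _ _

noncomputable instance : LieAlgebra K T.Ambient where
  lie_smul c a b := by
    ext1
    · simp only [toProd_lie_fst, map_smul, Prod.smul_fst, lie_smul]
    · simp only [toProd_lie_snd_fst, map_smul, Prod.smul_fst, Prod.smul_snd, smul_add,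
        LieRing.of_associative_ring_bracket, mul_smul_comm, smul_mul_assoc, smul_sub]
    · simp only [toProd_lie_snd_snd, map_smul,
        Prod.smul_fst, Prod.smul_snd, LinearMap.smul_apply, smul_add, smul_sub]

end Ambient

end GammaTriple

end DerTower

namespace DerTower

open LieAlgebra LieModule Module

/-! ### Reduction of derivations to weight zero. -/

section Reduction

variable {K : Type u} [Field K] [CharZero K]
  {s : Type v} [LieRing s] [LieAlgebra K s] [FiniteDimensional K s] [HasTrivialRadical K s]
  {k : Type v} [LieRing k] [LieAlgebra K k] [LieRing.IsNilpotent k]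
  {A : Type v} [LieRing A] [LieAlgebra K A] [FiniteDimensional K A]

/-- If `s` is semisimple, `k` is nilpotent and `s` and `k` commute in `A`, then every derivation
of `A` is, up to an inner one, zero on `s` and of generalized weight zero for `k`. -/
theorem exists_derivation_of_weight_zero (iS : s →ₗ⁅K⁆ A) (iK : k →ₗ⁅K⁆ A)
    (hSK : ∀ x y, ⁅iS x, iK y⁆ = 0) (D : LieDerivation K A A) :
    ∃ (a : A) (D₀ : LieDerivation K A A), D = LieDerivation.ad K A a + D₀ ∧
      (∀ x, D₀ (iS x) = 0) ∧
      ∀ y, ∃ n : ℕ, (LieAlgebra.ad K (Module.End K A) (LieAlgebra.ad K A (iK y)) ^ n)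
        (D₀ : Module.End K A) = 0 := by
  obtain ⟨a₁, ha₁⟩ : ∃ a : A, ∀ x, D (iS x) = ⁅iS x, a⁆ := by
    let _ : LieRingModule s A := LieRingModule.compLieHom A iS
    let _ : LieModule K s A := LieModule.compLieHom A iS
    exact exists_eq_lie (q := s) (M := A)
      { toLinearMap := (D : A →ₗ[K] A) ∘ₗ (iS : s →ₗ[K] A)
        leibniz' := fun a b => by
          change D (iS ⁅a, b⁆) = ⁅iS a, D (iS b)⁆ - ⁅iS b, D (iS a)⁆
          rw [LieHom.map_lie, LieDerivation.apply_lie_eq_sub] }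
  let W : Submodule K (LieDerivation K A A) :=
    { carrier := {E | ∀ x, E (iS x) = 0}
      add_mem' := fun ha hb x => by rw [LieDerivation.add_apply, ha x, hb x, add_zero]
      zero_mem' := fun x => rfl
      smul_mem' := fun c a ha x => by rw [LieDerivation.smul_apply, ha x, smul_zero] }
  have hW : ∀ (y : k), ∀ E ∈ W, ⁅LieDerivation.ad K A (iK y), E⁆ ∈ W := by
    intro y E hE x
    rw [LieDerivation.commutator_apply, hE x, map_zero, LieDerivation.ad_apply_apply, ← lie_skew,
      hSK, neg_zero, map_zero, sub_zero]
  let ρ : k →ₗ⁅K⁆ Module.End K W :=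
    { toFun := fun y =>
        { toFun := fun E => ⟨⁅LieDerivation.ad K A (iK y), (E : LieDerivation K A A)⁆, hW y E E.2⟩
          map_add' := fun a b => Subtype.ext (by simp)
          map_smul' := fun c a => Subtype.ext (by simp) }
      map_add' := fun a b => LinearMap.ext fun E => Subtype.ext (by simp)
      map_smul' := fun c a => LinearMap.ext fun E => Subtype.ext (by simp)
      map_lie' := fun {a b} => LinearMap.ext fun E => Subtype.ext (by
        simp [LieRing.of_associative_ring_bracket]) }
  obtain ⟨P, hP1, -, hP2, -⟩ := exists_fitting ρ
  -- The positive Fitting component is spanned by brackets `[ad y, u] = -ad (u y)` with `y` from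
  -- `k`, so all of it is inner and can be removed from `D`.
  have hPad : P.map W.subtype ≤ LinearMap.range (LieDerivation.ad K A : A →ₗ[K] _) := by
    rw [hP2, Submodule.map_span_le]
    rintro _ ⟨y, u, -, rfl⟩
    refine ⟨- (u : LieDerivation K A A) (iK y), ?_⟩
    ext b
    change LieDerivation.ad K A (- (u : LieDerivation K A A) (iK y)) b =
      ⁅LieDerivation.ad K A (iK y), (u : LieDerivation K A A)⁆ b
    rw [LieDerivation.commutator_apply, LieDerivation.ad_apply_apply,
      LieDerivation.ad_apply_apply, LieDerivation.ad_apply_apply,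
      LieDerivation.apply_lie_eq_add, neg_lie]
    abel
  have hDW : D + LieDerivation.ad K A a₁ ∈ W := by
    intro x
    rw [LieDerivation.add_apply, ha₁, LieDerivation.ad_apply_apply, ← lie_skew, neg_add_cancel]
  obtain ⟨v₀, hv₀, hv₁⟩ := hP1 ⟨_, hDW⟩
  obtain ⟨a₂, ha₂⟩ := hPad (Submodule.mem_map_of_mem hv₁)
  refine ⟨a₂ - a₁, v₀, ?_, v₀.2, fun y => ?_⟩
  · have ha₂' : LieDerivation.ad K A a₂ = D + LieDerivation.ad K A a₁ - v₀ := ha₂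
    rw [map_sub, ha₂']
    abel
  · obtain ⟨n, hn⟩ := hv₀ y
    refine ⟨n, ?_⟩
    have h : ∀ j : ℕ, (LieAlgebra.ad K (Module.End K A) (LieAlgebra.ad K A (iK y)) ^ j)
        ((v₀ : LieDerivation K A A) : Module.End K A) =
        (((ρ y ^ j) v₀ : W) : LieDerivation K A A) := by
      intro j
      induction j with
      | zero => rfl
      | succ j ih =>
        rw [pow_succ', pow_succ', Module.End.mul_apply, Module.End.mul_apply, ih,
          LieAlgebra.ad_apply, ← LieDerivation.coe_ad_apply_eq_ad_apply,
          ← LieDerivation.commutator_coe_linear_map]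
        rfl
    rw [h, hn]
    rfl

end Reduction

end DerTower

namespace DerTower

open LieAlgebra LieModule Module

/-! ### The map from `L` to `s ⊕ B ⊕ m` and the subalgebras `s ⊕ N ⊕ m`. -/

namespace GammaTriple

variable {K : Type u} [Field K] {L : Type v} [LieRing L] [LieAlgebra K L] (T : GammaTriple K L)

/-- The projection of `L = s ⊕ r` onto `s`. -/
noncomputable def projS : L →ₗ[K] T.s.toSubmodule :=
  T.s.toSubmodule.projectionOnto _ T.isCompl_s

theorem projS_of_mem_s {x : L} (hx : x ∈ T.s) : T.projS x = ⟨x, hx⟩ :=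
  Submodule.projectionOnto_apply_of_mem_left _ hx

theorem projS_of_mem_radical {x : L} (hx : x ∈ radical K L) : T.projS x = 0 :=
  (Submodule.projectionOnto_apply_eq_zero_iff _).2 hx

theorem projK_of_mem_s {x : L} (hx : x ∈ T.s) : T.projK x = 0 :=
  (Submodule.projectionOnto_apply_eq_zero_iff _).2 (Submodule.mem_sup_right hx)

theorem projM_of_mem_s {x : L} (hx : x ∈ T.s) : T.projM x = 0 :=
  (Submodule.projectionOnto_apply_eq_zero_iff _).2 (Submodule.mem_sup_right hx)

variable [FiniteDimensional K L] [CharZero K]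

/-- The linear map `x + y + z ↦ (x, μ(y), z)`. -/
noncomputable def toAmbient : L →ₗ[K] T.Ambient where
  toFun w := Ambient.mk (T.projS w) (T.mu (T.projK w)) (T.mu_mem_B _) (T.projM w)
  map_add' a b := by
    ext1
    · simp
    · simp only [map_add, Ambient.toProd_mk, Prod.snd_add, Prod.fst_add]
    · simp
  map_smul' c a := by
    ext1
    · simp
    · simp only [map_smul, Ambient.toProd_mk, Prod.smul_snd, Prod.smul_fst, RingHom.id_apply]
    · simp

theorem toProd_toAmbient_add (x : T.s) (y : T.k) (z : T.m) :
    Ambient.toProd (T.toAmbient ((x : L) + (y : L) + (z : L))) = (x, T.mu y, z) := by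
  have e : ∀ w : L, Ambient.toProd (T.toAmbient w) =
      (T.projS w, T.mu (T.projK w), T.projM w) := fun _ => rfl
  rw [e]
  simp only [map_add, T.projS_of_mem_s x.2,
    T.projS_of_mem_radical (T.k_le_radical y.2), T.projS_of_mem_radical (T.m_le_radical z.2),
    T.projK_of_mem_s x.2, T.projK_of_mem_k y.2, T.projK_of_mem_m z.2,
    T.projM_of_mem_s x.2, T.projM_of_mem_k y.2, T.projM_of_mem_m z.2]
  simp

theorem toProd_toAmbient_s (x : T.s) : Ambient.toProd (T.toAmbient x) = (x, 0, 0) := by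
  have := T.toProd_toAmbient_add x 0 0
  rw [map_zero] at this
  simpa using this

theorem toProd_toAmbient_k (y : T.k) : Ambient.toProd (T.toAmbient y) = (0, T.mu y, 0) := by
  have := T.toProd_toAmbient_add 0 y 0
  simpa using this

theorem toProd_toAmbient_m (z : T.m) : Ambient.toProd (T.toAmbient z) = (0, 0, z) := by
  have := T.toProd_toAmbient_add 0 0 z
  rw [map_zero] at this
  simpa using this

theorem toAmbient_injective (h : Function.Injective T.mu) : Function.Injective T.toAmbient := by
  rw [injective_iff_map_eq_zero]
  intro w hw
  obtain ⟨x, y, z, rfl⟩ := T.exists_decomposition w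
  have := T.toProd_toAmbient_add x y z
  rw [hw, map_zero] at this
  have h1 : 0 = x := congrArg (·.1) this
  have h2 : 0 = T.mu y := congrArg (·.2.1) this
  have h3 : 0 = z := congrArg (·.2.2) this
  have h4 : 0 = y := h (by rw [map_zero, h2])
  rw [← h1, ← h3, ← h4]
  simp

theorem exists_toAmbient_eq {t : T.Ambient} (h : (Ambient.toProd t).2.1 ∈ T.mu.range) :
    ∃ w, T.toAmbient w = t := by
  obtain ⟨y, hy⟩ := h
  change T.mu y = _ at hy
  refine ⟨((Ambient.toProd t).1 : L) + (y : L) + ((Ambient.toProd t).2.2 : L),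
    Ambient.toProd_injective ?_⟩
  rw [toProd_toAmbient_add, hy]

theorem toAmbient_lie (a b : L) : T.toAmbient ⁅a, b⁆ = ⁅T.toAmbient a, T.toAmbient b⁆ := by
  apply Ambient.toProd_injective
  obtain ⟨x, y, z, rfl⟩ := T.exists_decomposition a
  obtain ⟨x', y', z', rfl⟩ := T.exists_decomposition b
  have hr : ⁅(z : L), (z' : L)⁆ ∈ radical K L := T.lie_m_mem_radical z'.2 _
  have e : ⁅(x : L) + (y : L) + (z : L), (x' : L) + (y' : L) + (z' : L)⁆ =
      ((⁅x, x'⁆ : T.s) : L) + ((⁅y, y'⁆ + T.projK ⁅(z : L), (z' : L)⁆ : T.k) : L) +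
      ((T.actS x z' - T.actS x' z + T.mu y z' - T.mu y' z + T.projM ⁅(z : L), (z' : L)⁆ : T.m) : L) := by
    have h1 := T.lie_s_k x x.2 y' y'.2
    have h2 := T.lie_k_s x'.2 y.2
    have h3 := T.projK_add_projM hr
    have e1 : ((T.actS x z' : T.m) : L) = ⁅(x : L), (z' : L)⁆ := rfl
    have e2 : ((T.actS x' z : T.m) : L) = ⁅(x' : L), (z : L)⁆ := rfl
    have e3 : ((T.mu y z' : T.m) : L) = ⁅(y : L), (z' : L)⁆ := rfl
    have e4 : ((T.mu y' z : T.m) : L) = ⁅(y' : L), (z : L)⁆ := rfl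
    rw [LieSubalgebra.coe_bracket]
    have e5 : ((⁅y, y'⁆ + T.projK ⁅(z : L), (z' : L)⁆ : T.k) : L) =
      ⁅(y : L), (y' : L)⁆ + (T.projK ⁅(z : L), (z' : L)⁆ : L) := rfl
    rw [e5]
    simp only [AddSubgroupClass.coe_sub, Submodule.coe_add, e1, e2, e3, e4, lie_add, add_lie,
      h1, h2]
    nth_rewrite 1 [← h3]
    rw [← lie_skew (z : L) (x' : L), ← lie_skew (z : L) (y' : L)]
    abel
  rw [e, toProd_toAmbient_add, Ambient.toProd_lie, toProd_toAmbient_add, toProd_toAmbient_add]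
  refine Prod.ext rfl (Prod.ext ?_ rfl)
  change T.mu _ = ⁅T.mu y, T.mu y'⁆ + T.mu _
  rw [map_add, LieHom.map_lie]

/-- The Lie subalgebra `s ⊕ N ⊕ m`. -/
def sub (N : LieSubalgebra K (Module.End K T.m)) (hN : T.mu.range ≤ N) :
    LieSubalgebra K T.Ambient where
  carrier := {t | (Ambient.toProd t).2.1 ∈ N}
  add_mem' ha hb := by
    change (Ambient.toProd (_ + _)).2.1 ∈ N
    rw [map_add]
    exact add_mem ha hb
  zero_mem' := by
    change (Ambient.toProd 0).2.1 ∈ N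
    rw [map_zero]
    exact zero_mem N
  smul_mem' c a ha := by
    change (Ambient.toProd (c • a)).2.1 ∈ N
    rw [map_smul]
    exact N.smul_mem c ha
  lie_mem' {a b} ha hb := add_mem (N.lie_mem ha hb) (hN ⟨_, rfl⟩)

theorem mem_sub {N : LieSubalgebra K (Module.End K T.m)} {hN : T.mu.range ≤ N} {t : T.Ambient} :
    t ∈ T.sub N hN ↔ (Ambient.toProd t).2.1 ∈ N := Iff.rfl

theorem toAmbient_mem_sub {N : LieSubalgebra K (Module.End K T.m)} (hN : T.mu.range ≤ N) (w : L) :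
    T.toAmbient w ∈ T.sub N hN := hN ⟨T.projK w, rfl⟩

/-- The Lie algebra homomorphism `x + y + z ↦ (x, μ(y), z)` to `s ⊕ N ⊕ m`. -/
noncomputable def toSub {N : LieSubalgebra K (Module.End K T.m)} (hN : T.mu.range ≤ N) :
    L →ₗ⁅K⁆ T.sub N hN where
  toFun w := ⟨T.toAmbient w, T.toAmbient_mem_sub hN w⟩
  map_add' a b := Subtype.ext (map_add T.toAmbient a b)
  map_smul' c a := Subtype.ext (map_smul T.toAmbient c a)
  map_lie' {a b} := Subtype.ext (T.toAmbient_lie a b)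

/-- An element of `s ⊕ B ⊕ m` whose bracket with `s ⊕ μ(k) ⊕ m` is zero is zero. -/
theorem eq_zero_of_lie_toAmbient_eq_zero {t : T.Ambient} (h : ∀ w, ⁅t, T.toAmbient w⁆ = 0) :
    t = 0 := by
  have _ := T.semisimple_s
  -- Bracketing with `s` and `k` shows that the `m`-component is `s`-invariant and killed by `k`.
  -- Then the `s`-component is central in `s`, and the remaining endomorphism vanishes on `m`.
  have hz : (Ambient.toProd t).2.2 = 0 := by
    refine T.eq_zero_of_lie_eq_zero_of_weight_zero _ (fun x hx => ?_) (fun y => ⟨1, ?_⟩)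
    · have h1 : (Ambient.toProd ⁅t, T.toAmbient x⁆).2.2 = 0 := by rw [h, map_zero]; rfl
      rw [Ambient.toProd_lie_snd_snd, T.toProd_toAmbient_s ⟨x, hx⟩] at h1
      simp only [map_zero, zero_sub, LinearMap.zero_apply, add_zero, sub_zero, neg_eq_zero] at h1
      exact congrArg Subtype.val h1
    · have h1 : (Ambient.toProd ⁅t, T.toAmbient y⁆).2.2 = 0 := by rw [h, map_zero]; rfl
      rw [Ambient.toProd_lie_snd_snd, T.toProd_toAmbient_k y] at h1
      simp only [map_zero, LinearMap.zero_apply, add_zero, sub_zero, zero_sub, neg_eq_zero] at h1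
      rw [pow_one]
      exact h1
  have hx : (Ambient.toProd t).1 = 0 := by
    have h0 : (Ambient.toProd t).1 ∈ center K T.s := by
      rw [LieModule.mem_maxTrivSubmodule]
      intro x
      have h1 : (Ambient.toProd ⁅t, T.toAmbient x⁆).1 = 0 := by rw [h, map_zero]; rfl
      rw [Ambient.toProd_lie_fst, T.toProd_toAmbient_s x] at h1
      rw [← lie_skew, h1, neg_zero]
    rwa [center_eq_bot, LieSubmodule.mem_bot] at h0
  have hf : (Ambient.toProd t).2.1 = 0 := by
    ext w
    have h1 : (Ambient.toProd ⁅t, T.toAmbient w⁆).2.2 = 0 := by rw [h, map_zero]; rfl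
    rw [Ambient.toProd_lie_snd_snd, T.toProd_toAmbient_m w, hz, hx] at h1
    simp only [map_zero, LinearMap.zero_apply, add_zero, sub_zero, zero_add] at h1
    rw [h1]; rfl
  ext1
  · rw [hx, map_zero]; rfl
  · rw [hf, map_zero]; rfl
  · rw [hz, map_zero]; rfl

end GammaTriple

end DerTower

/-! ### Derivations of `s ⊕ N ⊕ m`. -/

namespace DerTower

open LieAlgebra LieModule Module

theorem apply_eq_zero_of_mem_radical {K : Type u} [Field K] {A : Type v} [LieRing A]
    [LieAlgebra K A] [FiniteDimensional K A] {s : Type w} [LieRing s] [LieAlgebra K s]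
    [FiniteDimensional K s] [HasTrivialRadical K s] (f : A →ₗ⁅K⁆ s) (hf : Function.Surjective f)
    {a : A} (ha : a ∈ radical K A) : f a = 0 := by
  let I : LieIdeal K s :=
    { (radical K A).toSubmodule.map (f : A →ₗ[K] s) with
      lie_mem := fun {x m} hm => by
        obtain ⟨b, hb, rfl⟩ := hm
        obtain ⟨c, rfl⟩ := hf x
        exact ⟨⁅c, b⁆, (radical K A).lie_mem hb, LieHom.map_lie f c b⟩ }
  let g : radical K A →ₗ⁅K⁆ I :=
    { toFun := fun b => ⟨f b, b, b.2, rfl⟩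
      map_add' := fun b c => Subtype.ext (map_add f (b : A) c)
      map_smul' := fun r b => Subtype.ext (map_smul f r (b : A))
      map_lie' := fun {b c} => Subtype.ext (LieHom.map_lie f (b : A) c) }
  have hg : Function.Surjective g := by
    rintro ⟨_, b, hb, rfl⟩
    exact ⟨⟨b, hb⟩, rfl⟩
  have h1 : IsSolvable I := hg.lieAlgebra_isSolvable
  have h2 := (LieIdeal.solvable_iff_le_radical K s I).1 h1 (show f a ∈ I from ⟨a, ha, rfl⟩)
  rwa [radical_eq_bot, LieSubmodule.mem_bot] at h2

namespace GammaTriple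

variable {K : Type u} [Field K] {L : Type v} [LieRing L] [LieAlgebra K L] (T : GammaTriple K L)

/-- A restatement of `[s ⊕ k, m] = m`, used to verify properties of all `m` on brackets only. -/
theorem eq_top_of_actS_mem_of_mu_mem {Q : Submodule K T.m} (hs : ∀ x z, T.actS x z ∈ Q)
    (hk : ∀ y z, T.mu y z ∈ Q) : Q = ⊤ := by
  have h : T.m ≤ Q.map T.m.subtype := by
    conv_lhs => rw [← T.span_lie]
    rw [Submodule.span_le]
    rintro _ ⟨x, hx, z, hz, rfl⟩
    obtain ⟨x, hxs, y, hy, rfl⟩ := Submodule.mem_sup.1 hx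
    refine ⟨T.actS ⟨x, hxs⟩ ⟨z, hz⟩ + T.mu ⟨y, hy⟩ ⟨z, hz⟩, add_mem (hs _ _) (hk _ _), ?_⟩
    rw [add_lie]
    rfl
  rw [eq_top_iff]
  intro z _
  obtain ⟨z', hz', e⟩ := h z.2
  rwa [← Subtype.ext e]

variable [FiniteDimensional K L] [CharZero K] {N : LieSubalgebra K (Module.End K T.m)}
  {hN : T.mu.range ≤ N}

/-- The projection of `s ⊕ N ⊕ m` to `s`. -/
noncomputable def subToS (hN : T.mu.range ≤ N) : T.sub N hN →ₗ⁅K⁆ T.s where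
  toFun v := (Ambient.toProd v.1).1
  map_add' _ _ := rfl
  map_smul' _ _ := rfl
  map_lie' := rfl

theorem toSub_injective (h : Function.Injective T.mu) : Function.Injective (T.toSub hN) :=
  fun _ _ hab => T.toAmbient_injective h (congrArg Subtype.val hab)

theorem subToS_surjective : Function.Surjective (T.subToS hN) := fun x =>
  ⟨T.toSub hN x, congrArg Prod.fst (T.toProd_toAmbient_s x)⟩

theorem exists_apply_toSub_eq (D : LieDerivation K (T.sub N hN) (T.sub N hN))
    (hD : ∀ z : T.m, ∃ w ∈ T.nHat, D (T.toSub hN z) = T.toSub hN w) {w : L} (hw : w ∈ T.nHat) :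
    ∃ w' ∈ T.nHat, D (T.toSub hN w) = T.toSub hN w' := by
  have hw' : w ∈ LieSubalgebra.lieSpan K L (T.m : Set L) := hw
  induction hw' using LieSubalgebra.lieSpan_induction with
  | mem z hz => exact hD ⟨z, hz⟩
  | zero => exact ⟨0, zero_mem _, by simp⟩
  | add a b ha hb iha ihb =>
    obtain ⟨a', ha', ea⟩ := iha ha
    obtain ⟨b', hb', eb⟩ := ihb hb
    exact ⟨a' + b', add_mem ha' hb', by rw [map_add, map_add, ea, eb, map_add]⟩
  | smul c a ha iha =>
    obtain ⟨a', ha', ea⟩ := iha ha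
    exact ⟨c • a', T.nHat.smul_mem c ha', by rw [map_smul, map_smul, ea, map_smul]⟩
  | lie a b ha hb iha ihb =>
    obtain ⟨a', ha', ea⟩ := iha ha
    obtain ⟨b', hb', eb⟩ := ihb hb
    refine ⟨⁅a, b'⁆ + ⁅a', b⁆, add_mem (T.nHat.lie_mem ha hb') (T.nHat.lie_mem ha' hb), ?_⟩
    rw [LieHom.map_lie, LieDerivation.apply_lie_eq_add, ea, eb, map_add, LieHom.map_lie,
      LieHom.map_lie]

theorem lie_toSub_m (v : T.sub N hN) (z : T.m) :
    ⁅v, T.toSub hN z⁆ = T.toSub hN (⁅((Ambient.toProd v.1).1 : L), (z : L)⁆ +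
      ⁅((Ambient.toProd v.1).2.2 : L), (z : L)⁆ + ((Ambient.toProd v.1).2.1 z : T.m)) := by
  have h1 := T.toAmbient_lie ((Ambient.toProd v.1).1 : L) z
  have h2 := T.toAmbient_lie ((Ambient.toProd v.1).2.2 : L) z
  apply Subtype.ext
  change ⁅v.1, T.toAmbient z⁆ = T.toAmbient _
  rw [map_add, map_add, h1, h2]
  ext1 <;> simp only [map_add, Prod.fst_add, Prod.snd_add, Ambient.toProd_lie_fst,
    Ambient.toProd_lie_snd_fst, Ambient.toProd_lie_snd_snd, T.toProd_toAmbient_m,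
    T.toProd_toAmbient_s] <;> simp
  abel

/-- The image of `n̂` is an ideal, because by `lie_toSub_m` the whole algebra moves `m` into it; it
is solvable because `n̂` lies in the radical of `L`. -/
theorem toSub_mem_radical {w : L} (hw : w ∈ T.nHat) : T.toSub hN w ∈ radical K (T.sub N hN) := by
  let I : LieIdeal K (T.sub N hN) :=
    { T.nHat.toSubmodule.map (T.toSub hN : L →ₗ[K] T.sub N hN) with
      lie_mem := fun {v m} hm => by
        obtain ⟨b, hb, rfl⟩ := hm
        obtain ⟨w', hw', e⟩ := T.exists_apply_toSub_eq (LieDerivation.ad K _ v) (fun z => by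
          refine ⟨_, ?_, (LieDerivation.ad_apply_apply _ _ _ _).trans (T.lie_toSub_m v z)⟩
          exact add_mem (add_mem (T.mem_nHat (T.lie_s_mem (Subtype.prop _) z.2))
            (T.nHat.lie_mem (T.mem_nHat (Subtype.prop _)) (T.mem_nHat z.2)))
            (T.mem_nHat (Subtype.prop _))) hb
        exact ⟨w', hw', e.symm.trans (LieDerivation.ad_apply_apply _ _ _ _)⟩ }
  have h0 : IsSolvable T.nHat := by
    let i : T.nHat →ₗ⁅K⁆ radical K L :=
      { toFun := fun b => ⟨b, T.nHat_le_radical b.2⟩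
        map_add' := fun _ _ => rfl
        map_smul' := fun _ _ => rfl
        map_lie' := rfl }
    have hi : Function.Injective i := fun a b h => Subtype.ext (congrArg (fun c : radical K L => (c : L)) h)
    exact hi.lieAlgebra_isSolvable
  let g : T.nHat →ₗ⁅K⁆ I :=
    { toFun := fun b => ⟨T.toSub hN b, b, b.2, rfl⟩
      map_add' := fun b c => Subtype.ext (map_add (T.toSub hN) (b : L) c)
      map_smul' := fun r b => Subtype.ext (map_smul (T.toSub hN) r (b : L))
      map_lie' := fun {b c} => Subtype.ext (LieHom.map_lie (T.toSub hN) (b : L) c) }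
  have hg : Function.Surjective g := by
    rintro ⟨_, b, hb, rfl⟩
    exact ⟨⟨b, hb⟩, rfl⟩
  have h1 : IsSolvable I := hg.lieAlgebra_isSolvable
  exact (LieIdeal.solvable_iff_le_radical K _ I).1 h1 ⟨w, hw, rfl⟩

theorem toProd_lie_toSub_k (y : T.k) (v : T.sub N hN) :
    Ambient.toProd (⁅T.toSub hN y, v⁆ : T.sub N hN).1 =
      (0, ⁅T.mu y, (Ambient.toProd v.1).2.1⁆, T.mu y (Ambient.toProd v.1).2.2) := by
  change Ambient.toProd ⁅T.toAmbient y, v.1⁆ = _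
  refine Prod.ext ?_ (Prod.ext ?_ ?_) <;> simp only [Ambient.toProd_lie_fst,
    Ambient.toProd_lie_snd_fst, Ambient.toProd_lie_snd_snd, T.toProd_toAmbient_k] <;> simp

theorem toProd_lie_toSub_s (x : T.s) (v : T.sub N hN) :
    Ambient.toProd (⁅T.toSub hN x, v⁆ : T.sub N hN).1 =
      (⁅x, (Ambient.toProd v.1).1⁆, 0, T.actS x (Ambient.toProd v.1).2.2) := by
  change Ambient.toProd ⁅T.toAmbient x, v.1⁆ = _
  refine Prod.ext ?_ (Prod.ext ?_ ?_) <;> simp only [Ambient.toProd_lie_fst,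
    Ambient.toProd_lie_snd_fst, Ambient.toProd_lie_snd_snd, T.toProd_toAmbient_s] <;> simp

theorem toProd_ad_toSub_k_pow (y : T.k) (v : T.sub N hN) (n : ℕ) :
    ((Ambient.toProd v.1).1 = 0 →
      (Ambient.toProd ((LieAlgebra.ad K _ (T.toSub hN y) ^ n) v).1).1 = 0) ∧
    (Ambient.toProd ((LieAlgebra.ad K _ (T.toSub hN y) ^ n) v).1).2 =
      ((LieAlgebra.ad K _ (T.mu y) ^ n) (Ambient.toProd v.1).2.1,
        (T.mu y ^ n) (Ambient.toProd v.1).2.2) := by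
  induction n with
  | zero => exact ⟨id, rfl⟩
  | succ n ih =>
    simp only [pow_succ', Module.End.mul_apply, LieAlgebra.ad_apply, toProd_lie_toSub_k, ih.2]
    exact ⟨fun _ => trivial, trivial⟩

/-- The element `(0, g, 0)` of `s ⊕ N ⊕ m`. -/
noncomputable def subMk (hN : T.mu.range ≤ N) (hB : N ≤ T.B) (g : Module.End K T.m) (hg : g ∈ N) : T.sub N hN :=
  ⟨Ambient.mk 0 g (hB hg) 0, hg⟩

/-- A derivation of `s ⊕ N ⊕ m` which vanishes on `s` and is of weight zero preserves `N`. -/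
theorem apply_subMk_eq (hB : N ≤ T.B) {D : LieDerivation K (T.sub N hN) (T.sub N hN)}
    (hs : ∀ x : T.s, D (T.toSub hN x) = 0)
    (hk : ∀ y : T.k, ∃ n : ℕ, (LieAlgebra.ad K (Module.End K (T.sub N hN))
      (LieAlgebra.ad K (T.sub N hN) (T.toSub hN y)) ^ n) (D : Module.End K (T.sub N hN)) = 0)
    (g : Module.End K T.m) (hg : g ∈ N) :
    (Ambient.toProd (D (T.subMk hN hB g hg)).1).1 = 0 ∧
      (Ambient.toProd (D (T.subMk hN hB g hg)).1).2.2 = 0 := by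
  have _ := T.semisimple_s
  set v := T.subMk hN hB g hg with hv
  have hv0 : Ambient.toProd v.1 = (0, g, 0) := rfl
  have hsD : ∀ x : T.s, ⁅T.toSub hN x, D v⁆ = 0 := by
    intro x
    have h1 : ⁅T.toSub hN x, v⁆ = 0 := by
      apply Subtype.ext
      apply Ambient.toProd_injective
      rw [toProd_lie_toSub_s, hv0]
      simp
    have h2 := D.apply_lie_eq_add (T.toSub hN x) v
    rw [h1, hs, zero_lie, add_zero, map_zero] at h2
    exact h2.symm
  have hx : (Ambient.toProd (D v).1).1 = 0 := by
    have h0 : (Ambient.toProd (D v).1).1 ∈ center K T.s := by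
      rw [LieModule.mem_maxTrivSubmodule]
      intro x
      have h1 := T.toProd_lie_toSub_s x (D v)
      rw [hsD x] at h1
      exact (congrArg Prod.fst h1).symm
    rwa [center_eq_bot, LieSubmodule.mem_bot] at h0
  refine ⟨hx, T.eq_zero_of_lie_eq_zero_of_weight_zero _ (fun x hx => ?_) fun y => ?_⟩
  · have h1 := T.toProd_lie_toSub_s ⟨x, hx⟩ (D v)
    rw [hsD] at h1
    exact (congrArg (fun t => (t.2.2 : L)) h1).symm
  -- `g` has weight zero, so the semisimple part `S` of `ad y` kills it. `D` commutes with `S`,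
  -- hence `D g` is also of weight zero; its `m`-component is `s`-invariant and therefore zero.
  · obtain ⟨n, hn⟩ := T.exists_ad_mu_pow_eq_zero_of_mem_B (hB hg) y
    obtain ⟨S, R, hS, hR, hc, he⟩ := exists_jordan (LieAlgebra.ad K (T.sub N hN) (T.toSub hN y))
    have h1 : ((S + R) ^ n) v = 0 := by
      rw [← he]
      have h2 := T.toProd_ad_toSub_k_pow (hN := hN) y v n
      apply Subtype.ext
      apply Ambient.toProd_injective
      refine Prod.ext (h2.1 rfl) (h2.2.trans ?_)
      rw [hv0, hn, map_zero]
      rfl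
    have h2 := semisimple_apply_eq_zero hS hR hc h1
    obtain ⟨j, hj⟩ := hk y
    rw [he] at hj
    have h3 := commute_of_ad_pow_eq_zero hS hR hc hj
    have h4 : S (D v) = 0 := by
      have := LinearMap.congr_fun h3.eq v
      simp only [Module.End.mul_apply, h2, map_zero] at this
      exact this
    obtain ⟨i, hi⟩ := exists_pow_apply_eq_zero hR hc h4
    rw [← he] at hi
    refine ⟨i, ?_⟩
    have h5 := (T.toProd_ad_toSub_k_pow (hN := hN) y (D v) i).2
    rw [hi] at h5
    exact (congrArg Prod.snd h5).symm

end GammaTriple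

end DerTower

namespace DerTower

open LieAlgebra LieModule Module

namespace GammaTriple

variable {K : Type u} [Field K] {L : Type v} [LieRing L] [LieAlgebra K L] (T : GammaTriple K L)
  [FiniteDimensional K L] [CharZero K] {N : LieSubalgebra K (Module.End K T.m)}
  {hN : T.mu.range ≤ N}

/-- A derivation of `s ⊕ N ⊕ m` which vanishes on `s` and is of weight zero preserves `m`. -/
theorem apply_toSub_m_eq (hB : N ≤ T.B) {D : LieDerivation K (T.sub N hN) (T.sub N hN)}
    (hs : ∀ x : T.s, D (T.toSub hN x) = 0)
    (hk : ∀ y : T.k, ∃ n : ℕ, (LieAlgebra.ad K (Module.End K (T.sub N hN))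
      (LieAlgebra.ad K (T.sub N hN) (T.toSub hN y)) ^ n) (D : Module.End K (T.sub N hN)) = 0)
    (z : T.m) : (Ambient.toProd (D (T.toSub hN z)).1).1 = 0 ∧
      (Ambient.toProd (D (T.toSub hN z)).1).2.1 = 0 := by
  have _ := T.semisimple_s
  have _ := T.nilpotent_k
  -- `m` maps into the radical, `D` preserves the radical, and the radical projects to zero in `s`.
  refine ⟨apply_eq_zero_of_mem_radical (T.subToS hN) T.subToS_surjective
    (derivation_apply_mem_radical D (T.toSub_mem_radical (T.mem_nHat z.2))), ?_⟩
  -- `F` is the `N`-component of `D` on `m`. It kills `[s, m]` and intertwines the actions of `k`,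
  -- so its image `U` satisfies `U ≤ [k, U]`; since `U` lies in `B`, where `k` acts with weight
  -- zero, `U = 0`.
  let F : T.m →ₗ[K] Module.End K T.m := LinearMap.fst K _ _ ∘ₗ LinearMap.snd K _ _ ∘ₗ
    Ambient.toProd ∘ₗ (T.sub N hN).toSubmodule.subtype ∘ₗ (D : T.sub N hN →ₗ[K] T.sub N hN) ∘ₗ
    (T.toSub hN : L →ₗ[K] T.sub N hN) ∘ₗ T.m.subtype
  let ρ : T.k →ₗ⁅K⁆ Module.End K (Module.End K T.m) :=
    (LieAlgebra.ad K (Module.End K T.m)).comp T.mu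
  have hU : LinearMap.range F = ⊥ := by
    refine eq_bot_of_le_span_of_nilpotent ρ _ ?_ ?_
    · rw [LinearMap.range_eq_map, Submodule.map_le_iff_le_comap, top_le_iff]
      refine T.eq_top_of_actS_mem_of_mu_mem (fun x z => ?_) (fun y z => ?_)
      · have h1 : T.toSub hN (T.actS x z : L) = ⁅T.toSub hN x, T.toSub hN z⁆ :=
          LieHom.map_lie (T.toSub hN) (x : L) (z : L)
        have h2 : F (T.actS x z) = 0 := by
          change (Ambient.toProd (D (T.toSub hN (T.actS x z : L))).1).2.1 = 0
          rw [h1, D.apply_lie_eq_add, hs, zero_lie, add_zero, toProd_lie_toSub_s]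
        rw [Submodule.mem_comap, h2]
        exact zero_mem _
      · have h1 : T.toSub hN (T.mu y z : L) = ⁅T.toSub hN y, T.toSub hN z⁆ :=
          LieHom.map_lie (T.toSub hN) (y : L) (z : L)
        have hy : T.toSub hN y = T.subMk hN hB (T.mu y) (hN ⟨y, rfl⟩) :=
          Subtype.ext (Ambient.toProd_injective (T.toProd_toAmbient_k y))
        obtain ⟨hy1, hy2⟩ := T.apply_subMk_eq hB hs hk (T.mu y) (hN ⟨y, rfl⟩)
        rw [← hy] at hy1 hy2
        have h3 : (Ambient.toProd (⁅D (T.toSub hN y), T.toSub hN z⁆ : T.sub N hN).1).2.1 = 0 := by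
          change ⁅(Ambient.toProd (D (T.toSub hN y)).1).2.1, (Ambient.toProd (T.toAmbient z)).2.1⁆ +
            T.brK (Ambient.toProd (D (T.toSub hN y)).1).2.2 _ = 0
          rw [T.toProd_toAmbient_m, hy2, map_zero, lie_zero, LinearMap.zero_apply, add_zero]
        have h2 : F (T.mu y z) = ρ y (F z) := by
          change (Ambient.toProd (D (T.toSub hN (T.mu y z : L))).1).2.1 =
            ⁅T.mu y, (Ambient.toProd (D (T.toSub hN z)).1).2.1⁆
          rw [h1, D.apply_lie_eq_add, Submodule.coe_add, map_add, Prod.snd_add, Prod.fst_add, h3,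
            add_zero, toProd_lie_toSub_k]
        rw [Submodule.mem_comap, h2]
        exact Submodule.subset_span ⟨y, _, ⟨z, trivial, rfl⟩, rfl⟩
    · rintro _ ⟨z, rfl⟩ y
      exact T.exists_ad_mu_pow_eq_zero_of_mem_B (hB (D (T.toSub hN z)).2) y
  have : F z ∈ LinearMap.range F := ⟨z, rfl⟩
  rwa [hU, Submodule.mem_bot] at this

/-- Let `f` be the restriction to `m` of a derivation of `s ⊕ N ⊕ m` which vanishes on `s` and is
of weight zero. Then `f ∈ B`. -/
theorem mem_B_of_apply_toSub_eq (hmu : Function.Injective T.mu)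
    {D : LieDerivation K (T.sub N hN) (T.sub N hN)} (hs : ∀ x : T.s, D (T.toSub hN x) = 0)
    (hk : ∀ y : T.k, ∃ n : ℕ, (LieAlgebra.ad K (Module.End K (T.sub N hN))
      (LieAlgebra.ad K (T.sub N hN) (T.toSub hN y)) ^ n) (D : Module.End K (T.sub N hN)) = 0)
    {f : Module.End K T.m} (hf : ∀ z : T.m, D (T.toSub hN z) = T.toSub hN (f z)) : f ∈ T.B := by
  have hinj := T.toSub_injective (hN := hN) hmu
  have hex : ∀ w : T.nHat, ∃ w' : T.nHat, D (T.toSub hN w) = T.toSub hN w' := by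
    intro w
    obtain ⟨w', hw', e⟩ := T.exists_apply_toSub_eq D
      (fun z => ⟨f z, T.mem_nHat (f z).2, hf z⟩) w.2
    exact ⟨⟨w', hw'⟩, e⟩
  choose d hd using hex
  have hd' : ∀ {w w' : T.nHat}, T.toSub hN w = T.toSub hN w' → w = w' :=
    fun h => Subtype.ext (hinj h)
  let E : LieDerivation K T.nHat T.nHat :=
    { toFun := d
      map_add' := fun a b => hd' (by
        rw [← hd, Submodule.coe_add, Submodule.coe_add, map_add, map_add, map_add, hd, hd])
      map_smul' := fun c a => hd' (by
        rw [← hd, Submodule.coe_smul, RingHom.id_apply, Submodule.coe_smul, map_smul, map_smul,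
          map_smul, hd])
      leibniz' := fun a b => hd' (by
        change T.toSub hN (d ⁅a, b⁆) = T.toSub hN (⁅(a : L), (d b : L)⁆ - ⁅(b : L), (d a : L)⁆)
        rw [← hd, LieSubalgebra.coe_bracket, LieHom.map_lie, D.apply_lie_eq_sub, hd, hd, map_sub,
          LieHom.map_lie, LieHom.map_lie]) }
  have hE : ∀ w : T.nHat, T.toSub hN (E w) = D (T.toSub hN w) := fun w => (hd w).symm
  refine ⟨E, ?_, fun z => ?_⟩
  swap
  · refine hinj ?_
    rw [hE, ← hf]
  -- Stability of `n̂` under `γ` is included so that the statement passes to sums: the summands of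
  -- `γ x` must themselves lie in `n̂`.
  suffices h : ∀ γ ∈ T.Gamma, ∀ x : T.nHat, ∃ hx : γ (x : L) ∈ T.nHat,
      ((E ⟨γ x, hx⟩ : T.nHat) : L) = γ (E x : T.nHat) by
    intro γ hγ x y hxy
    obtain ⟨h1, h2⟩ := h γ hγ x
    rw [← h2]
    congr 2
    exact Subtype.ext hxy
  intro γ hγ
  refine T.Gamma_induction (p := fun γ => ∀ x : T.nHat, ∃ hx : γ (x : L) ∈ T.nHat,
      ((E ⟨γ x, hx⟩ : T.nHat) : L) = γ (E x : T.nHat)) ?_ ?_ ?_ ?_ ?_ hγ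
  · intro x hx w
    refine ⟨T.lie_mem_nHat (Submodule.mem_sup_left hx) w.2, hinj ?_⟩
    rw [hE]
    change D (T.toSub hN ⁅x, (w : L)⁆) = T.toSub hN ⁅x, (E w : L)⁆
    rw [LieHom.map_lie, LieHom.map_lie, D.apply_lie_eq_add, hs ⟨x, hx⟩, zero_lie, add_zero, hE]
  · intro y hy S R hS hR hc he
    have hyn : ∀ w ∈ T.nHat.toSubmodule, LieAlgebra.ad K L y w ∈ T.nHat.toSubmodule :=
      fun w hw => T.lie_mem_nHat (Submodule.mem_sup_right hy) hw
    have hSn : ∀ w ∈ T.nHat.toSubmodule, S w ∈ T.nHat.toSubmodule :=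
      apply_mem_of_mem_adjoin (he ▸ semisimple_mem_adjoin hS hR hc) _ hyn
    have hRn : ∀ w ∈ T.nHat.toSubmodule, R w ∈ T.nHat.toSubmodule := by
      intro w hw
      have h1 : R w = LieAlgebra.ad K L y w - S w := by rw [he, LinearMap.add_apply]; abel
      rw [h1]
      exact sub_mem (hyn w hw) (hSn w hw)
    have hX : (LieAlgebra.ad K L y).restrict hyn = S.restrict hSn + R.restrict hRn := by
      ext w
      exact LinearMap.congr_fun he w
    have hR' : IsNilpotent (R.restrict hRn) := by
      obtain ⟨j, hj⟩ := hR
      refine ⟨j, ?_⟩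
      rw [Module.End.pow_restrict]
      ext x
      simp [hj]
    have hc' : Commute (S.restrict hSn) (R.restrict hRn) := by
      ext x
      exact LinearMap.congr_fun hc.eq x
    have hS' : Module.End.IsSemisimple (S.restrict hSn) := hS.restrict (p := T.nHat.toSubmodule) hSn
    -- The weight-zero condition is transported from `D` to `E` through the embedding of `n̂`; it
    -- forces `E` to commute with the semisimple part of `ad y`.
    have hpow : ∀ (n : ℕ) (w : T.nHat.toSubmodule),
        T.toSub hN (((LieAlgebra.ad K (Module.End K T.nHat.toSubmodule)
          ((LieAlgebra.ad K L y).restrict hyn) ^ n)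
            (E : T.nHat →ₗ[K] T.nHat) : Module.End K T.nHat.toSubmodule) w) =
        ((LieAlgebra.ad K (Module.End K (T.sub N hN))
          (LieAlgebra.ad K (T.sub N hN) (T.toSub hN y)) ^ n) (D : Module.End K (T.sub N hN)))
          (T.toSub hN w) := by
      intro n
      induction n with
      | zero => exact hE
      | succ n ih =>
        intro w
        rw [pow_succ', pow_succ', Module.End.mul_apply, Module.End.mul_apply, LieAlgebra.ad_apply,
          LieAlgebra.ad_apply, LieRing.of_associative_ring_bracket,
          LieRing.of_associative_ring_bracket, LinearMap.sub_apply, LinearMap.sub_apply,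
          Module.End.mul_apply, Module.End.mul_apply, Module.End.mul_apply, Module.End.mul_apply,
          Submodule.coe_sub, map_sub, ih]
        have h1 : ∀ w : T.nHat.toSubmodule, T.toSub hN ((LieAlgebra.ad K L y).restrict hyn w) =
            LieAlgebra.ad K (T.sub N hN) (T.toSub hN y) (T.toSub hN w) :=
          fun w => LieHom.map_lie (T.toSub hN) y w
        rw [h1, h1, ih]
    obtain ⟨n, hn⟩ := hk ⟨y, hy⟩
    have h0 : (LieAlgebra.ad K (Module.End K T.nHat.toSubmodule)
        (S.restrict hSn + R.restrict hRn) ^ n) (E : T.nHat →ₗ[K] T.nHat) = 0 := by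
      rw [← hX]
      ext w
      refine hinj ?_
      rw [hpow, hn]
      exact (map_zero (T.toSub hN)).symm
    have h1 := commute_of_ad_pow_eq_zero hS' hR' hc' h0
    intro w
    refine ⟨hSn w w.2, ?_⟩
    exact congrArg Subtype.val (LinearMap.congr_fun h1.eq w).symm
  · intro x
    refine ⟨zero_mem _, ?_⟩
    have : E ⟨(0 : Module.End K L) x, zero_mem _⟩ = 0 := map_zero E
    rw [this]
    rfl
  · intro γ γ' h h' x
    obtain ⟨h1, h2⟩ := h x
    obtain ⟨h3, h4⟩ := h' x
    refine ⟨add_mem h1 h3, ?_⟩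
    change _ = γ _ + γ' _
    rw [← h2, ← h4, ← Submodule.coe_add, ← map_add]
    rfl
  · intro c γ h x
    obtain ⟨h1, h2⟩ := h x
    refine ⟨T.nHat.smul_mem c h1, ?_⟩
    change _ = c • γ _
    rw [← h2, ← Submodule.coe_smul, ← map_smul]
    rfl

/-- Every derivation of `s ⊕ N ⊕ m` is the bracket with an element of `s ⊕ N' ⊕ m`, where `N'` is
the normalizer of `N` in `B`. -/
theorem exists_eq_lie_of_sub (hmu : Function.Injective T.mu) (hB : N ≤ T.B)
    (D : LieDerivation K (T.sub N hN) (T.sub N hN)) :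
    ∃ t : T.Ambient, (Ambient.toProd t).2.1 ∈ N.normalizer ⊓ T.B ∧
      ∀ v : T.sub N hN, ((D v : T.sub N hN) : T.Ambient) = ⁅t, (v : T.Ambient)⁆ := by
  have _ := T.semisimple_s
  have _ := T.nilpotent_k
  let iS : T.s →ₗ⁅K⁆ T.sub N hN := (T.toSub hN).comp T.s.incl
  let iK : T.k →ₗ⁅K⁆ T.sub N hN := (T.toSub hN).comp T.k.incl
  obtain ⟨a, D₀, rfl, hs, hk⟩ := exists_derivation_of_weight_zero iS iK (fun x y => by
    change ⁅T.toSub hN x, T.toSub hN y⁆ = 0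
    rw [← LieHom.map_lie, T.lie_s_k x x.2 y y.2, map_zero]) D
  change ∀ x : T.s, D₀ (T.toSub hN x) = 0 at hs
  change ∀ y : T.k, ∃ n : ℕ, (LieAlgebra.ad K (Module.End K (T.sub N hN))
      (LieAlgebra.ad K (T.sub N hN) (T.toSub hN y)) ^ n) (D₀ : Module.End K (T.sub N hN)) = 0 at hk
  let f : Module.End K T.m := LinearMap.snd K _ _ ∘ₗ LinearMap.snd K _ _ ∘ₗ
    Ambient.toProd ∘ₗ (T.sub N hN).toSubmodule.subtype ∘ₗ (D₀ : T.sub N hN →ₗ[K] T.sub N hN) ∘ₗ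
    (T.toSub hN : L →ₗ[K] T.sub N hN) ∘ₗ T.m.subtype
  have hf : ∀ z : T.m, D₀ (T.toSub hN z) = T.toSub hN (f z) := by
    intro z
    obtain ⟨h1, h2⟩ := T.apply_toSub_m_eq hB hs hk z
    apply Subtype.ext
    apply Ambient.toProd_injective
    change _ = Ambient.toProd (T.toAmbient (f z : L))
    rw [T.toProd_toAmbient_m]
    exact Prod.ext h1 (Prod.ext h2 rfl)
  have hfB := T.mem_B_of_apply_toSub_eq hmu hs hk hf
  -- Apply `D₀` to `[g, z] = g(z)` for `z ∈ m`. As `D₀` maps `N` into `N`, this formula makes `f`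
  -- normalize `N`.
  have hfN : ∀ g (hg : g ∈ N), (Ambient.toProd (D₀ (T.subMk hN hB g hg)).1).2.1 = ⁅f, g⁆ := by
    intro g hg
    obtain ⟨h1, h2⟩ := T.apply_subMk_eq hB hs hk g hg
    ext z
    have h3 : ⁅T.subMk hN hB g hg, T.toSub hN z⁆ = T.toSub hN (g z) := by
      rw [T.lie_toSub_m]
      change T.toSub hN (⁅((0 : T.s) : L), (z : L)⁆ + ⁅((0 : T.m) : L), (z : L)⁆ + (g z : L)) = _
      simp
    have h4 := D₀.apply_lie_eq_add (T.subMk hN hB g hg) (T.toSub hN z)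
    rw [h3, hf, hf, T.lie_toSub_m, T.lie_toSub_m, h1, h2] at h4
    change T.toSub hN (f (g z) : L) = T.toSub hN (⁅((0 : T.s) : L), (f z : L)⁆ +
      ⁅((0 : T.m) : L), (f z : L)⁆ + (g (f z) : L)) + _ at h4
    rw [← map_add] at h4
    have h5 := T.toSub_injective hmu h4
    simp only [ZeroMemClass.coe_zero, zero_lie, zero_add] at h5
    rw [LieRing.of_associative_ring_bracket, LinearMap.sub_apply, Module.End.mul_apply,
      Module.End.mul_apply, AddSubgroupClass.coe_sub, h5]
    abel
  have hfn : f ∈ N.normalizer ⊓ T.B := by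
    refine ⟨(LieSubalgebra.mem_normalizer_iff' _ _).2 fun g hg => ?_, hfB⟩
    have := T.mem_sub.1 (D₀ (T.subMk hN hB g hg)).2
    rw [hfN] at this
    rw [← lie_skew]
    exact N.neg_mem_iff.2 this
  refine ⟨a.1 + Ambient.mk 0 f hfB 0, ?_, fun v => ?_⟩
  · rw [map_add]
    refine add_mem (S := LieSubalgebra K (Module.End K T.m)) ⟨N.le_normalizer a.2, hB a.2⟩ ?_
    exact hfn
  · rw [LieDerivation.add_apply, LieDerivation.ad_apply_apply, add_lie, Submodule.coe_add,
      LieSubalgebra.coe_bracket]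
    congr 1
    have hv : v = T.toSub hN (Ambient.toProd v.1).1 + T.subMk hN hB _ (T.mem_sub.1 v.2) +
        T.toSub hN (Ambient.toProd v.1).2.2 := by
      apply Subtype.ext
      apply Ambient.toProd_injective
      change _ = Ambient.toProd (T.toAmbient _ + Ambient.mk _ _ _ _ + T.toAmbient _)
      rw [map_add, map_add, T.toProd_toAmbient_s, T.toProd_toAmbient_m, Ambient.toProd_mk]
      simp
    obtain ⟨h1, h2⟩ := T.apply_subMk_eq hB hs hk _ (T.mem_sub.1 v.2)
    apply Ambient.toProd_injective
    conv_lhs => rw [hv, map_add, map_add, hs, hf, zero_add]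
    change Ambient.toProd ((D₀ _).1 + T.toAmbient _) = _
    rw [map_add, T.toProd_toAmbient_m]
    refine Prod.ext ?_ (Prod.ext ?_ ?_)
    · rw [Ambient.toProd_lie_fst, Prod.fst_add, h1, Ambient.toProd_mk]
      simp
    · rw [Ambient.toProd_lie_snd_fst, Prod.snd_add, Prod.fst_add, hfN, Ambient.toProd_mk]
      simp
    · rw [Ambient.toProd_lie_snd_snd, Prod.snd_add, Prod.snd_add, h2, Ambient.toProd_mk]
      simp

end GammaTriple

end DerTower

namespace DerTower

open LieAlgebra LieModule Module

/-! ### Transport of derivations and generalities on the tower. -/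

section Transport

variable {K : Type u} [Field K] {A : Type v} [LieRing A] [LieAlgebra K A]
  {A' : Type w} [LieRing A'] [LieAlgebra K A']

/-- Transport of derivations along an isomorphism. -/
def derivationCongrAux (e : A ≃ₗ⁅K⁆ A') (D : LieDerivation K A A) : LieDerivation K A' A' where
  toLinearMap := (e : A →ₗ[K] A') ∘ₗ (D : A →ₗ[K] A) ∘ₗ (e.symm : A' →ₗ[K] A)
  leibniz' a b := by
    change e (D (e.symm ⁅a, b⁆)) = ⁅a, e (D (e.symm b))⁆ - ⁅b, e (D (e.symm a))⁆
    rw [LieEquiv.map_lie, LieDerivation.apply_lie_eq_sub, map_sub, LieEquiv.map_lie,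
      LieEquiv.map_lie, e.apply_symm_apply, e.apply_symm_apply]

theorem derivationCongrAux_apply (e : A ≃ₗ⁅K⁆ A') (D : LieDerivation K A A) (a : A') :
    derivationCongrAux e D a = e (D (e.symm a)) := rfl

/-- Isomorphic Lie algebras have isomorphic algebras of derivations. -/
def derivationCongr (e : A ≃ₗ⁅K⁆ A') : LieDerivation K A A ≃ₗ⁅K⁆ LieDerivation K A' A' where
  toFun := derivationCongrAux e
  map_add' D D' := LieDerivation.ext fun a => map_add e (D (e.symm a)) (D' (e.symm a))
  map_smul' c D := LieDerivation.ext fun a => map_smul e c (D (e.symm a))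
  map_lie' {D D'} := LieDerivation.ext fun a => by
    simp only [derivationCongrAux_apply, LieDerivation.commutator_apply, map_sub,
      e.symm_apply_apply]
  invFun := derivationCongrAux e.symm
  left_inv D := LieDerivation.ext fun a => by
    change e.symm (e (D (e.symm (e a)))) = D a
    rw [e.symm_apply_apply, e.symm_apply_apply]
  right_inv D := LieDerivation.ext fun a => by
    change e (e.symm (D (e (e.symm a)))) = D a
    rw [e.apply_symm_apply, e.apply_symm_apply]

theorem derivationCongr_ad (e : A ≃ₗ⁅K⁆ A') (a : A) :
    derivationCongr e (LieDerivation.ad K A a) = LieDerivation.ad K A' (e a) :=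
  LieDerivation.ext fun b => by
    change e (LieDerivation.ad K A a (e.symm b)) = _
    rw [LieDerivation.ad_apply_apply, LieDerivation.ad_apply_apply, LieEquiv.map_lie,
      e.apply_symm_apply]

end Transport

section Tower

variable (K : Type u) [Field K] (g : Type v) [LieRing g] [LieAlgebra K g]

instance finiteDimensional_derivation [FiniteDimensional K g] :
    FiniteDimensional K (LieDerivation K g g) :=
  Module.IsNoetherian.finite K (LieDerivation K g g)

instance finiteDimensional_tower [FiniteDimensional K g] (n : ℕ) :
    FiniteDimensional K (tower K g n) := by
  induction n with
  | zero => assumption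
  | succ n ih => exact finiteDimensional_derivation K (tower K g n)

variable {K g}

theorem IsComplete.nonempty_equiv (h : IsComplete K g) :
    Nonempty (LieDerivation K g g ≃ₗ⁅K⁆ g) := by
  refine ⟨(LieEquiv.ofBijective (LieDerivation.ad K g) ⟨?_, fun D => ?_⟩).symm⟩
  · rw [injective_iff_map_eq_zero]
    intro a ha
    have : a ∈ center K g := by
      rw [LieModule.mem_maxTrivSubmodule]
      intro b
      have := LieDerivation.congr_fun ha b
      rw [LieDerivation.ad_apply_apply] at this
      rw [← lie_skew, this, LieDerivation.zero_apply, neg_zero]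
    rwa [h.1, LieSubmodule.mem_bot] at this
  · obtain ⟨a, ha⟩ := h.2 D
    exact ⟨a, ha.symm⟩

theorem terminatesAt_of_isComplete {q : ℕ} (h : ∀ n, q ≤ n → IsComplete K (tower K g n)) :
    TerminatesAt K g q := by
  intro n hn
  induction n, hn using Nat.le_induction with
  | base => exact ⟨LieEquiv.refl⟩
  | succ n hn ih =>
    obtain ⟨e⟩ := ih
    obtain ⟨e'⟩ := (h n hn).nonempty_equiv
    exact ⟨e'.trans e⟩

end Tower

/-! ### The chain of normalizers and the algebras `s ⊕ Nⁿ ⊕ m`. -/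

namespace GammaTriple

variable {K : Type u} [Field K] {L : Type v} [LieRing L] [LieAlgebra K L] (T : GammaTriple K L)
  [FiniteDimensional K L] [CharZero K]

theorem normalizerSeq_le_B (n : ℕ) : T.normalizerSeq n ≤ T.B := by
  cases n with
  | zero => exact T.range_mu_le_B
  | succ n => exact inf_le_right

theorem normalizerSeq_le_succ (n : ℕ) : T.normalizerSeq n ≤ T.normalizerSeq (n + 1) :=
  le_inf (LieSubalgebra.le_normalizer _) (T.normalizerSeq_le_B n)

theorem range_mu_le_normalizerSeq (n : ℕ) : T.mu.range ≤ T.normalizerSeq n :=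
  monotone_nat_of_le_succ T.normalizerSeq_le_succ (Nat.zero_le n)

theorem exists_normalizerSeq_eq : ∃ q, ∀ n, q ≤ n → T.normalizerSeq n = T.normalizerSeq q := by
  obtain ⟨q, hq⟩ := monotone_stabilizes_iff_noetherian.2
    (inferInstance : IsNoetherian K (Module.End K T.m))
    ⟨fun n => (T.normalizerSeq n).toSubmodule, fun _ _ h =>
      monotone_nat_of_le_succ T.normalizerSeq_le_succ h⟩
  exact ⟨q, fun n hn => (LieSubalgebra.toSubmodule_injective (hq n hn)).symm⟩

theorem center_sub {N : LieSubalgebra K (Module.End K T.m)} {hN : T.mu.range ≤ N} :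
    center K (T.sub N hN) = ⊥ := by
  rw [eq_bot_iff]
  intro v hv
  rw [LieModule.mem_maxTrivSubmodule] at hv
  rw [LieSubmodule.mem_bot]
  refine Subtype.ext (T.eq_zero_of_lie_toAmbient_eq_zero fun w => ?_)
  have := congrArg Subtype.val (hv (T.toSub hN w))
  rw [← lie_skew, neg_eq_zero]
  exact this

/-- The term `s ⊕ Nⁿ ⊕ m`. -/
abbrev term (n : ℕ) : LieSubalgebra K T.Ambient :=
  T.sub (T.normalizerSeq n) (T.range_mu_le_normalizerSeq n)

theorem term_le_succ (n : ℕ) : T.term n ≤ T.term (n + 1) := fun _ ht => T.normalizerSeq_le_succ n ht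

theorem lie_mem_term {n : ℕ} {t v : T.Ambient} (ht : t ∈ T.term (n + 1)) (hv : v ∈ T.term n) :
    ⁅t, v⁆ ∈ T.term n := by
  refine add_mem (S := LieSubalgebra K (Module.End K T.m)) ?_
    (T.range_mu_le_normalizerSeq n ⟨_, rfl⟩)
  rw [← lie_skew]
  exact neg_mem ((LieSubalgebra.mem_normalizer_iff' _ _).1 ht.1 _ hv)

/-- The elements of `s ⊕ Nⁿ⁺¹ ⊕ m` act on `s ⊕ Nⁿ ⊕ m` by derivations. -/
noncomputable def termAct (n : ℕ) :
    T.term (n + 1) →ₗ⁅K⁆ LieDerivation K (T.term n) (T.term n) where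
  toFun t :=
    { toFun := fun v => ⟨⁅t.1, v.1⁆, T.lie_mem_term t.2 v.2⟩
      map_add' := fun a b => Subtype.ext (lie_add t.1 a.1 b.1)
      map_smul' := fun c a => Subtype.ext (lie_smul c t.1 a.1)
      leibniz' := fun a b => Subtype.ext (by
        change ⁅t.1, ⁅a.1, b.1⁆⁆ = ⁅a.1, ⁅t.1, b.1⁆⁆ - ⁅b.1, ⁅t.1, a.1⁆⁆
        rw [leibniz_lie, ← lie_skew b.1]
        abel) }
  map_add' a b := LieDerivation.ext fun v => Subtype.ext (add_lie a.1 b.1 v.1)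
  map_smul' c a := LieDerivation.ext fun v => Subtype.ext (smul_lie c a.1 v.1)
  map_lie' {a b} := LieDerivation.ext fun v => Subtype.ext (lie_lie a.1 b.1 v.1)

/-- The inductive step of the tower: `Der (s ⊕ Nⁿ ⊕ m)` is `s ⊕ Nⁿ⁺¹ ⊕ m`. Injectivity holds since
no nonzero element commutes with the image of `L`. -/
theorem termAct_bijective (hmu : Function.Injective T.mu) (n : ℕ) :
    Function.Bijective (T.termAct n) := by
  constructor
  · rw [injective_iff_map_eq_zero]
    intro t ht
    refine Subtype.ext (T.eq_zero_of_lie_toAmbient_eq_zero fun w => ?_)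
    exact congrArg Subtype.val
      (LieDerivation.congr_fun ht (T.toSub (T.range_mu_le_normalizerSeq n) w))
  · intro D
    obtain ⟨t, ht, h⟩ := T.exists_eq_lie_of_sub hmu (T.normalizerSeq_le_B n) D
    exact ⟨⟨t, ht⟩, LieDerivation.ext fun v => Subtype.ext (h v).symm⟩

theorem toSub_bijective (hmu : Function.Injective T.mu) :
    Function.Bijective (T.toSub (T.range_mu_le_normalizerSeq 0)) := by
  refine ⟨T.toSub_injective hmu, fun v => ?_⟩
  obtain ⟨w, hw⟩ := T.exists_toAmbient_eq v.2
  exact ⟨w, Subtype.ext hw⟩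

end GammaTriple

/-! ### The tower above a term with trivial center. -/

section CaseOne

variable {K : Type u} [Field K] [CharZero K] {g : Type v} [LieRing g] [LieAlgebra K g]
  [FiniteDimensional K g] {p : ℕ} (T : GammaTriple K (tower K g p))

/-- The isomorphisms of the tower above `gₚ` with the terms `s ⊕ Nⁿ ⊕ m`. -/
noncomputable def towerEquiv (hmu : Function.Injective T.mu) :
    ∀ n, tower K g (p + n) ≃ₗ⁅K⁆ T.term n
  | 0 => LieEquiv.ofBijective _ (T.toSub_bijective hmu)
  | n + 1 => (derivationCongr (towerEquiv hmu n)).trans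
      (LieEquiv.ofBijective _ (T.termAct_bijective hmu n)).symm

theorem towerEquiv_towerAd (hmu : Function.Injective T.mu) (n : ℕ) (a : tower K g (p + n)) :
    ((towerEquiv T hmu (n + 1) (towerAd K g (p + n) a) : T.term (n + 1)) : T.Ambient) =
      (towerEquiv T hmu n a : T.term n) := by
  have h : towerEquiv T hmu (n + 1) (towerAd K g (p + n) a) =
      ⟨_, T.term_le_succ n (towerEquiv T hmu n a).2⟩ := by
    apply (LieEquiv.ofBijective _ (T.termAct_bijective hmu n)).injective
    change (LieEquiv.ofBijective _ (T.termAct_bijective hmu n))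
      ((LieEquiv.ofBijective _ (T.termAct_bijective hmu n)).symm
        (derivationCongr (towerEquiv T hmu n) (LieDerivation.ad K _ a))) = _
    rw [LieEquiv.apply_symm_apply, derivationCongr_ad]
    exact LieDerivation.ext fun v => LieDerivation.ad_apply_apply _ _ _ _
  rw [h]

theorem center_tower_eq_bot (hmu : Function.Injective T.mu) (n : ℕ) :
    center K (tower K g (p + n)) = ⊥ := by
  rw [eq_bot_iff]
  intro v hv
  rw [LieModule.mem_maxTrivSubmodule] at hv
  have h : towerEquiv T hmu n v ∈ center K (T.term n) := by
    rw [LieModule.mem_maxTrivSubmodule]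
    intro w
    rw [← (towerEquiv T hmu n).apply_symm_apply w, ← LieEquiv.map_lie, hv, map_zero]
  rw [T.center_sub, LieSubmodule.mem_bot] at h
  rw [LieSubmodule.mem_bot]
  exact (towerEquiv T hmu n).injective (h.trans (map_zero _).symm)

/-- Under `towerEquiv` the adjoint map is the inclusion of consecutive terms (`towerEquiv_towerAd`),
so it is onto when the two normalizers coincide. -/
theorem isComplete_tower (hmu : Function.Injective T.mu) {n : ℕ}
    (hn : T.normalizerSeq (n + 1) = T.normalizerSeq n) : IsComplete K (tower K g (p + n)) := by
  refine ⟨center_tower_eq_bot T hmu n, fun D => ?_⟩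
  have h1 : ((towerEquiv T hmu (n + 1) D : T.term (n + 1)) : T.Ambient) ∈ T.term n := by
    rw [T.mem_sub, ← hn]
    exact (towerEquiv T hmu (n + 1) D : T.term (n + 1)).2
  refine ⟨(towerEquiv T hmu n).symm ⟨_, h1⟩, (towerEquiv T hmu (n + 1)).injective ?_⟩
  apply Subtype.ext
  refine Eq.trans ?_ (towerEquiv_towerAd T hmu n _).symm
  rw [LieEquiv.apply_symm_apply]
  rfl

theorem givenByNormalizers (hc : center K (tower K g p) = ⊥) : GivenByNormalizers K g p T := by
  have hmu := T.mu_injective hc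
  refine ⟨⟨fun n => GammaTriple.Ambient.toProd ∘ₗ (T.term n).toSubmodule.subtype ∘ₗ
    (towerEquiv T hmu n : tower K g (p + n) →ₗ[K] T.term n), fun n => ⟨?_, ?_, ?_⟩, ?_, ?_⟩, ?_⟩
  · exact GammaTriple.Ambient.toProd_injective.comp
      (Subtype.val_injective.comp (towerEquiv T hmu n).injective)
  · ext t
    constructor
    · rintro ⟨a, rfl⟩
      exact (towerEquiv T hmu n a : T.term n).2
    · intro ht
      let b : T.term n :=
        ⟨GammaTriple.Ambient.mk t.1 t.2.1 (T.normalizerSeq_le_B n ht) t.2.2, ht⟩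
      refine ⟨(towerEquiv T hmu n).symm b, ?_⟩
      change GammaTriple.Ambient.toProd (towerEquiv T hmu n ((towerEquiv T hmu n).symm b)).1 = t
      rw [LieEquiv.apply_symm_apply]
      rfl
  · intro a b
    change GammaTriple.Ambient.toProd (towerEquiv T hmu n ⁅a, b⁆).1 = _
    rw [LieEquiv.map_lie]
    rfl
  · exact T.toProd_toAmbient_add
  · exact fun n a => congrArg GammaTriple.Ambient.toProd (towerEquiv_towerAd T hmu n a)
  · obtain ⟨q, hq⟩ := T.exists_normalizerSeq_eq
    refine ⟨q, hq _ (Nat.le_succ q), fun n hn => ⟨hq n hn, isComplete_tower T hmu ?_⟩⟩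
    rw [hq n hn, hq _ (hn.trans (Nat.le_succ n))]

theorem caseOne_of_center_eq_bot (hc : center K (tower K g p) = ⊥) : CaseOne K g := by
  obtain ⟨T⟩ := nonempty_gammaTriple (K := K) (L := tower K g p)
  refine ⟨⟨p, fun n hn => ?_⟩, ?_, fun p' hp' =>
    ⟨nonempty_gammaTriple _ _, fun T' => givenByNormalizers T' hp'⟩⟩
  · obtain ⟨j, rfl⟩ := Nat.exists_eq_add_of_le hn
    exact center_tower_eq_bot T (T.mu_injective hc) j
  · obtain ⟨-, q, -, hq⟩ := givenByNormalizers T hc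
    have h : ∀ n, p + q ≤ n → IsComplete K (tower K g n) := by
      intro n hn
      obtain ⟨j, rfl⟩ := Nat.exists_eq_add_of_le ((Nat.le_add_right p q).trans hn)
      exact (hq j (by omega)).2
    exact ⟨p + q, terminatesAt_of_isComplete h, h⟩

end CaseOne

end DerTower

/-! ### Derivation counts with one functional. -/

namespace DerTower

open LieAlgebra LieModule Module

variable {K : Type u} [Field K] {L : Type v} [LieRing L] [LieAlgebra K L]

theorem lie_prod_self_eq_zero (a b : K × K) : ⁅a, b⁆ = 0 :=
  Prod.ext ((LieRing.of_associative_ring_bracket a.1 b.1).trans (by rw [mul_comm, sub_self]; rfl))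
    ((LieRing.of_associative_ring_bracket a.2 b.2).trans (by rw [mul_comm, sub_self]; rfl))

/-- Commuting `X` and `Y` define a representation of the abelian algebra `K × K`. If their images
span `M`, then `M` is its own positive Fitting component and contains no nonzero common null vector.
-/
theorem eq_zero_of_commute_surjective [CharZero K] {M : Type v} [AddCommGroup M] [Module K M]
    [FiniteDimensional K M] {X Y : Module.End K M} (h : Commute X Y)
    (hs : ∀ m, ∃ a b, X a + Y b = m) {z : M} (hX : X z = 0) (hY : Y z = 0) : z = 0 := by
  let ρ : (K × K) →ₗ⁅K⁆ Module.End K M :=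
    { LinearMap.coprod (LinearMap.toSpanSingleton K _ X) (LinearMap.toSpanSingleton K _ Y) with
      map_lie' := fun {a b} => by
        change (⁅a, b⁆ : K × K).1 • X + (⁅a, b⁆ : K × K).2 • Y =
          ⁅a.1 • X + a.2 • Y, b.1 • X + b.2 • Y⁆
        rw [lie_prod_self_eq_zero, LieRing.of_associative_ring_bracket]
        simp only [Prod.fst_zero, Prod.snd_zero, zero_smul, add_zero]
        refine (sub_eq_zero.2 ?_).symm
        have h1 : Commute (a.1 • X + a.2 • Y) (b.1 • X + b.2 • Y) :=
          (((Commute.refl X).smul_right _).add_right (h.smul_right _)).smul_left _ |>.add_left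
            (((h.symm.smul_right _).add_right ((Commute.refl Y).smul_right _)).smul_left _)
        exact h1.eq }
  have _ : IsLieAbelian (K × K) := ⟨lie_prod_self_eq_zero⟩
  obtain ⟨P, -, h1, -, h2⟩ := exists_fitting ρ
  have hP : ⊤ ≤ P := h2 ⊤ fun m _ => by
    obtain ⟨a, b, rfl⟩ := hs m
    refine add_mem (Submodule.subset_span ⟨(1, 0), a, trivial, ?_⟩)
      (Submodule.subset_span ⟨(0, 1), b, trivial, ?_⟩)
    · change ((1 : K) • X + (0 : K) • Y) a = _
      simp
    · change ((0 : K) • X + (1 : K) • Y) b = _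
      simp
  refine h1 z (hP trivial) fun y => ⟨1, ?_⟩
  change ((y.1 • X + y.2 • Y) ^ 1) z = 0
  simp [hX, hY]

theorem mem_derivedIdeal_of_eq {a b : L} : ⁅a, b⁆ ∈ derivedIdeal K L :=
  LieSubmodule.lie_mem_lie trivial trivial

theorem derivedIdeal_induction {U : Submodule K L} (h : ∀ a b : L, ⁅a, b⁆ ∈ U) {x : L}
    (hx : x ∈ derivedIdeal K L) : x ∈ U := by
  rw [← LieSubmodule.mem_toSubmodule, LieSubmodule.lieIdeal_oper_eq_linear_span'] at hx
  refine Submodule.span_le.2 ?_ hx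
  rintro _ ⟨a, -, b, -, rfl⟩
  exact h a b

theorem exists_functional {w : L} (hw : w ∉ derivedIdeal K L) :
    ∃ l : L →ₗ[K] K, l w = 1 ∧ ∀ a b : L, l ⁅a, b⁆ = 0 := by
  obtain ⟨f, hf, h⟩ := Submodule.exists_le_ker_of_notMem
    (p := (derivedIdeal K L).toSubmodule) (v := w) hw
  refine ⟨(f w)⁻¹ • f, inv_mul_cancel₀ hf, fun a b => ?_⟩
  rw [LinearMap.smul_apply, show f ⁅a, b⁆ = 0 from h mem_derivedIdeal_of_eq, smul_zero]

theorem exists_notMem_derivedIdeal (h : ¬ IsPerfect K L) : ∃ w : L, w ∉ derivedIdeal K L := by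
  by_contra! h'
  exact h (eq_top_iff.2 fun x _ => h' x)

/-- The algebra of derivations of a perfect Lie algebra has trivial center. -/
theorem IsPerfect.center_derivation (h : IsPerfect K L) :
    center K (LieDerivation K L L) = ⊥ := by
  rw [eq_bot_iff]
  intro D hD
  rw [LieModule.mem_maxTrivSubmodule] at hD
  have hD' : ∀ a b : L, ⁅D a, b⁆ = 0 := by
    intro a b
    have h1 := hD (LieDerivation.ad K L a)
    rw [← lie_skew, neg_eq_zero, LieDerivation.lie_der_ad_eq_ad_der] at h1
    rw [← LieDerivation.ad_apply_apply (R := K), h1, LieDerivation.zero_apply]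
  rw [LieSubmodule.mem_bot]
  ext x
  have hx : x ∈ derivedIdeal K L := by
    rw [show derivedIdeal K L = ⊤ from h]
    trivial
  refine derivedIdeal_induction (U := LinearMap.ker (D : L →ₗ[K] L)) (fun a b => ?_) hx
  change D ⁅a, b⁆ = 0
  rw [D.apply_lie_eq_add, hD', ← lie_skew, hD', neg_zero, add_zero]

section Count

variable [FiniteDimensional K L] {W : Type v} [AddCommGroup W] [Module K W]
  [FiniteDimensional K W] {M : Submodule K L} {δ : W →ₗ[K] LieDerivation K L L}

/-- The relations `ad y + δ w = 0` embed into `M` by `y`, as `δ` is injective; the rest is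
rank-nullity. -/
theorem finrank_add_finrank_range (hδ : Function.Injective δ)
    (hM : ∀ y w, LieDerivation.ad K L y + δ w = 0 → y ∈ M) :
    finrank K L + finrank K W ≤
      finrank K (LinearMap.range ((LieDerivation.ad K L : L →ₗ[K] _).coprod δ)) + finrank K M := by
  set Ψ := (LieDerivation.ad K L : L →ₗ[K] LieDerivation K L L).coprod δ with hΨ
  have h1 := LinearMap.finrank_range_add_finrank_ker Ψ
  rw [finrank_prod] at h1
  have hk : ∀ t ∈ LinearMap.ker Ψ, LieDerivation.ad K L t.1 + δ t.2 = 0 := fun t ht => ht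
  let i : LinearMap.ker Ψ →ₗ[K] M :=
    LinearMap.codRestrict M (LinearMap.fst K L W ∘ₗ (LinearMap.ker Ψ).subtype)
      fun t => hM t.1.1 t.1.2 (hk t t.2)
  have hi : Function.Injective i := by
    rw [injective_iff_map_eq_zero]
    intro t ht
    have h2 : t.1.1 = 0 := congrArg Subtype.val ht
    have h3 := hk t t.2
    rw [h2, map_zero, zero_add] at h3
    exact Subtype.ext (Prod.ext h2 (hδ (h3.trans (map_zero δ).symm)))
  have h2 := LinearMap.finrank_le_finrank_of_injective hi
  omega

theorem finrank_add_le (hδ : Function.Injective δ)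
    (hM : ∀ y w, LieDerivation.ad K L y + δ w = 0 → y ∈ M) :
    finrank K L + finrank K W ≤ finrank K (LieDerivation K L L) + finrank K M :=
  (finrank_add_finrank_range hδ hM).trans (Nat.add_le_add_right (Submodule.finrank_le _) _)

theorem exists_eq_ad_add (hδ : Function.Injective δ)
    (hM : ∀ y w, LieDerivation.ad K L y + δ w = 0 → y ∈ M) (hW : finrank K M ≤ finrank K W)
    (hL : finrank K (LieDerivation K L L) ≤ finrank K L) (D : LieDerivation K L L) :
    ∃ y w, D = LieDerivation.ad K L y + δ w := by
  have h := finrank_add_finrank_range hδ hM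
  have h1 : LinearMap.range ((LieDerivation.ad K L : L →ₗ[K] _).coprod δ) = ⊤ :=
    Submodule.eq_top_of_finrank_eq (le_antisymm (Submodule.finrank_le _) (by omega))
  have h2 : D ∈ LinearMap.range ((LieDerivation.ad K L : L →ₗ[K] _).coprod δ) := h1 ▸ trivial
  obtain ⟨t, rfl⟩ := h2
  exact ⟨t.1, t.2, rfl⟩

end Count

section Hyperplane

variable (l : L →ₗ[K] K)

/-- The centralizer of the kernel of `l`. -/
def kerCentralizer : Submodule K L where
  carrier := {c | ∀ v, l v = 0 → ⁅c, v⁆ = 0}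
  add_mem' ha hb v hv := by rw [add_lie, ha v hv, hb v hv, add_zero]
  zero_mem' v _ := zero_lie v
  smul_mem' c a ha v hv := by rw [smul_lie, ha v hv, smul_zero]

variable {l}

/-- The derivations `v ↦ l(v) c`, where `c` centralizes the kernel of `l`. -/
def rankOneDerivation (hl : ∀ a b : L, l ⁅a, b⁆ = 0) : kerCentralizer l →ₗ[K] LieDerivation K L L where
  toFun c :=
    { toLinearMap := l.smulRight (c : L)
      leibniz' := fun a b => by
        -- This combination lies in `ker l`, so `c` commutes with it; that is precisely the Leibniz
        -- rule.
        have h := c.2 (l b • a - l a • b) (by simp [mul_comm])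
        simp only [LinearMap.smulRight_apply, hl, zero_smul, lie_smul]
        rw [lie_sub, lie_smul, lie_smul, sub_eq_zero] at h
        rw [← lie_skew a, ← lie_skew b, smul_neg, smul_neg, h, sub_self] }
  map_add' a b := LieDerivation.ext fun v => smul_add (l v) (a : L) b
  map_smul' c a := LieDerivation.ext fun v => smul_comm (l v) c (a : L)

theorem rankOneDerivation_apply (hl : ∀ a b : L, l ⁅a, b⁆ = 0) (c : kerCentralizer l) (v : L) :
    rankOneDerivation hl c v = l v • (c : L) := rfl

variable (hl : ∀ a b : L, l ⁅a, b⁆ = 0) {x : L}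

theorem rankOneDerivation_injective (hx : l x = 1) : Function.Injective (rankOneDerivation hl) := by
  intro a b h
  have := LieDerivation.congr_fun h x
  rw [rankOneDerivation_apply, rankOneDerivation_apply, hx, one_smul, one_smul] at this
  exact Subtype.ext this

theorem mem_kerCentralizer_of_ad_add_eq_zero (y : L) (c : kerCentralizer l)
    (h : LieDerivation.ad K L y + rankOneDerivation hl c = 0) : y ∈ kerCentralizer l := by
  intro v hv
  have := LieDerivation.congr_fun h v
  rwa [LieDerivation.add_apply, rankOneDerivation_apply, hv, zero_smul, add_zero,
    LieDerivation.ad_apply_apply] at this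

/-- Here the new derivations and the bound on relations are both measured by `kerCentralizer l`, and
the two dimensions cancel. -/
theorem finrank_le_finrank_derivation [FiniteDimensional K L] (hl : ∀ a b : L, l ⁅a, b⁆ = 0)
    (hx : l x = 1) :
    finrank K L ≤ finrank K (LieDerivation K L L) := by
  have := finrank_add_le (rankOneDerivation_injective hl hx)
    (mem_kerCentralizer_of_ad_add_eq_zero hl)
  omega

theorem exists_eq_ad_add_rankOneDerivation [FiniteDimensional K L] (hx : l x = 1)
    (hL : finrank K (LieDerivation K L L) ≤ finrank K L) (D : LieDerivation K L L) :
    ∃ y c, D = LieDerivation.ad K L y + rankOneDerivation hl c :=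
  exists_eq_ad_add (rankOneDerivation_injective hl hx)
    (mem_kerCentralizer_of_ad_add_eq_zero hl) le_rfl hL D

end Hyperplane

end DerTower

namespace DerTower

open LieAlgebra LieModule Module

variable {K : Type u} [Field K] {L : Type v} [LieRing L] [LieAlgebra K L]

/-! ### Derivation counts with two functionals. -/

section CodimensionTwo

variable (l l' : L →ₗ[K] K)

/-- The centralizer of the intersection of the kernels of `l` and `l'`. -/
def kerInfCentralizer : Submodule K L where
  carrier := {c | ∀ v, l v = 0 → l' v = 0 → ⁅c, v⁆ = 0}
  add_mem' ha hb v hv hv' := by rw [add_lie, ha v hv hv', hb v hv hv', add_zero]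
  zero_mem' v _ _ := zero_lie v
  smul_mem' c a ha v hv hv' := by rw [smul_lie, ha v hv hv', smul_zero]

variable {l l'}

theorem lie_mem_kerInfCentralizer (hl : ∀ a b : L, l ⁅a, b⁆ = 0) (hl' : ∀ a b : L, l' ⁅a, b⁆ = 0)
    (x : L) {c : L} (hc : c ∈ kerInfCentralizer l l') : ⁅x, c⁆ ∈ kerInfCentralizer l l' := by
  intro v hv hv'
  rw [lie_lie, hc v hv hv', lie_zero, hc _ (hl _ _) (hl' _ _), sub_zero]

/-- The action of an element of `L` on the centralizer of `ker l ⊓ ker l'`. -/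
def kerInfAct (hl : ∀ a b : L, l ⁅a, b⁆ = 0) (hl' : ∀ a b : L, l' ⁅a, b⁆ = 0) (x : L) :
    Module.End K (kerInfCentralizer l l') :=
  (LieAlgebra.ad K L x).restrict fun _ hc => lie_mem_kerInfCentralizer hl hl' x hc

/-- The two actions commute up to `[x, y]`, which lies in both kernels and is therefore centralized.
-/
theorem commute_kerInfAct (hl : ∀ a b : L, l ⁅a, b⁆ = 0) (hl' : ∀ a b : L, l' ⁅a, b⁆ = 0)
    (x y : L) : Commute (kerInfAct hl hl' x) (kerInfAct hl hl' y) := by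
  ext c
  change ⁅x, ⁅y, (c : L)⁆⁆ = ⁅y, ⁅x, (c : L)⁆⁆
  rw [leibniz_lie, ← lie_skew ⁅x, y⁆, c.2 _ (hl _ _) (hl' _ _), neg_zero, zero_add]

/-- The derivations `v ↦ l(v) a + l'(v) b`, where `a` and `b` centralize `ker l ⊓ ker l'` and
`[x', a] = [x, b]`. -/
def rankTwoDerivation (hl : ∀ a b : L, l ⁅a, b⁆ = 0) (hl' : ∀ a b : L, l' ⁅a, b⁆ = 0) {x x' : L}
    (hx : l x = 1 ∧ l' x = 0) (hx' : l x' = 0 ∧ l' x' = 1) :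
    LinearMap.ker ((kerInfAct hl hl' x').coprod (-kerInfAct hl hl' x)) →ₗ[K]
      LieDerivation K L L where
  toFun c :=
    { toLinearMap := l.smulRight (c.1.1 : L) + l'.smulRight (c.1.2 : L)
      leibniz' := fun u v => by
        have h0 : ⁅x', (c.1.1 : L)⁆ = ⁅x, (c.1.2 : L)⁆ := by
          have := congrArg Subtype.val (LinearMap.mem_ker.1 c.2)
          refine sub_eq_zero.1 (Eq.trans ?_ this)
          rw [sub_eq_add_neg]
          rfl
        -- `u` agrees with `l(u) x + l'(u) x'` modulo the two kernels, which `a` centralizes.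
        have h1 : ∀ (a : kerInfCentralizer l l') (u : L),
            ⁅u, (a : L)⁆ = l u • ⁅x, (a : L)⁆ + l' u • ⁅x', (a : L)⁆ := by
          intro a u
          have := a.2 (u - l u • x - l' u • x') (by simp [hx, hx']) (by simp [hx, hx'])
          rw [lie_sub, lie_sub, lie_smul, lie_smul, sub_sub, sub_eq_zero, ← lie_skew, ← lie_skew _ x,
            ← lie_skew _ x', smul_neg, smul_neg, ← neg_add, neg_inj] at this
          exact this
        simp only [LinearMap.add_apply, LinearMap.smulRight_apply, hl, hl', zero_smul, lie_smul,
          lie_add, add_zero]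
        rw [h1 c.1.1 u, h1 c.1.1 v, h1 c.1.2 u, h1 c.1.2 v, h0]
        module }
  map_add' a b := LieDerivation.ext fun v => by
    change l v • ((a.1.1 : L) + b.1.1) + l' v • ((a.1.2 : L) + b.1.2) =
      (l v • (a.1.1 : L) + l' v • (a.1.2 : L)) + (l v • (b.1.1 : L) + l' v • (b.1.2 : L))
    module
  map_smul' r a := LieDerivation.ext fun v => by
    change l v • (r • (a.1.1 : L)) + l' v • (r • (a.1.2 : L)) =
      r • (l v • (a.1.1 : L) + l' v • (a.1.2 : L))
    module

/-- With `M` the centralizer of `ker l ⊓ ker l'`, the rank-two derivations form the kernel of a map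
`κ : M × M → M`. If `κ` is not onto, this kernel has dimension greater than `dim M`, and
`finrank_add_le` becomes strict. It is not onto, since a central element is killed by both commuting
actions. -/
theorem finrank_lt_finrank_derivation [FiniteDimensional K L] [CharZero K]
    (hl : ∀ a b : L, l ⁅a, b⁆ = 0) (hl' : ∀ a b : L, l' ⁅a, b⁆ = 0) {x x' : L}
    (hx : l x = 1 ∧ l' x = 0) (hx' : l x' = 0 ∧ l' x' = 1) (hZ : center K L ≠ ⊥) :
    finrank K L < finrank K (LieDerivation K L L) := by
  set δ := rankTwoDerivation hl hl' hx hx' with hδ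
  have hδa : ∀ c v, δ c v = l v • (c.1.1 : L) + l' v • (c.1.2 : L) := fun _ _ => rfl
  have h1 : _ + finrank K (LinearMap.ker ((kerInfAct hl hl' x').coprod (-kerInfAct hl hl' x))) ≤ _ :=
    finrank_add_le (δ := δ) (M := kerInfCentralizer l l')
    (by
      intro a b h
      have e1 := LieDerivation.congr_fun h x
      have e2 := LieDerivation.congr_fun h x'
      rw [hδa, hδa, hx.1, hx.2, one_smul, one_smul, zero_smul, zero_smul, add_zero, add_zero] at e1
      rw [hδa, hδa, hx'.1, hx'.2, one_smul, one_smul, zero_smul, zero_smul, zero_add, zero_add] at e2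
      exact Subtype.ext (Prod.ext (Subtype.ext e1) (Subtype.ext e2)))
    (by
      intro y c h v hv hv'
      have := LieDerivation.congr_fun h v
      rwa [LieDerivation.add_apply, hδa, hv, hv', zero_smul, zero_smul, add_zero, add_zero,
        LieDerivation.ad_apply_apply] at this)
  set κ := (kerInfAct hl hl' x').coprod (-kerInfAct hl hl' x) with hκ
  have h2 := LinearMap.finrank_range_add_finrank_ker κ
  rw [finrank_prod] at h2
  have h3 : LinearMap.range κ ≠ ⊤ := by
    intro htop
    refine hZ (eq_bot_iff.2 fun z hz => ?_)
    rw [LieModule.mem_maxTrivSubmodule] at hz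
    have hzM : z ∈ kerInfCentralizer l l' := fun v _ _ => by rw [← lie_skew, hz, neg_zero]
    have := eq_zero_of_commute_surjective (commute_kerInfAct hl hl' x' x) (z := ⟨z, hzM⟩)
      (fun m => by
        obtain ⟨t, rfl⟩ : m ∈ LinearMap.range κ := htop ▸ trivial
        refine ⟨t.1, -t.2, ?_⟩
        rw [map_neg]
        rfl) (Subtype.ext (hz x')) (Subtype.ext (hz x))
    rw [LieSubmodule.mem_bot]
    exact congrArg Subtype.val this
  have h4 := Submodule.finrank_lt h3
  omega

/-- If `Der L` is not larger than `L`, and `L` has a nontrivial center, then the derived ideal of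
`L` has codimension at most one. -/
theorem mem_derivedIdeal_of_apply_eq_zero [FiniteDimensional K L] [CharZero K]
    (hl : ∀ a b : L, l ⁅a, b⁆ = 0) {x : L} (hx : l x = 1) (hZ : center K L ≠ ⊥)
    (hL : finrank K (LieDerivation K L L) ≤ finrank K L) {v : L} (hv : l v = 0) :
    v ∈ derivedIdeal K L := by
  by_contra h
  obtain ⟨l', hl'v, hl'⟩ := exists_functional h
  -- Subtracting `l'(x) v` makes the two vectors dual to `l` and `l'`.
  exact hL.not_gt (finrank_lt_finrank_derivation hl hl' (x := x - l' x • v) (x' := v)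
    ⟨by simp [hx, hv], by simp [hl'v]⟩ ⟨hv, hl'v⟩ hZ)

end CodimensionTwo

end DerTower

/-! ### Splitting off a one-dimensional center when `dim Der L = dim L`. -/

namespace DerTower

open LieAlgebra LieModule Module

variable {K : Type u} [Field K] {L : Type v} [LieRing L] [LieAlgebra K L] {l : L →ₗ[K] K}

theorem apply_eq_zero_of_mem_derivedIdeal (hl : ∀ a b : L, l ⁅a, b⁆ = 0) {v : L}
    (hv : v ∈ derivedIdeal K L) : l v = 0 :=
  derivedIdeal_induction (U := LinearMap.ker l) hl hv

/-- Rank-one derivations with values in `ker l` have zero composites, so the bracket reduces to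
terms involving an inner derivation and is itself inner. -/
theorem lie_ad_add_rankOneDerivation (hl : ∀ a b : L, l ⁅a, b⁆ = 0) (a b : L)
    {c d : kerCentralizer l} (hc : l c = 0) (hd : l d = 0) :
    ⁅LieDerivation.ad K L a + rankOneDerivation hl c,
      LieDerivation.ad K L b + rankOneDerivation hl d⁆ =
      LieDerivation.ad K L (⁅a, b⁆ + l b • (c : L) - l a • (d : L)) := by
  have h0 : ⁅rankOneDerivation hl c, rankOneDerivation hl d⁆ = 0 := by
    ext v
    simp [rankOneDerivation_apply, hc, hd]
  rw [add_lie, lie_add, lie_add, h0, add_zero, LieDerivation.lie_der_ad_eq_ad_der,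
    LieDerivation.lie_der_ad_eq_ad_der, ← lie_skew (LieDerivation.ad K L a),
    LieDerivation.lie_der_ad_eq_ad_der, rankOneDerivation_apply, rankOneDerivation_apply,
    LieDerivation.ad_apply_apply, map_sub, map_add]
  abel

variable [FiniteDimensional K L]

theorem finrank_ker_functional {x : L} (hx : l x = 1) :
    finrank K (LinearMap.ker l) + 1 = finrank K L := by
  have h := LinearMap.finrank_range_add_finrank_ker l
  have h1 : LinearMap.range l = ⊤ := LinearMap.range_eq_top.2 fun c => ⟨c • x, by simp [hx]⟩
  rw [h1, finrank_top, finrank_self] at h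
  omega

/-- If `Der L` is not larger than `L`, and the derived ideal of `Der L` is a hyperplane, then the
center of `L` is not contained in the kernel of `l`. -/
theorem exists_mem_center_apply_eq_one (hl : ∀ a b : L, l ⁅a, b⁆ = 0) {x : L} (hx : l x = 1)
    (hL : finrank K (LieDerivation K L L) ≤ finrank K L) (hZ : center K L ≠ ⊥)
    {l₁ : LieDerivation K L L →ₗ[K] K} {D : LieDerivation K L L} (hD : l₁ D = 1)
    (h : ∀ E, l₁ E = 0 → E ∈ derivedIdeal K (LieDerivation K L L)) :
    ∃ z ∈ center K L, l z = 1 := by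
  by_contra! hcon
  have hz0 : ∀ z ∈ center K L, l z = 0 := by
    intro z hz
    by_contra h0
    refine hcon ((l z)⁻¹ • z) ((center K L).smul_mem _ hz) ?_
    rw [map_smul, smul_eq_mul, inv_mul_cancel₀ h0]
  -- An element centralizing `ker l` but outside it would be central, since it also commutes with
  -- itself.
  have hC : ∀ c : kerCentralizer l, l c = 0 := by
    intro c
    by_contra h0
    refine h0 (hz0 c ?_)
    rw [LieModule.mem_maxTrivSubmodule]
    intro v
    have := c.2 (v - (l v * (l c)⁻¹) • (c : L)) (by simp [h0])
    rw [lie_sub, lie_smul, lie_self, smul_zero, sub_zero] at this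
    rw [← lie_skew, this, neg_zero]
  set f : LinearMap.ker l →ₗ[K] LieDerivation K L L :=
    (LieDerivation.ad K L : L →ₗ[K] LieDerivation K L L) ∘ₗ (LinearMap.ker l).subtype with hf
  -- The derived ideal of `Der L` then lies in `ad (ker l)`. But `ad` has a kernel on `ker l`, which
  -- contains the nonzero center, so the hyperplane `ker l₁` would be too small.
  have hM : LinearMap.ker l₁ ≤ LinearMap.range f := by
    intro E hE
    refine derivedIdeal_induction (U := LinearMap.range f) (fun A B => ?_) (h E hE)
    obtain ⟨a, c, rfl⟩ := exists_eq_ad_add_rankOneDerivation hl hx hL A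
    obtain ⟨b, d, rfl⟩ := exists_eq_ad_add_rankOneDerivation hl hx hL B
    rw [lie_ad_add_rankOneDerivation hl a b (hC c) (hC d)]
    exact ⟨⟨⁅a, b⁆ + l b • (c : L) - l a • (d : L), by simp [hl, hC]⟩, rfl⟩
  have h1 := Submodule.finrank_mono hM
  have h2 := finrank_ker_functional hD
  have h3 := finrank_ker_functional hx
  have h4 := LinearMap.finrank_range_add_finrank_ker f
  have h5 := finrank_le_finrank_derivation hl hx
  have h6 : 0 < finrank K (LinearMap.ker f) := by
    obtain ⟨z, hz, hz'⟩ := Submodule.exists_mem_ne_zero_of_ne_bot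
      (p := (center K L).toSubmodule) fun h0 => hZ (LieSubmodule.toSubmodule_eq_bot _ |>.1 h0)
    rw [Module.finrank_pos_iff_exists_ne_zero]
    refine ⟨⟨⟨z, hz0 z hz⟩, ?_⟩, fun h0 => hz' (congrArg (fun t => ((t : LinearMap.ker l) : L))
      (congrArg Subtype.val h0))⟩
    rw [LieSubmodule.mem_toSubmodule, LieModule.mem_maxTrivSubmodule] at hz
    rw [LinearMap.mem_ker]
    ext v
    change LieDerivation.ad K L z v = 0
    rw [LieDerivation.ad_apply_apply, ← lie_skew, hz, neg_zero]
  omega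

section Split

variable {z : L}

omit [FiniteDimensional K L] in
theorem lie_center (hz : z ∈ center K L) (v : L) : ⁅v, z⁆ = 0 := by
  rw [LieModule.mem_maxTrivSubmodule] at hz
  exact hz v

omit [FiniteDimensional K L] in
theorem center_lie (hz : z ∈ center K L) (v : L) : ⁅z, v⁆ = 0 := by
  rw [← lie_skew, lie_center hz, neg_zero]

omit [FiniteDimensional K L] in
theorem lie_sub_smul_center (hz : z ∈ center K L) (a b : L) (r t : K) :
    ⁅a - r • z, b - t • z⁆ = ⁅a, b⁆ := by
  rw [lie_sub, sub_lie, lie_smul, lie_center hz, smul_lie, center_lie hz]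
  simp

/-- The projection to `[L, L]` along a central element. -/
def splitProj (hlz : l z = 1) (hP : ∀ v, l v = 0 → v ∈ derivedIdeal K L) :
    L →ₗ[K] derivedIdeal K L where
  toFun v := ⟨v - l v • z, hP _ (by simp [hlz])⟩
  map_add' a b := Subtype.ext (by
    change a + b - l (a + b) • z = (a - l a • z) + (b - l b • z)
    rw [map_add]
    module)
  map_smul' c a := Subtype.ext (by
    change c • a - l (c • a) • z = c • (a - l a • z)
    rw [map_smul, smul_eq_mul]
    module)

variable (hl : ∀ a b : L, l ⁅a, b⁆ = 0) (hz : z ∈ center K L) (hlz : l z = 1)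
  (hP : ∀ v, l v = 0 → v ∈ derivedIdeal K L)

omit [FiniteDimensional K L] in
theorem splitProj_coe (p : derivedIdeal K L) (hl : ∀ a b : L, l ⁅a, b⁆ = 0) :
    splitProj hlz hP p = p := Subtype.ext (by
  change (p : L) - l p • z = p
  rw [apply_eq_zero_of_mem_derivedIdeal hl p.2, zero_smul, sub_zero])

omit [FiniteDimensional K L] in
include hl hz in
theorem splitProj_lie (a b : L) :
    splitProj hlz hP ⁅a, b⁆ = ⁅splitProj hlz hP a, splitProj hlz hP b⁆ := Subtype.ext (by
  change ⁅a, b⁆ - l ⁅a, b⁆ • z = ⁅a - l a • z, b - l b • z⁆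
  rw [hl, zero_smul, sub_zero, lie_sub_smul_center hz])

omit [FiniteDimensional K L] in
include hl hz hlz hP in
theorem nonempty_equiv_prod : Nonempty (L ≃ₗ⁅K⁆ K × derivedIdeal K L) := by
  let f : L →ₗ⁅K⁆ K × derivedIdeal K L :=
    { l.prod (splitProj hlz hP) with
      map_lie' := fun {a b} => Prod.ext (by
        change l ⁅a, b⁆ = ⁅l a, l b⁆
        rw [hl, LieRing.of_associative_ring_bracket, mul_comm, sub_self])
        (splitProj_lie hl hz hlz hP a b) }
  refine ⟨LieEquiv.ofBijective f ⟨?_, fun t => ⟨t.1 • z + t.2, ?_⟩⟩⟩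
  · rw [injective_iff_map_eq_zero]
    intro v hv
    have h1 : l v = 0 := congrArg Prod.fst hv
    have h2 : v - l v • z = 0 := congrArg (fun t => ((t.2 : derivedIdeal K L) : L)) hv
    rwa [h1, zero_smul, sub_zero] at h2
  · have h1 : l (t.1 • z + (t.2 : L)) = t.1 := by
      rw [map_add, map_smul, hlz, apply_eq_zero_of_mem_derivedIdeal hl t.2.2]
      simp
    refine Prod.ext h1 (Subtype.ext ?_)
    change t.1 • z + (t.2 : L) - l (t.1 • z + (t.2 : L)) • z = t.2
    rw [h1]
    abel

omit [FiniteDimensional K L] in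
include hl hz hlz hP in
-- Brackets of `L` are unchanged when both arguments are projected along `z` to the derived ideal.
theorem isPerfect_derivedIdeal : IsPerfect K (derivedIdeal K L) := by
  refine eq_top_iff.2 fun v _ => ?_
  have h : (v : L) ∈ (derivedIdeal K (derivedIdeal K L)).toSubmodule.map
      (derivedIdeal K L).toSubmodule.subtype := by
    refine derivedIdeal_induction (fun a b => ?_) v.2
    refine ⟨(⁅splitProj hlz hP a, splitProj hlz hP b⁆ : derivedIdeal K L),
      mem_derivedIdeal_of_eq (L := derivedIdeal K L), ?_⟩
    rw [← splitProj_lie hl hz hlz hP]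
    exact congrArg Subtype.val (splitProj_coe hlz hP ⟨_, mem_derivedIdeal_of_eq⟩ hl)
  obtain ⟨w, hw, e⟩ := h
  rwa [← show w = v from Subtype.ext e]

variable (hL : finrank K (LieDerivation K L L) ≤ finrank K L)
  (hZ : center K (LieDerivation K L L) ≠ ⊥)

omit [FiniteDimensional K L] in
include hl hz hlz hP hZ in
/-- If the center of `Der L` is not trivial, then the center of `L` is spanned by `z`. -/
theorem eq_smul_of_mem_center {c : L} (hc : c ∈ center K L) : c = l c • z := by
  obtain ⟨E, hE, hE0⟩ := Submodule.exists_mem_ne_zero_of_ne_bot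
      (p := (center K (LieDerivation K L L)).toSubmodule)
      fun h0 => hZ (LieSubmodule.toSubmodule_eq_bot _ |>.1 h0)
  rw [LieSubmodule.mem_toSubmodule, LieModule.mem_maxTrivSubmodule] at hE
  -- A nonzero central `E` of `Der L` commutes with inner derivations, so its values are central and
  -- it kills brackets: `E = l(·) E z`.
  have hEc : ∀ a b : L, ⁅E a, b⁆ = 0 := by
    intro a b
    have h1 := hE (LieDerivation.ad K L a)
    rw [← lie_skew, neg_eq_zero, LieDerivation.lie_der_ad_eq_ad_der] at h1
    rw [← LieDerivation.ad_apply_apply (R := K), h1, LieDerivation.zero_apply]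
  have hE' : ∀ v ∈ derivedIdeal K L, E v = 0 := fun v hv =>
    derivedIdeal_induction (U := LinearMap.ker (E : L →ₗ[K] L)) (fun a b => by
      change E ⁅a, b⁆ = 0
      rw [E.apply_lie_eq_add, hEc, ← lie_skew, hEc, neg_zero, add_zero]) hv
  have hEv : ∀ v, E v = l v • E z := by
    intro v
    have := hE' (v - l v • z) (hP _ (by simp [hlz]))
    rwa [map_sub, map_smul, sub_eq_zero] at this
  have hEz : E z ≠ 0 := fun h0 => hE0 (LieDerivation.ext fun v => by
    rw [hEv, h0, smul_zero, LieDerivation.zero_apply])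
  -- `E` also commutes with the derivation `v ↦ l(v) c`. This makes every central `c` proportional
  -- to `E z`, and the case `c = z` shows `l (E z) ≠ 0`.
  have hcomm : ∀ c ∈ center K L, l (E z) • c = l c • E z := by
    intro c hc
    have h1 := LieDerivation.congr_fun
      (hE (rankOneDerivation hl ⟨c, fun v _ => center_lie hc v⟩)) z
    rw [LieDerivation.commutator_apply, rankOneDerivation_apply, rankOneDerivation_apply, hlz,
      one_smul, hEv c, LieDerivation.zero_apply, sub_eq_zero] at h1
    exact h1
  have h1 := hcomm z hz
  rw [hlz, one_smul] at h1
  have h2 : l (E z) ≠ 0 := fun h0 => hEz (by rw [← h1, h0, zero_smul])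
  have h3 := hcomm c hc
  apply smul_right_injective L h2
  change l (E z) • c = l (E z) • l c • z
  rw [smul_comm, h1, h3]

include hl hz hlz hP hZ hL in
-- A central element of `[L, L]` is central in `L`, hence a multiple of `z` on which `l` vanishes. A
-- derivation of `[L, L]`, extended by zero on `z`, is inner up to a rank-one derivation, and the
-- latter vanishes on `[L, L]`.
theorem isComplete_derivedIdeal : IsComplete K (derivedIdeal K L) := by
  constructor
  · rw [eq_bot_iff]
    intro w hw
    have hw' : (w : L) ∈ center K L := by
      rw [LieModule.mem_maxTrivSubmodule] at hw ⊢
      intro v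
      have h1 := congrArg Subtype.val (hw (splitProj hlz hP v))
      change ⁅v - l v • z, (w : L)⁆ = 0 at h1
      rwa [sub_lie, smul_lie, center_lie hz, smul_zero, sub_zero] at h1
    have h1 := eq_smul_of_mem_center hl hz hlz hP hZ hw'
    rw [apply_eq_zero_of_mem_derivedIdeal hl w.2, zero_smul] at h1
    rw [LieSubmodule.mem_bot]
    exact Subtype.ext h1
  · intro D
    let E : LieDerivation K L L :=
      { toLinearMap := (derivedIdeal K L).toSubmodule.subtype ∘ₗ
          (D : derivedIdeal K L →ₗ[K] derivedIdeal K L) ∘ₗ splitProj hlz hP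
        leibniz' := fun a b => by
          change ((D (splitProj hlz hP ⁅a, b⁆) : derivedIdeal K L) : L) =
            ⁅a, ((D (splitProj hlz hP b) : derivedIdeal K L) : L)⁆ -
            ⁅b, ((D (splitProj hlz hP a) : derivedIdeal K L) : L)⁆
          have h1 : ∀ (a : L) (p : derivedIdeal K L),
              ((⁅splitProj hlz hP a, p⁆ : derivedIdeal K L) : L) = ⁅a, (p : L)⁆ := by
            intro a p
            change ⁅a - l a • z, (p : L)⁆ = _
            rw [sub_lie, smul_lie, center_lie hz, smul_zero, sub_zero]
          rw [splitProj_lie hl hz, D.apply_lie_eq_sub, AddSubgroupClass.coe_sub, h1, h1] }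
    obtain ⟨y, c, h⟩ := exists_eq_ad_add_rankOneDerivation hl hlz hL E
    refine ⟨splitProj hlz hP y, LieDerivation.ext fun p => Subtype.ext ?_⟩
    have h1 := LieDerivation.congr_fun h (p : L)
    have h2 : E (p : L) = (D p : derivedIdeal K L) := by
      change ((D (splitProj hlz hP p) : derivedIdeal K L) : L) = _
      rw [splitProj_coe hlz hP p hl]
    rw [h2, LieDerivation.add_apply, rankOneDerivation_apply,
      apply_eq_zero_of_mem_derivedIdeal hl p.2, zero_smul, add_zero,
      LieDerivation.ad_apply_apply] at h1
    rw [h1, LieDerivation.ad_apply_apply]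
    change _ = ⁅y - l y • z, (p : L)⁆
    rw [sub_lie, smul_lie, center_lie hz, smul_zero, sub_zero]

include hl hz hlz hP hZ hL in
-- The derivation `E = l(·) z` commutes with all inner ones, so `v ↦ ad v + l(v) E` is a
-- homomorphism. It is injective because the center is `Kz`, and bijective by dimension.
theorem nonempty_derivation_equiv : Nonempty (LieDerivation K L L ≃ₗ⁅K⁆ L) := by
  set E := rankOneDerivation hl ⟨z, fun v _ => center_lie hz v⟩ with hE
  have hEv : ∀ v, E v = l v • z := fun v => rfl
  have hEa : ∀ a, ⁅E, LieDerivation.ad K L a⁆ = 0 := by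
    intro a
    rw [LieDerivation.lie_der_ad_eq_ad_der]
    ext v
    rw [LieDerivation.ad_apply_apply, hEv, smul_lie, center_lie hz, smul_zero,
      LieDerivation.zero_apply]
  have hEs : ∀ (r : K) (a : L), ⁅r • E, LieDerivation.ad K L a⁆ = 0 := fun r a => by
    rw [smul_lie, hEa, smul_zero]
  have hEE : ∀ r t : K, ⁅r • E, t • E⁆ = 0 := fun r t => by
    rw [smul_lie, ← lie_skew, smul_lie, lie_self, smul_zero, neg_zero, smul_zero]
  let f : L →ₗ⁅K⁆ LieDerivation K L L :=
    { (LieDerivation.ad K L : L →ₗ[K] LieDerivation K L L) + l.smulRight E with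
      map_lie' := fun {a b} => by
        change LieDerivation.ad K L ⁅a, b⁆ + l ⁅a, b⁆ • E =
          ⁅LieDerivation.ad K L a + l a • E, LieDerivation.ad K L b + l b • E⁆
        rw [hl, zero_smul, add_zero, lie_add, add_lie, add_lie, hEs, ← lie_skew _ (l b • E), hEs,
          hEE, LieHom.map_lie]
        simp }
  have hf : Function.Injective f := by
    rw [injective_iff_map_eq_zero]
    intro v hv
    have h1 : ∀ u, ⁅v, u⁆ + l v • l u • z = 0 := by
      intro u
      have := LieDerivation.congr_fun hv u
      change LieDerivation.ad K L v u + l v • l u • z = 0 at this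
      rwa [LieDerivation.ad_apply_apply] at this
    have h2 := h1 z
    rw [lie_center hz, hlz, one_smul, zero_add] at h2
    have h3 : l v = 0 := by simpa [hlz] using congrArg l h2
    have h4 : v ∈ center K L := by
      rw [LieModule.mem_maxTrivSubmodule]
      intro u
      have := h1 u
      rw [h3, zero_smul, add_zero] at this
      rw [← lie_skew, this, neg_zero]
    rw [eq_smul_of_mem_center hl hz hlz hP hZ h4, h3, zero_smul]
  have hs : Function.Surjective f := (LinearMap.injective_iff_surjective_of_finrank_eq_finrank
    (f := (f : L →ₗ[K] LieDerivation K L L))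
    (le_antisymm (finrank_le_finrank_derivation hl hlz) hL)).1 hf
  exact ⟨(LieEquiv.ofBijective f ⟨hf, hs⟩).symm⟩

end Split

end DerTower

/-! ### Towers with nonzero centers, and the conclusion. -/

namespace DerTower

open LieAlgebra LieModule Module

variable {K : Type u} [Field K] {g : Type v} [LieRing g] [LieAlgebra K g]

theorem TerminatesAt.finrank_eq {q : ℕ} (h : TerminatesAt K g q) {n : ℕ} (hn : q ≤ n) :
    finrank K (tower K g n) = finrank K (tower K g q) := by
  obtain ⟨e⟩ := h n hn
  exact e.toLinearEquiv.finrank_eq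

theorem TerminatesAt.not_caseThree {q : ℕ} (h : TerminatesAt K g q) : ¬ CaseThree K g := by
  rintro ⟨-, h'⟩
  obtain ⟨n, hn⟩ := Filter.eventually_atTop.1
    (h'.eventually (Filter.eventually_gt_atTop (finrank K (tower K g q))))
  have := hn (max n q) (le_max_left _ _)
  rw [h.finrank_eq (le_max_right n q)] at this
  exact lt_irrefl _ this

theorem terminatesAt_of_nonempty_equiv {q : ℕ}
    (h : Nonempty (tower K g (q + 1) ≃ₗ⁅K⁆ tower K g q)) : TerminatesAt K g q := by
  obtain ⟨e₀⟩ := h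
  intro n hn
  induction n, hn using Nat.le_induction with
  | base => exact ⟨LieEquiv.refl⟩
  | succ n hn ih =>
    obtain ⟨e⟩ := ih
    exact ⟨(derivationCongr e).trans e₀⟩

/-- A perfect term would give the next term trivial center. -/
theorem exists_tower_functional (h : ∀ n, center K (tower K g n) ≠ ⊥) (n : ℕ) :
    ∃ (l : tower K g n →ₗ[K] K) (x : tower K g n), l x = 1 ∧ ∀ a b : tower K g n, l ⁅a, b⁆ = 0 := by
  have h1 : ¬ IsPerfect K (tower K g n) := fun h' => h (n + 1) h'.center_derivation
  obtain ⟨w, hw⟩ := exists_notMem_derivedIdeal h1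
  obtain ⟨l, hl, hl'⟩ := exists_functional hw
  exact ⟨l, w, hl, hl'⟩

theorem caseTwo_or_caseThree [CharZero K] [FiniteDimensional K g]
    (h : ∀ n, center K (tower K g n) ≠ ⊥) :
    CaseTwo K g ∨ CaseThree K g := by
  have hmono : Monotone (fun n => finrank K (tower K g n)) := monotone_nat_of_le_succ fun n => by
    obtain ⟨l, x, hx, hl⟩ := exists_tower_functional h n
    exact finrank_le_finrank_derivation hl hx
  by_cases hlim : Filter.Tendsto (fun n => finrank K (tower K g n)) Filter.atTop Filter.atTop
  · exact Or.inr ⟨hmono, hlim⟩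
  · left
    have hb : ∃ b, ∀ n, finrank K (tower K g n) ≤ b := by
      by_contra! hb
      exact hlim (Filter.tendsto_atTop_atTop_of_monotone hmono fun b =>
        (hb b).imp fun _ h => h.le)
    -- A bounded nondecreasing sequence is eventually constant. Equality is used at `q`, `q + 1` and
    -- `q + 2`: the central element of `g_q` is found from the codimension-one statement for
    -- `g_{q+1}`.
    obtain ⟨q, hq⟩ : ∃ q, ∀ n, q ≤ n → finrank K (tower K g n) = finrank K (tower K g q) := by
      obtain ⟨b, hb⟩ := hb
      have hfin : (Set.range fun n => finrank K (tower K g n)).Finite :=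
        (Set.finite_Iic b).subset (by rintro _ ⟨n, rfl⟩; exact hb n)
      obtain ⟨_, ⟨q, rfl⟩, hq⟩ := hfin.exists_maximal (Set.range_nonempty _)
      exact ⟨q, fun n hn => le_antisymm (hq ⟨n, rfl⟩ (hmono hn)) (hmono hn)⟩
    obtain ⟨l, x, hx, hl⟩ := exists_tower_functional h q
    obtain ⟨l₁, D, hD, hl₁⟩ := exists_tower_functional h (q + 1)
    have hL : finrank K (LieDerivation K (tower K g q) (tower K g q)) ≤ finrank K (tower K g q) :=
      (hq (q + 1) (Nat.le_succ q)).le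
    have hL' : finrank K (LieDerivation K (tower K g (q + 1)) (tower K g (q + 1))) ≤
        finrank K (tower K g (q + 1)) :=
      ((hq (q + 2) (Nat.le_add_right q 2)).trans (hq (q + 1) (Nat.le_succ q)).symm).le
    have hP : ∀ v, l v = 0 → v ∈ derivedIdeal K (tower K g q) := fun v hv =>
      mem_derivedIdeal_of_apply_eq_zero hl hx (h q) hL hv
    obtain ⟨z, hz, hlz⟩ := exists_mem_center_apply_eq_one hl hx hL (h q) hD fun E hE =>
      mem_derivedIdeal_of_apply_eq_zero hl₁ hD (h (q + 1)) hL' hE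
    exact ⟨h, q, terminatesAt_of_nonempty_equiv
      (nonempty_derivation_equiv hl hz hlz hP hL (h (q + 1))),
      nonempty_equiv_prod hl hz hlz hP, isPerfect_derivedIdeal hl hz hlz hP,
      isComplete_derivedIdeal hl hz hlz hP hL (h (q + 1))⟩

end DerTower

theorem mainTheorem4 (K : Type u) [Field K] [CharZero K] (g : Type v) [LieRing g]
    [LieAlgebra K g] [FiniteDimensional K g] :
    (DerTower.CaseOne K g ∨ DerTower.CaseTwo K g ∨ DerTower.CaseThree K g) ∧
      ¬ (DerTower.CaseOne K g ∧ DerTower.CaseTwo K g) ∧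
      ¬ (DerTower.CaseOne K g ∧ DerTower.CaseThree K g) ∧
      ¬ (DerTower.CaseTwo K g ∧ DerTower.CaseThree K g) := by
  refine ⟨?_, ?_, ?_, ?_⟩
  · by_cases h : ∀ n, LieAlgebra.center K (DerTower.tower K g n) ≠ ⊥
    · exact Or.inr (DerTower.caseTwo_or_caseThree h)
    · push Not at h
      obtain ⟨p, hp⟩ := h
      exact Or.inl (DerTower.caseOne_of_center_eq_bot hp)
  · rintro ⟨⟨⟨n, hn⟩, -⟩, h, -⟩
    exact h n (hn n le_rfl)
  · rintro ⟨⟨-, ⟨q, hq, -⟩, -⟩, h⟩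
    exact hq.not_caseThree h
  · rintro ⟨⟨-, q, hq, -⟩, h⟩
    exact hq.not_caseThree h
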